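/- Let $\nu\in\mathbb C$, $\delta\in\mathbb Z/2\mathbb Z$, and let $(a_n)_{n\ge 1}$ be complex numbers growing at most polynomially in $n$; put $a_{-n}=(-1)^\delta a_n$ and $e(u)=e^{2\pi i u}$. Then $L(s)=\sum_{n\ge1}a_n n^{-s}$ converges absolutely for $\operatorname{Re}s\gg0$, and the series $$\tau(x)=\sum_{n\ne0}|n|^{-\nu}a_n\,e(nx)$$ converges to a tempered distribution $\tau$ on $\mathbb R$ of parity $\delta$, i.e. $\tau(-x)=(-1)^\delta\tau(x)$. Let $G_\delta(s)=2\,i^\delta(2\pi)^{-s}\Gamma(s)\cos(\pi(s-\delta)/2)$ (with $\delta$ represented by $0$ or $1$). Then $\tau$ vanishes to infinite order at $x=0$ if and only if both $L(s)$ and $G_\delta(s-\nu)L(s)$ extend from a right half plane to entire functions of moderate growth on vertical strips. Here a distribution $\sigma$ on $\mathbb R$ vanishes to order $k\ge0$ at $0$ if, on some open neighborhood $U$ of $0$, $\sigma=\sum_{j=1}^N f_jD_jh_j$ as distributions, with $f_j\in C^\infty(U)$ vanishing to order $k$ at $0$, $h_j\in L^\infty_{\rm loc}(U)$, and linear differential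 operators $D_j$ on $U$ with smooth coefficients that are tangential to $\{0\}$, i.e. for every $m\geq 0$ map smooth functions vanishing to order $m$ at $0$ to functions vanishing to order $m$ at $0$; it vanishes to infinite order if it vanishes to order $k$ for every $k\ge0$. An entire function $H$ has moderate growth on vertical strips if for all real $a'<b'$ there are $T,C>0$ and $N\in\mathbb N$ with $|H(s)|\le C|\operatorname{Im}s|^N$ whenever $a'\le\operatorname{Re}s\le b'$ and $|\operatorname{Im}s|\ge T$. -/

import Mathlib

open MeasureTheory
open scoped SchwartzMap ContDiff

noncomputable section

namespace InfOrder

/-! ### Order of vanishing of a distribution at the origin of the real line -/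

/-- A function, smooth near `0`, vanishes to order `k` at `0` in the classical sense, i.e. it lies in
the `k`-th power of the ideal of smooth functions vanishing at `0`: its derivatives of order `< k`
vanish at `0`. -/
def FunVanishesToOrder (k : ℕ) (f : ℝ → ℂ) : Prop :=
  ∀ m < k, iteratedDeriv m f 0 = 0

/-- A linear differential operator `∑_{i ≤ order} coeff i · (d/dx)^i` on `U ⊆ ℝ`, with complex
valued coefficients that are smooth on `U`. -/
structure DiffOp (U : Set ℝ) where
  order : ℕ
  coeff : ℕ → ℝ → ℂ
  smooth : ∀ i ≤ order, ContDiffOn ℝ ∞ (coeff i) U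

namespace DiffOp

variable {U : Set ℝ}

/-- The action of the differential operator on functions (meaningful at the points of `U` when `U`
is open and `u` is smooth on `U`). -/
def apply (D : DiffOp U) (u : ℝ → ℂ) (x : ℝ) : ℂ :=
  ∑ i ∈ Finset.range (D.order + 1), D.coeff i x * iteratedDeriv i u x

/-- The transposed operator `u ↦ ∑ (-1)^i (d/dx)^i (coeff i · u)`. It is applied below to smooth
functions `u` with compact support in `U`. -/
def transpose (D : DiffOp U) (u : ℝ → ℂ) (x : ℝ) : ℂ :=
  ∑ i ∈ Finset.range (D.order + 1), (-1) ^ i * iteratedDeriv i (fun y => D.coeff i y * u y) x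

/-- `D` is tangential to `{0}`: it maps, for every `k`, smooth functions on `U` that vanish to
order `k` at `0` to functions that vanish to order `k` at `0`. -/
def IsTangential (D : DiffOp U) : Prop :=
  ∀ (k : ℕ) (u : ℝ → ℂ), ContDiffOn ℝ ∞ u U → FunVanishesToOrder k u →
    FunVanishesToOrder k (D.apply u)

end DiffOp

/-- `h ∈ L^∞_loc(U)`. -/
def LocBounded (h : ℝ → ℂ) (U : Set ℝ) : Prop :=
  ∀ K ⊆ U, IsCompact K → MemLp h ⊤ (volume.restrict K)

/-- The distribution `σ` vanishes to order `k ≥ 0` at the origin: on some open neighbourhood `U` of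
`0`, `σ = ∑_j f_j D_j h_j` as distributions, with differential operators `D_j` on `U` tangential to
`{0}`, `h_j ∈ L^∞_loc(U)`, and `f_j ∈ C^∞(U)` vanishing to order `k` at `0`.
The equality is tested on smooth functions `φ` with compact support in `U`; the value of
`f D h` on `φ` is `∫ h · Dᵗ (f φ) dx`. -/
def VanishesToOrder (σ : 𝓢'(ℝ, ℂ)) (k : ℕ) : Prop :=
  ∃ U : Set ℝ, IsOpen U ∧ (0 : ℝ) ∈ U ∧
    ∃ (N : ℕ) (f : Fin N → ℝ → ℂ) (D : Fin N → DiffOp U) (h : Fin N → ℝ → ℂ),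
      (∀ j, ContDiffOn ℝ ∞ (f j) U ∧ FunVanishesToOrder k (f j)) ∧
      (∀ j, (D j).IsTangential) ∧
      (∀ j, LocBounded (h j) U) ∧
      ∀ φ : 𝓢(ℝ, ℂ), HasCompactSupport φ → tsupport φ ⊆ U →
        σ φ = ∑ j, ∫ x : ℝ, h j x * (D j).transpose (fun y => f j y * φ y) x

/-- `σ` vanishes to infinite order at the origin. -/
def VanishesToInfiniteOrder (σ : 𝓢'(ℝ, ℂ)) : Prop :=
  ∀ k : ℕ, VanishesToOrder σ k

/-! ### The Fourier series `∑_{n ≠ 0} |n|^{-ν} a_n e(nx)` -/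

/-- `e(u) = exp(2πiu)`. -/
def e (u : ℝ) : ℂ := Complex.exp (2 * Real.pi * Complex.I * u)

/-- The series `∑_{n ≠ 0} |n|^{-ν} a_n e(nx)` converges, in the space of tempered distributions
(with its weak topology), to `τ`. This determines `τ`. -/
def IsFourierSeries (ν : ℂ) (a : ℤ → ℂ) (τ : 𝓢'(ℝ, ℂ)) : Prop :=
  ∀ φ : 𝓢(ℝ, ℂ),
    HasSum (fun n : {n : ℤ // n ≠ 0} =>
      (((|(n : ℤ)| : ℤ) : ℂ) ^ (-ν)) * a n * ∫ x : ℝ, e ((n : ℤ) * x) * φ x) (τ φ)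

/-- `τ` has parity `δ`, i.e. `τ(-x) = (-1)^δ τ(x)`. -/
def HasParity (δ : ZMod 2) (τ : 𝓢'(ℝ, ℂ)) : Prop :=
  ∀ φ ψ : 𝓢(ℝ, ℂ), (∀ x, ψ x = φ (-x)) → τ ψ = (-1) ^ δ.val * τ φ

/-! ### Gamma factors and analytic continuation -/

/-- `G_δ(s) = 2 i^δ (2π)^{-s} Γ(s) cos(π(s-δ)/2)`. The right-hand side depends only on `δ`
modulo 2. -/
def G (δ : ZMod 2) (s : ℂ) : ℂ :=
  2 * Complex.I ^ δ.val * (2 * Real.pi : ℂ) ^ (-s) * Complex.Gamma s *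
    Complex.cos (Real.pi * (s - δ.val) / 2)

/-- `H` has moderate growth on vertical strips: on each strip `a' ≤ Re s ≤ b'`, it is
`O(|Im s|^N)` as `|Im s| → ∞`, for some `N`, uniformly in the strip. -/
def ModerateGrowth (H : ℂ → ℂ) : Prop :=
  ∀ a' b' : ℝ, a' < b' → ∃ T > (0 : ℝ), ∃ C > (0 : ℝ), ∃ N : ℕ,
    ∀ s : ℂ, a' ≤ s.re → s.re ≤ b' → T ≤ |s.im| → ‖H s‖ ≤ C * |s.im| ^ N

/-- The function `F`, given on some right half plane, extends to an entire function of moderate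
growth on vertical strips. -/
def ExtendsToEntireOfModerateGrowth (F : ℂ → ℂ) : Prop :=
  ∃ H : ℂ → ℂ, Differentiable ℂ H ∧ ModerateGrowth H ∧
    ∃ c : ℝ, ∀ s : ℂ, c < s.re → H s = F s

end InfOrder

end

noncomputable section

namespace InfOrder

open Filter Topology Set FourierTransform Asymptotics

/-! Put `b n = n^{-ν} a n` (`coef`). Its Dirichlet series at `s` is `L(s + ν)` (`lseries_coef`), so
a translation by `ν` reduces everything to `b`. Folding `n` with `-n` turns the pairing of `τ` with
`φ` into `∑_{n ≥ 1} b n · g(n)`, where `g = parFourier δ φ` (`IsFourierSeries.hasSum`). Two facts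
link this sum to the two analytic conditions. The Mellin transform of `θ(v) = ∑ b n · g(n v)` is the
Dirichlet series times the Mellin transform of `g` (`PolySeq.mellin_theta`). The Mellin transform of
`g` at `s` is `G δ s` times that of the parity part of `φ` at `1 - s` (`mellin_parFourier`).

Vanishing implies continuation. Up to the factor `v⁻¹`, `θ(v)` is `τ` tested on `x ↦ φ(x / v)`
(`theta_eq`). A distribution vanishing to order `k` at `0` gives `O(y^{-k})` on `φ(y x)` as `y → ∞`
(`VanishesToOrder.dominated_dil`): a tangential operator of order `i` has an `i`-th coefficient
vanishing to order `i`, which pays for `i` derivatives of the dilate. Hence `θ` decays rapidly at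
`0`; at `∞` it does so anyway, there being no term `n = 0`. Its Mellin transform is therefore
entire. Taking `φ` to be the Fourier transform of a bump on `[1, 2]` isolates the Dirichlet series,
and taking `φ` to be the bump itself isolates `G δ` times it. The bumps `β(x) x^{it}`, with `t`
following `Im s`, have Mellin transforms bounded below on vertical strips and seminorms polynomial
in `t`; dividing by these transforms gives moderate growth (`extends_of_family`).

Continuation implies vanishing. Mellin inversion writes `τ φ` as an integral over a vertical line
far to the right (`hasSum_eq_integral`). Continuation of the Dirichlet series allows a shift to `Re
s = 1/2`, where the functional equation applies; continuation of the product with `G δ` then allows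
a shift to `Re s = -(k + 1/2)` (`IsFourierSeries.eq_integral`). The shift by `k` appears as
multiplication by `x^k`. Dividing the density by a polynomial makes it integrable and appears as
`(d/dx)^m x^m` on the test function. What remains is `τ = x^k · x^m (d/dx)^m h` with `h` of size
`O(|x|^{1/2})`, which is vanishing to order `k` (`IsFourierSeries.vanishesToOrder`). -/

/-! ### Sequences of polynomial growth and the functional `ψ ↦ ∑ b n ψ(n)` -/

/-- A sequence on `ℕ` that vanishes at `0` and grows at most polynomially. -/
def PolySeq (b : ℕ → ℂ) : Prop :=
  b 0 = 0 ∧ ∃ C : ℝ, 0 ≤ C ∧ ∃ N : ℕ, ∀ n : ℕ, 1 ≤ n → ‖b n‖ ≤ C * (n : ℝ) ^ N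

/-- The coefficients `n^{-ν} a_n` for `n ≥ 1`. -/
def coef (ν : ℂ) (a : ℤ → ℂ) (n : ℕ) : ℂ :=
  if n = 0 then 0 else (n : ℂ) ^ (-ν) * a n

lemma polySeq_coef (ν : ℂ) {a : ℤ → ℂ}
    (h : ∃ (C : ℝ) (N : ℕ), ∀ n : ℕ, 1 ≤ n → ‖a n‖ ≤ C * (n : ℝ) ^ N) : PolySeq (coef ν a) := by
  obtain ⟨C, N, h⟩ := h
  refine ⟨by simp [coef], |C|, abs_nonneg _, ⌈-ν.re⌉₊ + N, fun n hn => ?_⟩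
  have h1 : (1 : ℝ) ≤ n := by exact_mod_cast hn
  have h2 : ‖(n : ℂ) ^ (-ν)‖ ≤ (n : ℝ) ^ ⌈-ν.re⌉₊ := by
    rw [Complex.norm_natCast_cpow_of_pos (by omega), ← Real.rpow_natCast]
    exact Real.rpow_le_rpow_of_exponent_le h1 (by simpa using Nat.le_ceil (-ν.re))
  have h3 : ‖a n‖ ≤ |C| * (n : ℝ) ^ N :=
    (h n hn).trans (mul_le_mul_of_nonneg_right (le_abs_self C) (by positivity))
  rw [coef, if_neg (by omega), norm_mul, pow_add]
  calc _ ≤ (n : ℝ) ^ ⌈-ν.re⌉₊ * (|C| * (n : ℝ) ^ N) := by gcongr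
    _ = _ := by ring

/-- The exponent `N + 2 + K` splits by purpose: `N` absorbs the growth of `b`, `2` makes the sum
over `n` converge, and `K` is spare decay in `v`. -/
lemma PolySeq.norm_mul_le {b : ℕ → ℂ} {C : ℝ} (hC : 0 ≤ C) {N : ℕ} (h0 : b 0 = 0)
    (hb : ∀ n : ℕ, 1 ≤ n → ‖b n‖ ≤ C * (n : ℝ) ^ N) {g : ℝ → ℂ} {S : ℝ} {K : ℕ}
    (hg : ∀ x, |x| ^ (N + 2 + K) * ‖g x‖ ≤ S) {v : ℝ} (hv : 0 < v) (n : ℕ) :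
    ‖b n * g (n * v)‖ ≤ C * S * (v ^ (N + 2 + K))⁻¹ * ((n : ℝ) ^ 2)⁻¹ := by
  have hS : 0 ≤ S := le_trans (by positivity) (hg 0)
  rcases Nat.eq_zero_or_pos n with rfl | hn
  · simp [h0]
  have h1 : (1 : ℝ) ≤ n := by exact_mod_cast hn
  have h2 := hg (n * v)
  rw [abs_of_pos (by positivity)] at h2
  have h3 : ‖g (n * v)‖ ≤ S * (((n : ℝ) * v) ^ (N + 2 + K))⁻¹ := by
    rw [← div_eq_mul_inv, le_div_iff₀ (by positivity), mul_comm]; exact h2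
  have h4 : ((n : ℝ) ^ K)⁻¹ ≤ 1 := inv_le_one_of_one_le₀ (one_le_pow₀ h1)
  rw [norm_mul]
  calc ‖b n‖ * ‖g (n * v)‖ ≤ (C * (n : ℝ) ^ N) * (S * (((n : ℝ) * v) ^ (N + 2 + K))⁻¹) := by
        gcongr; exact hb n hn
    _ = C * S * (v ^ (N + 2 + K))⁻¹ * ((n : ℝ) ^ 2)⁻¹ * ((n : ℝ) ^ K)⁻¹ := by
        field_simp; ring
    _ ≤ C * S * (v ^ (N + 2 + K))⁻¹ * ((n : ℝ) ^ 2)⁻¹ * 1 := by gcongr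
    _ = _ := mul_one _

lemma summable_inv_natCast_sq : Summable fun n : ℕ => ((n : ℝ) ^ 2)⁻¹ :=
  Real.summable_nat_pow_inv.2 one_lt_two

lemma abs_pow_mul_norm_le_seminorm (φ : 𝓢(ℝ, ℂ)) (K : ℕ) (x : ℝ) :
    |x| ^ K * ‖φ x‖ ≤ SchwartzMap.seminorm ℂ K 0 φ := by
  simpa using SchwartzMap.norm_pow_mul_le_seminorm ℂ φ K x

lemma PolySeq.summable_norm {b : ℕ → ℂ} (hb : PolySeq b) (ψ : 𝓢(ℝ, ℂ)) {v : ℝ} (hv : 0 < v) :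
    Summable fun n : ℕ => ‖b n * ψ (n * v)‖ := by
  obtain ⟨h0, C, hC, N, hb⟩ := hb
  refine Summable.of_nonneg_of_le (fun _ => norm_nonneg _)
    (PolySeq.norm_mul_le hC h0 hb (K := 0) (abs_pow_mul_norm_le_seminorm ψ _) hv) ?_
  exact summable_inv_natCast_sq.mul_left _

lemma PolySeq.summable {b : ℕ → ℂ} (hb : PolySeq b) (ψ : 𝓢(ℝ, ℂ)) :
    Summable fun n : ℕ => b n * ψ n := by
  simpa using (hb.summable_norm ψ one_pos).of_norm

/-- The functional `ψ ↦ ∑ b n ψ(n)`. -/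
def sumCLM {b : ℕ → ℂ} (hb : PolySeq b) : 𝓢(ℝ, ℂ) →L[ℂ] ℂ :=
  SchwartzMap.mkCLMtoNormedSpace (fun ψ => ∑' n : ℕ, b n * ψ n)
    (fun f g => by
      rw [← (hb.summable f).tsum_add (hb.summable g)]
      simp [mul_add])
    (fun c f => by
      simp only [RingHom.id_apply, smul_eq_mul]
      rw [← tsum_mul_left]
      refine tsum_congr fun n => ?_
      simp only [smul_apply, smul_eq_mul]; ring)
    (by
      obtain ⟨h0, C, hC, N, hb⟩ := hb
      refine ⟨{(N + 2, 0)}, C * ∑' n : ℕ, ((n : ℝ) ^ 2)⁻¹,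
        mul_nonneg hC (tsum_nonneg fun n => by positivity), fun ψ => ?_⟩
      have h1 := PolySeq.norm_mul_le hC h0 hb (K := 0) (abs_pow_mul_norm_le_seminorm ψ _) one_pos
      simp only [mul_one, one_pow, inv_one] at h1
      refine (tsum_of_norm_bounded (summable_inv_natCast_sq.mul_left _).hasSum h1).trans ?_
      rw [tsum_mul_left, Finset.sup_singleton, SchwartzMap.schwartzSeminormFamily_apply]
      apply le_of_eq; simp only [add_zero]; ring)

lemma sumCLM_hasSum {b : ℕ → ℂ} (hb : PolySeq b) (ψ : 𝓢(ℝ, ℂ)) :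
    HasSum (fun n : ℕ => b n * ψ n) (sumCLM hb ψ) :=
  (hb.summable ψ).hasSum

/-! ### The parity part of the Fourier transform -/

/-- The sign `(-1)^δ`. -/
def sgn (δ : ZMod 2) : ℂ := (-1) ^ δ.val

lemma sgn_mul_self (δ : ZMod 2) : sgn δ * sgn δ = 1 := by
  rw [sgn, ← mul_pow]; simp

/-- `φ ↦ 𝓕⁻ φ + (-1)^δ 𝓕 φ`. -/
def parFourier (δ : ZMod 2) : 𝓢(ℝ, ℂ) →L[ℂ] 𝓢(ℝ, ℂ) :=
  fourierInvCLM ℂ 𝓢(ℝ, ℂ) + sgn δ • fourierCLM ℂ 𝓢(ℝ, ℂ)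

lemma parFourier_apply (δ : ZMod 2) (φ : 𝓢(ℝ, ℂ)) (x : ℝ) :
    parFourier δ φ x = 𝓕⁻ (φ : ℝ → ℂ) x + sgn δ * 𝓕 (φ : ℝ → ℂ) x := by
  simp [parFourier, SchwartzMap.fourier_coe, SchwartzMap.fourierInv_coe]

lemma integral_e_mul (φ : ℝ → ℂ) (w : ℝ) : ∫ x : ℝ, e (w * x) * φ x = 𝓕⁻ φ w := by
  rw [Real.fourierInv_eq']
  refine integral_congr_ae (Eventually.of_forall fun x => ?_)
  simp only [e, smul_eq_mul, RCLike.inner_apply, conj_trivial]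
  congr 2
  push_cast; ring

lemma IsFourierSeries.hasSum {ν : ℂ} {δ : ZMod 2} {a : ℤ → ℂ}
    (hpar : ∀ n : ℕ, 1 ≤ n → a (-(n : ℤ)) = (-1) ^ δ.val * a n) {τ : 𝓢'(ℝ, ℂ)}
    (hτ : IsFourierSeries ν a τ) (φ : 𝓢(ℝ, ℂ)) :
    HasSum (fun n : ℕ => coef ν a n * parFourier δ φ n) (τ φ) := by
  have h1 := hasSum_subtype_iff_indicator (s := {n : ℤ | n ≠ 0})
    (f := fun n : ℤ => (((|n| : ℤ) : ℂ) ^ (-ν)) * a n * ∫ x : ℝ, e (n * x) * φ x)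
    (a := τ φ) |>.1 (hτ φ)
  -- Pairing `n` with `-n` counts `n = 0` twice; the indicator makes that term zero.
  have h2 := h1.nat_add_neg
  simp only [mem_ofPred_eq, ne_eq, not_true_eq_false, not_false_eq_true, indicator_of_notMem,
    add_zero] at h2
  convert h2 using 2 with n
  rcases Nat.eq_zero_or_pos n with rfl | hn
  · simp [coef]
  have h3 : (n : ℤ) ∈ {n : ℤ | ¬ n = 0} := by simp; omega
  have h4 : (-n : ℤ) ∈ {n : ℤ | ¬ n = 0} := by simp; omega
  rw [indicator_of_mem h3, indicator_of_mem h4, hpar n hn, abs_neg, parFourier_apply, coef,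
    if_neg (by omega), integral_e_mul, integral_e_mul, Nat.abs_cast, sgn]
  push_cast
  rw [Real.fourierInv_eq_fourier_neg (φ : ℝ → ℂ) (-(n : ℝ)), neg_neg]
  ring

lemma exists_isFourierSeries {ν : ℂ} {δ : ZMod 2} {a : ℤ → ℂ}
    (hpar : ∀ n : ℕ, 1 ≤ n → a (-(n : ℤ)) = (-1) ^ δ.val * a n)
    (hb : PolySeq (coef ν a)) : ∃ τ : 𝓢'(ℝ, ℂ), IsFourierSeries ν a τ := by
  refine ⟨ContinuousLinearMap.toPointwiseConvergenceCLM _ _ _ _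
    ((sumCLM hb).comp (parFourier δ)), fun φ => ?_⟩
  set F : ℤ → ℂ := fun n : ℤ => (((|n| : ℤ) : ℂ) ^ (-ν)) * a n * ∫ x : ℝ, e (n * x) * φ x with hF
  refine (hasSum_subtype_iff_indicator (s := {n : ℤ | n ≠ 0}) (f := F)).2 ?_
  have h1 := sumCLM_hasSum hb (𝓕⁻ φ)
  have h2 := (sumCLM_hasSum hb (𝓕 φ)).mul_left (sgn δ)
  have h0 : indicator {n : ℤ | n ≠ 0} F 0 = 0 := by simp
  have h3 : HasSum (fun n : ℕ => indicator {n : ℤ | n ≠ 0} F n) (sumCLM hb (𝓕⁻ φ)) := by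
    convert h1 using 2 with n
    rcases Nat.eq_zero_or_pos n with rfl | hn
    · simp [coef]
    have h3 : (n : ℤ) ∈ {n : ℤ | n ≠ 0} := by simp; omega
    rw [indicator_of_mem h3, hF, coef, if_neg (by omega)]
    simp only [integral_e_mul, Nat.abs_cast, SchwartzMap.fourierInv_coe]
    push_cast; rfl
  have h4 : HasSum (fun n : ℕ => indicator {n : ℤ | n ≠ 0} F (-n))
      (sgn δ * sumCLM hb (𝓕 φ)) := by
    refine h2.congr_fun fun n => ?_
    rcases Nat.eq_zero_or_pos n with rfl | hn
    · simp [coef]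
    have h3 : (-n : ℤ) ∈ {n : ℤ | n ≠ 0} := by simp; omega
    rw [indicator_of_mem h3, hF, coef, if_neg (by omega)]
    simp only [integral_e_mul, abs_neg, Nat.abs_cast, SchwartzMap.fourier_coe, hpar n hn, sgn]
    push_cast
    rw [Real.fourierInv_eq_fourier_neg (φ : ℝ → ℂ) (-(n : ℝ)), neg_neg]
    ring
  have h5 := HasSum.of_nat_of_neg h3 h4
  rw [h0, sub_zero] at h5
  have h6 : sumCLM hb (parFourier δ φ) = sumCLM hb (𝓕⁻ φ) + sgn δ * sumCLM hb (𝓕 φ) := by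
    simp [parFourier]
  rw [← h6] at h5
  exact h5

/-- Reflection exchanges `𝓕` and `𝓕⁻`, hence multiplies `parFourier δ` by `sgn δ`, whose square is
`1`. -/
lemma IsFourierSeries.hasParity {ν : ℂ} {δ : ZMod 2} {a : ℤ → ℂ}
    (hpar : ∀ n : ℕ, 1 ≤ n → a (-(n : ℤ)) = (-1) ^ δ.val * a n) {τ : 𝓢'(ℝ, ℂ)}
    (hτ : IsFourierSeries ν a τ) : HasParity δ τ := by
  intro φ ψ h
  have h1 : (ψ : ℝ → ℂ) = fun x => φ (-x) := funext h
  have h2 := (hτ.hasSum hpar φ).mul_left (sgn δ)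
  refine (hτ.hasSum hpar ψ).unique ?_
  refine h2.congr_fun fun n => ?_
  have h3 : 𝓕 (ψ : ℝ → ℂ) n = 𝓕⁻ (φ : ℝ → ℂ) n := by
    rw [h1, Real.fourierInv_eq_fourier_comp_neg]
  have h4 : 𝓕⁻ (ψ : ℝ → ℂ) n = 𝓕 (φ : ℝ → ℂ) n := by
    rw [h1, Real.fourierInv_eq_fourier_comp_neg]; simp
  rw [parFourier_apply, parFourier_apply, h3, h4]
  linear_combination (-coef ν a n * 𝓕 (φ : ℝ → ℂ) n) * sgn_mul_self δ

/-! ### Mellin transforms of Schwartz functions and of `v ↦ ∑ b n g(n v)` -/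

lemma isBigO_atTop_rpow (g : 𝓢(ℝ, ℂ)) (r : ℝ) :
    (g : ℝ → ℂ) =O[atTop] fun x : ℝ => x ^ (-r) := by
  set K := ⌈r⌉₊
  refine IsBigO.of_bound (SchwartzMap.seminorm ℂ K 0 g) ?_
  filter_upwards [eventually_ge_atTop 1] with x hx
  have h0 : 0 < x := by linarith
  have h1 := abs_pow_mul_norm_le_seminorm g K x
  rw [abs_of_pos h0] at h1
  rw [Real.norm_of_nonneg (by positivity), Real.rpow_neg h0.le, ← div_eq_mul_inv,
    le_div_iff₀ (by positivity), mul_comm]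
  refine le_trans (mul_le_mul_of_nonneg_right ?_ (norm_nonneg _)) h1
  rw [← Real.rpow_natCast]
  exact Real.rpow_le_rpow_of_exponent_le hx (Nat.le_ceil r)

lemma isBigO_zero_rpow (g : 𝓢(ℝ, ℂ)) :
    (g : ℝ → ℂ) =O[𝓝[>] 0] fun x : ℝ => x ^ (-(0 : ℝ)) := by
  refine IsBigO.of_bound (SchwartzMap.seminorm ℂ 0 0 g) (Eventually.of_forall fun x => ?_)
  simpa using SchwartzMap.norm_le_seminorm ℂ g x

lemma mellinConvergent_schwartz (g : 𝓢(ℝ, ℂ)) {s : ℂ} (hs : 0 < s.re) :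
    MellinConvergent g s :=
  mellinConvergent_of_isBigO_rpow (a := s.re + 1) (b := 0)
    (g.continuous.locallyIntegrable.locallyIntegrableOn _) (isBigO_atTop_rpow g _) (by linarith)
    (isBigO_zero_rpow g) hs

lemma mellin_schwartz_differentiableAt (g : 𝓢(ℝ, ℂ)) {s : ℂ} (hs : 0 < s.re) :
    DifferentiableAt ℂ (mellin g) s :=
  mellin_differentiableAt_of_isBigO_rpow (a := s.re + 1) (b := 0)
    (g.continuous.locallyIntegrable.locallyIntegrableOn _) (isBigO_atTop_rpow g _) (by linarith)
    (isBigO_zero_rpow g) hs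

/-- The series `∑ b n g(n v)`. -/
def theta (b : ℕ → ℂ) (g : ℝ → ℂ) (v : ℝ) : ℂ := ∑' n : ℕ, b n * g (n * v)

/-- The exponent `p` and the constant depend on `b` and `K` only. This uniformity in `g` is what
later gives bounds along families of test functions. -/
lemma PolySeq.norm_theta_le {b : ℕ → ℂ} (hb : PolySeq b) (K : ℕ) :
    ∃ C : ℝ, 0 ≤ C ∧ ∃ p : ℕ, ∀ (g : 𝓢(ℝ, ℂ)) (v : ℝ), 1 ≤ v →
      ‖theta b g v‖ ≤ C * SchwartzMap.seminorm ℂ p 0 g * (v ^ K)⁻¹ := by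
  obtain ⟨h0, C, hC, N, hb⟩ := hb
  refine ⟨C * ∑' n : ℕ, ((n : ℝ) ^ 2)⁻¹, mul_nonneg hC (tsum_nonneg fun n => by positivity),
    N + 2 + K, fun g v hv => ?_⟩
  have hv0 : 0 < v := by linarith
  refine (tsum_of_norm_bounded (summable_inv_natCast_sq.mul_left _).hasSum
    (PolySeq.norm_mul_le hC h0 hb (K := K) (abs_pow_mul_norm_le_seminorm g _) hv0)).trans ?_
  rw [tsum_mul_left]
  have h1 : (v ^ (N + 2 + K))⁻¹ ≤ (v ^ K)⁻¹ :=
    inv_anti₀ (by positivity) (pow_le_pow_right₀ hv (by omega))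
  have h2 : 0 ≤ ∑' n : ℕ, ((n : ℝ) ^ 2)⁻¹ := tsum_nonneg fun n => by positivity
  have h3 : 0 ≤ SchwartzMap.seminorm ℂ (N + 2 + K) 0 g := apply_nonneg _ _
  calc _ = C * (∑' n : ℕ, ((n : ℝ) ^ 2)⁻¹) * SchwartzMap.seminorm ℂ (N + 2 + K) 0 g *
        (v ^ (N + 2 + K))⁻¹ := by ring
    _ ≤ _ := by gcongr

lemma PolySeq.continuousOn_theta {b : ℕ → ℂ} (hb : PolySeq b) (g : 𝓢(ℝ, ℂ)) :
    ContinuousOn (theta b g) (Ioi 0) := by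
  obtain ⟨h0, C, hC, N, hb⟩ := hb
  intro v hv
  have hv : 0 < v := hv
  have h1 : ContinuousOn (theta b g) (Ioi (v / 2)) := by
    refine continuousOn_tsum (u := fun n : ℕ => C * SchwartzMap.seminorm ℂ (N + 2) 0 g *
      ((v / 2) ^ (N + 2))⁻¹ * ((n : ℝ) ^ 2)⁻¹)
      (fun n => ?_) (summable_inv_natCast_sq.mul_left _) fun n x hx => ?_
    · exact (continuous_const.mul (g.continuous.comp (by fun_prop))).continuousOn
    · have hx : v / 2 < x := hx
      have h2 := PolySeq.norm_mul_le hC h0 hb (K := 0) (abs_pow_mul_norm_le_seminorm g _)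
        (show 0 < x by linarith) n
      have h3 : 0 ≤ SchwartzMap.seminorm ℂ (N + 2) 0 g := apply_nonneg _ _
      have h4 : (x ^ (N + 2))⁻¹ ≤ ((v / 2) ^ (N + 2))⁻¹ :=
        inv_anti₀ (by positivity) (pow_le_pow_left₀ (by positivity) hx.le _)
      refine h2.trans ?_
      simp only [add_zero]
      gcongr
  exact (h1.continuousAt (Ioi_mem_nhds (by linarith))).continuousWithinAt

lemma PolySeq.exists_lseriesSummable {b : ℕ → ℂ}
    (hb : ∃ C : ℝ, ∃ N : ℕ, ∀ n : ℕ, 1 ≤ n → ‖b n‖ ≤ C * (n : ℝ) ^ N) :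
    ∃ c : ℝ, ∀ s : ℂ, c < s.re → LSeriesSummable b s := by
  obtain ⟨C, N, h⟩ := hb
  refine ⟨N + 1, fun s hs => LSeriesSummable_of_le_const_mul_rpow (x := N + 1) hs
    ⟨C, fun n hn => ?_⟩⟩
  simpa using h n (by omega)

lemma lseries_coef (ν : ℂ) (a : ℤ → ℂ) (s : ℂ) :
    LSeries (coef ν a) s = LSeries (fun n : ℕ => a n) (s + ν) := by
  refine tsum_congr fun n => ?_
  rcases Nat.eq_zero_or_pos n with rfl | hn
  · simp
  have hn' : (n : ℂ) ≠ 0 := by exact_mod_cast (by omega : n ≠ 0)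
  rw [LSeries.term_of_ne_zero (by omega), LSeries.term_of_ne_zero (by omega), coef,
    if_neg (by omega), Complex.cpow_add _ _ hn', Complex.cpow_neg]
  field_simp

/-- Termwise, dilation by `n` contributes `n^{-s}` to the Mellin transform. The exchange of sum and
integral is justified by absolute convergence of the Dirichlet series. -/
lemma PolySeq.mellin_theta {b : ℕ → ℂ} (hb : PolySeq b) (g : 𝓢(ℝ, ℂ)) {s : ℂ} (hs : 0 < s.re)
    (hL : LSeriesSummable b s) :
    mellin (theta b g) s = LSeries b s * mellin g s := by
  have hg := mellinConvergent_schwartz g hs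
  set I : ℝ := ∫ t in Ioi (0 : ℝ), ‖(t : ℂ) ^ (s - 1) • g t‖ with hI
  have hterm : ∀ n : ℕ, ∫ t in Ioi (0 : ℝ), (t : ℂ) ^ (s - 1) • (b n * g (n * t)) =
      LSeries.term b s n * mellin g s := by
    intro n
    rcases Nat.eq_zero_or_pos n with rfl | hn
    · simp [hb.1]
    have h1 := mellin_comp_mul_left g s (a := n) (by exact_mod_cast hn)
    have h2 := mellin_const_smul (fun t : ℝ => g (n * t)) s (b n)
    simp only [smul_eq_mul] at h2
    rw [mellin] at h2
    rw [h2, h1, LSeries.term_of_ne_zero (by omega), Complex.cpow_neg]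
    simp only [smul_eq_mul, Complex.ofReal_natCast]; ring
  have hnorm : ∀ n : ℕ, ∫ t in Ioi (0 : ℝ), ‖(t : ℂ) ^ (s - 1) • (b n * g (n * t))‖ =
      ‖LSeries.term b s n‖ * I := by
    intro n
    rcases Nat.eq_zero_or_pos n with rfl | hn
    · simp [hb.1]
    have hn0 : (0 : ℝ) < n := by exact_mod_cast hn
    have h1 := integral_comp_mul_left_Ioi (fun t : ℝ => ‖(t : ℂ) ^ (s - 1) • g t‖) 0 hn0
    rw [mul_zero, ← hI] at h1
    have h2 : ∀ t ∈ Ioi (0 : ℝ), ‖(t : ℂ) ^ (s - 1) • (b n * g (n * t))‖ =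
        ‖b n‖ * ((n : ℝ) ^ (s.re - 1))⁻¹ * ‖((n * t : ℝ) : ℂ) ^ (s - 1) • g (n * t)‖ := by
      intro t ht
      have ht : 0 < t := ht
      simp only [norm_smul, norm_mul]
      rw [Complex.norm_cpow_eq_rpow_re_of_pos ht,
        Complex.norm_cpow_eq_rpow_re_of_pos (mul_pos hn0 ht), Complex.sub_re, Complex.one_re,
        Real.mul_rpow hn0.le ht.le]
      have : (n : ℝ) ^ (s.re - 1) ≠ 0 := (Real.rpow_pos_of_pos hn0 _).ne'
      field_simp
    rw [setIntegral_congr_fun measurableSet_Ioi h2, integral_const_mul, h1,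
      LSeries.term_of_ne_zero (by omega), norm_div, Complex.norm_natCast_cpow_of_pos hn,
      Real.rpow_sub hn0, Real.rpow_one]
    simp only [smul_eq_mul]
    field_simp
  have h3 := hasSum_integral_of_summable_integral_norm (μ := volume.restrict (Ioi (0 : ℝ)))
    (F := fun (n : ℕ) (t : ℝ) => (t : ℂ) ^ (s - 1) • (b n * g (n * t)))
    (fun n => by
      rcases Nat.eq_zero_or_pos n with rfl | hn
      · simp [hb.1]
      have h1 := (MellinConvergent.comp_mul_left (a := n) (by exact_mod_cast hn)).2 hg
      exact h1.const_smul (b n)) (by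
      simp only [hnorm]
      exact (hL.norm).mul_right I)
  simp only [hterm] at h3
  have h4 : mellin (theta b g) s = ∫ t in Ioi (0 : ℝ), ∑' n : ℕ,
      (t : ℂ) ^ (s - 1) • (b n * g (n * t)) := by
    rw [mellin]
    refine setIntegral_congr_fun measurableSet_Ioi fun t ht => ?_
    simp only [theta, smul_eq_mul]
    rw [tsum_mul_left]
  rw [h4, ← h3.tsum_eq, tsum_mul_right, LSeries]

/-! ### Mellin transforms of functions decaying rapidly at both ends -/

/-- `F` decays on `(0, ∞)` at both ends like the `K`-th power, with constant `P`. -/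
def DecaysBothEnds (F : ℝ → ℂ) (K : ℕ) (P : ℝ) : Prop :=
  (∀ v, 1 ≤ v → ‖F v‖ ≤ P * (v ^ K)⁻¹) ∧ ∀ v, 0 < v → v ≤ 1 → ‖F v‖ ≤ P * v ^ K

/-- With `K ≥ |Re s| + 1` the integrand is at most `P` on `(0, 1]` and `P v^{-2}` on `[1, ∞)`. Both
lie below `2P / (1 + v²)`, so one constant serves all `F`, `K` and `s`. -/
lemma exists_norm_mellin_le : ∃ C : ℝ, 0 ≤ C ∧ ∀ (F : ℝ → ℂ) (K : ℕ) (P : ℝ) (s : ℂ), 0 ≤ P →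
    DecaysBothEnds F K P → |s.re| + 1 ≤ K → ‖mellin F s‖ ≤ C * P := by
  refine ⟨∫ v in Ioi (0 : ℝ), 2 * (1 + v ^ 2)⁻¹, ?_, fun F K P s hP hF hK => ?_⟩
  · exact integral_nonneg fun v => by positivity
  have hσ := abs_le.1 (show |s.re| ≤ K - 1 by linarith)
  rw [← integral_mul_const]
  refine norm_integral_le_of_norm_le
    ((integrable_inv_one_add_sq.const_mul 2).mul_const P).integrableOn ?_
  refine (ae_restrict_iff' measurableSet_Ioi).2 (Eventually.of_forall fun v hv => ?_)
  have hv : 0 < v := hv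
  rw [norm_smul, Complex.norm_cpow_eq_rpow_re_of_pos hv, Complex.sub_re, Complex.one_re]
  rcases le_total v 1 with h | h
  · have h1 : v ^ (s.re - 1) * v ^ K ≤ 1 := by
      rw [← Real.rpow_natCast, ← Real.rpow_add hv]
      exact Real.rpow_le_one hv.le h (by linarith)
    have h2 : 1 ≤ 2 * (1 + v ^ 2)⁻¹ := by
      rw [← div_eq_mul_inv, le_div_iff₀ (by positivity)]; nlinarith
    calc _ ≤ v ^ (s.re - 1) * (P * v ^ K) := by gcongr; exact hF.2 v hv h
      _ = (v ^ (s.re - 1) * v ^ K) * P := by ring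
      _ ≤ _ := mul_le_mul_of_nonneg_right (h1.trans h2) hP
  · have h1 : v ^ (s.re - 1) * (v ^ K)⁻¹ ≤ (v ^ 2)⁻¹ := by
      rw [← Real.rpow_natCast, ← Real.rpow_neg hv.le, ← Real.rpow_add hv,
        ← Real.rpow_natCast v 2, ← Real.rpow_neg hv.le]
      exact Real.rpow_le_rpow_of_exponent_le h (by push_cast; linarith)
    have h2 : (v ^ 2)⁻¹ ≤ 2 * (1 + v ^ 2)⁻¹ := by
      rw [← div_eq_mul_inv, le_div_iff₀ (by positivity), inv_mul_le_iff₀ (by positivity)]; nlinarith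
    calc _ ≤ v ^ (s.re - 1) * (P * (v ^ K)⁻¹) := by gcongr; exact hF.1 v h
      _ = (v ^ (s.re - 1) * (v ^ K)⁻¹) * P := by ring
      _ ≤ _ := mul_le_mul_of_nonneg_right (h1.trans h2) hP

lemma differentiable_mellin_of_decaysBothEnds {F : ℝ → ℂ} (hF : ContinuousOn F (Ioi 0))
    (h : ∀ K : ℕ, ∃ P : ℝ, DecaysBothEnds F K P) : Differentiable ℂ (mellin F) := by
  intro s
  obtain ⟨K, hK⟩ := exists_nat_gt |s.re|
  obtain ⟨P, hP⟩ := h K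
  have hσ := abs_lt.1 hK
  refine mellin_differentiableAt_of_isBigO_rpow (a := K) (b := -K)
    (hF.locallyIntegrableOn measurableSet_Ioi) ?_ hσ.2 ?_ hσ.1
  · refine IsBigO.of_bound P ?_
    filter_upwards [eventually_ge_atTop 1] with v hv
    have hv0 : 0 < v := by linarith
    rw [Real.norm_of_nonneg (by positivity), Real.rpow_neg hv0.le, Real.rpow_natCast]
    exact hP.1 v hv
  · refine IsBigO.of_bound P ?_
    filter_upwards [Ioc_mem_nhdsGT one_pos] with v hv
    have hv0 : 0 < v := hv.1
    rw [Real.norm_of_nonneg (by positivity), neg_neg, Real.rpow_natCast]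
    exact hP.2 v hv.1 hv.2

/-! ### Order of vanishing of smooth functions -/

lemma contDiff_ofReal_pow (m : ℕ) : ContDiff ℝ ∞ fun x : ℝ => (x : ℂ) ^ m :=
  Complex.ofRealCLM.contDiff.pow m

lemma iteratedDeriv_ofReal_pow (m k : ℕ) (x : ℝ) :
    iteratedDeriv k (fun x : ℝ => (x : ℂ) ^ m) x = m.descFactorial k * (x : ℂ) ^ (m - k) := by
  induction k generalizing x with
  | zero => simp
  | succ k ih =>
    rw [iteratedDeriv_succ, funext ih]
    have h1 : HasDerivAt (fun x : ℝ => (m.descFactorial k : ℂ) * (x : ℂ) ^ (m - k))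
        (m.descFactorial k * (((m - k : ℕ) : ℂ) * (x : ℂ) ^ (m - k - 1) * 1)) x :=
      ((Complex.ofRealCLM.hasDerivAt (x := x)).pow (m - k)).const_mul _
    rw [h1.deriv, Nat.descFactorial_succ, Nat.sub_sub]
    push_cast; ring

lemma funVanishesToOrder_ofReal_pow (m : ℕ) : FunVanishesToOrder m fun x : ℝ => (x : ℂ) ^ m := by
  intro k hk
  rw [iteratedDeriv_ofReal_pow]
  simp [Nat.sub_ne_zero_of_lt hk]

lemma FunVanishesToOrder.mul {k l : ℕ} {f g : ℝ → ℂ} (hf : FunVanishesToOrder k f)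
    (hg : FunVanishesToOrder l g) (hf' : ContDiffAt ℝ ∞ f 0) (hg' : ContDiffAt ℝ ∞ g 0) :
    FunVanishesToOrder (k + l) fun x => f x * g x := by
  intro m hm
  have h := iteratedDeriv_mul (n := m) (hf'.of_le (by exact_mod_cast le_top))
    (hg'.of_le (by exact_mod_cast le_top))
  refine h.trans (Finset.sum_eq_zero fun i hi => ?_)
  have hi : i ≤ m := by simpa [Nat.lt_succ_iff] using hi
  rcases lt_or_ge i k with h | h
  · simp [hf i h]
  · simp [hg (m - i) (by omega)]

/-- Test `D` on `x^i`. Terms with `l > i` vanish; those with `l < i` carry `x^{i-l}` times a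
coefficient of order `l` by induction, so they have order `i`; what is left is `i!` times the `i`-th
coefficient. -/
lemma DiffOp.IsTangential.coeff_vanishes {U : Set ℝ} (hU : IsOpen U) (h0 : (0 : ℝ) ∈ U)
    {D : DiffOp U} (hD : D.IsTangential) (i : ℕ) (hi : i ≤ D.order) :
    FunVanishesToOrder i (D.coeff i) := by
  induction i using Nat.strong_induction_on with
  | _ i ih =>
  have hc : ∀ l ≤ D.order, ContDiffAt ℝ ∞ (D.coeff l) 0 := fun l hl =>
    (D.smooth l hl).contDiffAt (hU.mem_nhds h0)
  have h1 := hD i _ (contDiff_ofReal_pow i).contDiffOn (funVanishesToOrder_ofReal_pow i)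
  intro m hm
  have h2 := h1 m hm
  have h3 : D.apply (fun x : ℝ => (x : ℂ) ^ i) = fun x => ∑ l ∈ Finset.range (D.order + 1),
      D.coeff l x * (i.descFactorial l * (x : ℂ) ^ (i - l)) := by
    funext x; simp only [DiffOp.apply, iteratedDeriv_ofReal_pow]
  have hp : ∀ l : ℕ, ContDiffAt ℝ ∞ (fun x : ℝ => (i.descFactorial l : ℂ) * (x : ℂ) ^ (i - l)) 0 :=
    fun l => contDiffAt_const.mul (contDiff_ofReal_pow _).contDiffAt
  rw [h3, iteratedDeriv_fun_sum (fun l hl => ((hc l (by simpa [Nat.lt_succ_iff] using hl)).mul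
    (hp l)).of_le (by exact_mod_cast le_top)), Finset.sum_eq_single i] at h2
  · simp only [Nat.descFactorial_self, Nat.sub_self, pow_zero, mul_one,
      iteratedDeriv_mul_const_field] at h2
    exact (mul_eq_zero.1 h2).resolve_right (by exact_mod_cast i.factorial_ne_zero)
  · intro l hl hli
    have hl : l ≤ D.order := by simpa [Nat.lt_succ_iff] using hl
    rcases lt_or_gt_of_ne hli with h | h
    · have h4 := ((ih l h hl).mul (funVanishesToOrder_ofReal_pow (i - l)) (hc l hl)
        (contDiff_ofReal_pow _).contDiffAt) m (by omega)
      have h5 : (fun x : ℝ => D.coeff l x * ((i.descFactorial l : ℂ) * (x : ℂ) ^ (i - l))) =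
          fun x : ℝ => (i.descFactorial l : ℂ) * (D.coeff l x * (x : ℂ) ^ (i - l)) := by
        funext x; ring
      rw [h5, iteratedDeriv_const_mul_field, h4, mul_zero]
    · simp [Nat.descFactorial_eq_zero_iff_lt.2 h]
  · intro h; simp at h; omega

lemma exists_norm_le_pow {n : ℕ} {w : ℝ → ℂ} (hw : ContDiff ℝ ∞ w) (hc : HasCompactSupport w)
    (h : FunVanishesToOrder n w) : ∃ C : ℝ, 0 ≤ C ∧ ∀ x, ‖w x‖ ≤ C * |x| ^ n := by
  induction n generalizing w with
  | zero =>
    obtain ⟨C, hC⟩ := hw.continuous.bounded_above_of_compact_support hc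
    exact ⟨C, (norm_nonneg _).trans (hC 0), by simpa using hC⟩
  | succ n ih =>
    obtain ⟨C, hC0, hC⟩ := ih (w := deriv w) (contDiff_infty_iff_deriv.1 hw).2 hc.deriv
      (fun m hm => by rw [← iteratedDeriv_succ']; exact h (m + 1) (by omega))
    refine ⟨C, hC0, fun x => ?_⟩
    have h0 : w 0 = 0 := by simpa using h 0 (by omega)
    have h1 := (convex_uIcc (0 : ℝ) x).norm_image_sub_le_of_norm_deriv_le (f := w)
      (C := C * |x| ^ n) (fun y _ => (hw.differentiable (by simp)) y) (fun y hy => by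
        refine (hC y).trans ?_
        have : |y| ≤ |x| := by
          rcases mem_uIcc.1 hy with h | h
          · rw [abs_of_nonneg h.1, abs_of_nonneg (h.1.trans h.2)]; exact h.2
          · rw [abs_of_nonpos h.2, abs_of_nonpos (h.1.trans h.2)]; linarith [h.1]
        gcongr) left_mem_uIcc right_mem_uIcc
    rw [h0, sub_zero, sub_zero, Real.norm_eq_abs] at h1
    rw [pow_succ]; linarith

/-- Each derivative costs one order of vanishing. The subtraction is truncated, so for `r ≥ n` this
is plain boundedness. -/
lemma exists_norm_iteratedDeriv_le_pow {n : ℕ} {w : ℝ → ℂ} (hw : ContDiff ℝ ∞ w)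
    (hc : HasCompactSupport w) (h : FunVanishesToOrder n w) (r : ℕ) :
    ∃ C : ℝ, 0 ≤ C ∧ ∀ x, ‖iteratedDeriv r w x‖ ≤ C * |x| ^ (n - r) := by
  induction r generalizing n w with
  | zero => simpa using exists_norm_le_pow hw hc h
  | succ r ih =>
    have h1 : FunVanishesToOrder (n - 1) (deriv w) := fun m hm => by
      rw [← iteratedDeriv_succ']; exact h (m + 1) (by omega)
    have := ih (contDiff_infty_iff_deriv.1 hw).2 hc.deriv h1
    rw [iteratedDeriv_succ']
    rwa [Nat.sub_sub, add_comm 1 r] at this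

/-! ### Dilations and seminorm estimates -/

/-- The dilate `x ↦ φ (y x)` of a Schwartz function. -/
def dil (y : ℝ) (φ : 𝓢(ℝ, ℂ)) : 𝓢(ℝ, ℂ) :=
  if h : y ≠ 0 then SchwartzMap.compCLMOfContinuousLinearEquiv ℂ
    (ContinuousLinearEquiv.unitsEquivAut ℝ (Units.mk0 y h)) φ else 0

lemma dil_apply {y : ℝ} (hy : y ≠ 0) (φ : 𝓢(ℝ, ℂ)) (x : ℝ) : dil y φ x = φ (y * x) := by
  rw [dil, dif_pos hy, mul_comm]; rfl

/-- `A φ y` is `O(y^{-k})` for `y ≥ 1`, with constants controlled by Schwartz seminorms of `φ`. -/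
def Dominated (k : ℕ) (A : 𝓢(ℝ, ℂ) → ℝ → ℝ) : Prop :=
  ∃ C : ℝ, 0 ≤ C ∧ ∃ s : Finset (ℕ × ℕ), ∀ (φ : 𝓢(ℝ, ℂ)) (y : ℝ), 1 ≤ y →
    A φ y ≤ C * (y ^ k)⁻¹ * (s.sup (schwartzSeminormFamily ℂ ℝ ℂ)) φ

lemma finset_sup_mono {s t : Finset (ℕ × ℕ)} (h : s ⊆ t) (φ : 𝓢(ℝ, ℂ)) :
    (s.sup (schwartzSeminormFamily ℂ ℝ ℂ)) φ ≤ (t.sup (schwartzSeminormFamily ℂ ℝ ℂ)) φ :=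
  (Finset.sup_mono h : s.sup (schwartzSeminormFamily ℂ ℝ ℂ) ≤ _) φ

lemma Dominated.mono {k : ℕ} {A B : 𝓢(ℝ, ℂ) → ℝ → ℝ} (hA : Dominated k A)
    (h : ∀ φ y, 1 ≤ y → B φ y ≤ A φ y) : Dominated k B := by
  obtain ⟨C, hC, s, hs⟩ := hA
  exact ⟨C, hC, s, fun φ y hy => (h φ y hy).trans (hs φ y hy)⟩

lemma Dominated.add {k : ℕ} {A B : 𝓢(ℝ, ℂ) → ℝ → ℝ} (hA : Dominated k A) (hB : Dominated k B) :
    Dominated k fun φ y => A φ y + B φ y := by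
  obtain ⟨C, hC, s, hs⟩ := hA
  obtain ⟨C', hC', s', hs'⟩ := hB
  refine ⟨C + C', by positivity, s ∪ s', fun φ y hy => ?_⟩
  have hy0 : 0 < y := by linarith
  have h1 := finset_sup_mono (Finset.subset_union_left (s₁ := s) (s₂ := s')) φ
  have h2 := finset_sup_mono (Finset.subset_union_right (s₁ := s) (s₂ := s')) φ
  calc _ ≤ C * (y ^ k)⁻¹ * (s.sup (schwartzSeminormFamily ℂ ℝ ℂ)) φ +
        C' * (y ^ k)⁻¹ * (s'.sup (schwartzSeminormFamily ℂ ℝ ℂ)) φ :=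
        add_le_add (hs φ y hy) (hs' φ y hy)
    _ ≤ C * (y ^ k)⁻¹ * ((s ∪ s').sup (schwartzSeminormFamily ℂ ℝ ℂ)) φ +
        C' * (y ^ k)⁻¹ * ((s ∪ s').sup (schwartzSeminormFamily ℂ ℝ ℂ)) φ := by gcongr
    _ = _ := by ring

lemma Dominated.const_mul {k : ℕ} {A : 𝓢(ℝ, ℂ) → ℝ → ℝ} (hA : Dominated k A) {c : ℝ}
    (hc : 0 ≤ c) : Dominated k fun φ y => c * A φ y := by
  obtain ⟨C, hC, s, hs⟩ := hA
  refine ⟨c * C, by positivity, s, fun φ y hy => ?_⟩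
  simpa only [mul_assoc] using mul_le_mul_of_nonneg_left (hs φ y hy) hc

lemma Dominated.sum {k : ℕ} {ι : Type*} (t : Finset ι) {A : ι → 𝓢(ℝ, ℂ) → ℝ → ℝ}
    (hA : ∀ i ∈ t, Dominated k (A i)) : Dominated k fun φ y => ∑ i ∈ t, A i φ y := by
  classical
  induction t using Finset.induction_on with
  | empty => exact ⟨0, le_rfl, ∅, fun φ y _ => by simp⟩
  | insert i t hi ih =>
    simp only [Finset.sum_insert hi]
    exact (hA i (by simp)).add (ih fun j hj => hA j (by simp [hj]))

/-- A bound for derivatives of `w(x) φ(yx)` when `w` is flat at `0`. -/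
lemma exists_dominated_mul_dil {w : ℝ → ℂ} (hw : ContDiff ℝ ∞ w) {i K : ℕ} (hiK : i ≤ K) (j : ℕ)
    (hb : ∀ r ≤ i, ∃ C : ℝ, 0 ≤ C ∧ ∀ x, ‖iteratedDeriv r w x‖ ≤ C * |x| ^ (K - r)) :
    ∃ A : 𝓢(ℝ, ℂ) → ℝ → ℝ, Dominated (K - i) A ∧ ∀ φ y, 1 ≤ y → ∀ x,
      |x| ^ j * ‖iteratedDeriv i (fun x => w x * φ (y * x)) x‖ ≤ A φ y := by
  choose! c hc0 hc using hb
  refine ⟨fun φ y => ∑ r ∈ Finset.range (i + 1), (i.choose r : ℝ) * c r *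
    ((y ^ (K - i))⁻¹ * SchwartzMap.seminorm ℂ (K - r + j) (i - r) φ), ?_, ?_⟩
  · refine Dominated.sum _ fun r hr => Dominated.const_mul ?_ (mul_nonneg (by positivity)
      (hc0 r (by simpa [Nat.lt_succ_iff] using hr)))
    exact ⟨1, zero_le_one, {(K - r + j, i - r)}, fun φ y _ => by simp⟩
  · intro φ y hy x
    have hy0 : 0 < y := by linarith
    have hφ : ContDiff ℝ ∞ fun x => φ (y * x) := (φ.smooth ⊤).comp (by fun_prop)
    have h1 := iteratedDeriv_mul (n := i) (x := x)
      (hw.contDiffAt.of_le (by exact_mod_cast le_top))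
      (hφ.contDiffAt.of_le (by exact_mod_cast le_top))
    have h1' : iteratedDeriv i (fun x => w x * φ (y * x)) x = _ := h1
    rw [h1']
    refine (mul_le_mul_of_nonneg_left (norm_sum_le _ _) (by positivity)).trans ?_
    rw [Finset.mul_sum]
    refine Finset.sum_le_sum fun r hr => ?_
    have hr : r ≤ i := by simpa [Nat.lt_succ_iff] using hr
    have h2 := iteratedDeriv_comp_const_smul (n := i - r) (f := φ)
      (φ.smooth (i - r : ℕ)) y
    rw [norm_mul, norm_mul, Complex.norm_natCast, h2, norm_smul, norm_pow, Real.norm_of_nonneg hy0.le]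
    have h3 := SchwartzMap.le_seminorm' ℂ (K - r + j) (i - r) φ (y * x)
    rw [abs_mul, abs_of_pos hy0, mul_pow] at h3
    -- Differentiating the dilate costs `y^{i-r}`. Trading `|x|^{K-r+j}` for a weight in `y x` gains
    -- `y^{K-r+j}`, which leaves at least `y^{K-i}`.
    have h4 : y ^ (i - r) ≤ (y ^ (K - i))⁻¹ * y ^ (K - r + j) := by
      rw [le_inv_mul_iff₀ (by positivity), ← pow_add]
      exact pow_le_pow_right₀ hy (by omega)
    have h5 := hc r hr x
    have h6 := hc0 r hr
    calc _ ≤ |x| ^ j * ((i.choose r : ℝ) * (c r * |x| ^ (K - r)) *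
          (((y ^ (K - i))⁻¹ * y ^ (K - r + j)) * ‖iteratedDeriv (i - r) φ (y * x)‖)) := by gcongr
      _ = (i.choose r : ℝ) * c r * ((y ^ (K - i))⁻¹ *
          (y ^ (K - r + j) * |x| ^ (K - r + j) * ‖iteratedDeriv (i - r) φ (y * x)‖)) := by
        rw [pow_add |x|]; ring
      _ ≤ _ := by gcongr

/-! ### Cutoffs and the pairing with dilates. -/

lemma contDiff_mul_of_tsupport_subset {U : Set ℝ} (hU : IsOpen U) {f χ : ℝ → ℂ}
    (hf : ContDiffOn ℝ ∞ f U) (hχ : ContDiff ℝ ∞ χ) (hs : tsupport χ ⊆ U) :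
    ContDiff ℝ ∞ fun x => f x * χ x := by
  rw [contDiff_iff_contDiffAt]
  intro x
  by_cases hx : x ∈ U
  · exact (hf.contDiffAt (hU.mem_nhds hx)).mul hχ.contDiffAt
  · have h1 : (fun x => f x * χ x) =ᶠ[𝓝 x] fun _ => 0 := by
      filter_upwards [(isClosed_tsupport χ).isOpen_compl.mem_nhds (fun h => hx (hs h))] with y hy
      rw [image_eq_zero_of_notMem_tsupport hy, mul_zero]
    exact contDiffAt_const.congr_of_eventuallyEq h1

lemma exists_cutoff {U : Set ℝ} (hU : IsOpen U) (h0 : (0 : ℝ) ∈ U) :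
    ∃ χ : ℝ → ℂ, ContDiff ℝ ∞ χ ∧ HasCompactSupport χ ∧ tsupport χ ⊆ U ∧
      ∃ ε > 0, ∀ x, |x| < ε → χ x = 1 := by
  obtain ⟨r, hr, hrU⟩ := Metric.nhds_basis_closedBall.mem_iff.1 (hU.mem_nhds h0)
  let f : ContDiffBump (0 : ℝ) := ⟨r / 2, r, by positivity, by linarith⟩
  have h1 : tsupport (fun x => (f x : ℂ)) ⊆ tsupport f := by
    apply closure_mono
    intro x hx h
    exact hx (by simp [h])
  refine ⟨fun x => f x, Complex.ofRealCLM.contDiff.comp f.contDiff, ?_, ?_, r / 2, by positivity,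
    fun x hx => ?_⟩
  · exact f.hasCompactSupport.of_isClosed_subset (isClosed_tsupport _) h1
  · rw [f.tsupport_eq] at h1
    exact h1.trans hrU
  · have h2 : f x = 1 := f.one_of_mem_closedBall (by simpa [f] using hx.le)
    simp [h2]

lemma norm_integral_mul_le {h T : ℝ → ℂ} {K : Set ℝ} (hK : IsCompact K)
    (hh : MemLp h ⊤ (volume.restrict K)) {B : ℝ} (hB : ∀ x, ‖T x‖ ≤ B)
    (hT : ∀ x, x ∉ K → T x = 0) :
    ‖∫ x, h x * T x‖ ≤ (∫ x in K, ‖h x‖) * B := by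
  have : IsFiniteMeasure (volume.restrict K) := ⟨by simpa using hK.measure_lt_top⟩
  have h1 : Integrable h (volume.restrict K) := hh.integrable le_top
  rw [← setIntegral_eq_integral_of_forall_compl_eq_zero (s := K)
    (fun x hx => by rw [hT x hx, mul_zero]), ← integral_mul_const]
  refine norm_integral_le_of_norm_le (h1.norm.mul_const B) (Eventually.of_forall fun x => ?_)
  rw [norm_mul]
  exact mul_le_mul_of_nonneg_left (hB x) (norm_nonneg _)

lemma iteratedDeriv_eq_zero_of_notMem_tsupport {u : ℝ → ℂ} {x : ℝ} (hx : x ∉ tsupport u) (n : ℕ) :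
    iteratedDeriv n u x = 0 := by
  have h1 : u =ᶠ[𝓝 x] fun _ => 0 := by
    filter_upwards [(isClosed_tsupport u).isOpen_compl.mem_nhds hx] with y hy
    exact image_eq_zero_of_notMem_tsupport hy
  rw [h1.iteratedDeriv_eq n]; simp

/-- In the `i`-th term the product of coefficient, `f` and cutoff vanishes to order `i + k`. The `i`
derivatives falling on the dilate cost `y^i`, and `y^{-k}` survives. -/
lemma dominated_integral_transpose {U : Set ℝ} (hU : IsOpen U) (h0 : (0 : ℝ) ∈ U) {k : ℕ}
    {f h χ : ℝ → ℂ} (hf : ContDiffOn ℝ ∞ f U) (hfk : FunVanishesToOrder k f) {D : DiffOp U}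
    (hD : D.IsTangential) (hh : LocBounded h U) (hχ : ContDiff ℝ ∞ χ) (hc : HasCompactSupport χ)
    (hs : tsupport χ ⊆ U) :
    Dominated k fun φ y => ‖∫ x, h x * D.transpose (fun x => f x * (χ x * φ (y * x))) x‖ := by
  have hvan : ∀ i ≤ D.order, ∃ A : 𝓢(ℝ, ℂ) → ℝ → ℝ, Dominated k A ∧ ∀ φ y, 1 ≤ y → ∀ x,
      ‖iteratedDeriv i (fun x => D.coeff i x * (f x * (χ x * φ (y * x)))) x‖ ≤ A φ y := by
    intro i hi
    have hcf : ContDiffOn ℝ ∞ (fun x => D.coeff i x * f x) U := (D.smooth i hi).mul hf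
    set w : ℝ → ℂ := fun x => (D.coeff i x * f x) * χ x with hw
    have hws : ContDiff ℝ ∞ w := contDiff_mul_of_tsupport_subset hU hcf hχ hs
    have hwc : HasCompactSupport w := hc.mul_left
    have hwv : FunVanishesToOrder (i + k) w :=
      ((hD.coeff_vanishes hU h0 i hi).mul hfk ((D.smooth i hi).contDiffAt (hU.mem_nhds h0))
        (hf.contDiffAt (hU.mem_nhds h0))).mul (l := 0) (fun m hm => absurd hm (by omega))
        (hcf.contDiffAt (hU.mem_nhds h0)) hχ.contDiffAt
    obtain ⟨A, hA, hA'⟩ := exists_dominated_mul_dil hws (i := i) (K := i + k) (by omega) 0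
      (fun r _ => exists_norm_iteratedDeriv_le_pow hws hwc hwv r)
    rw [Nat.add_sub_cancel_left] at hA
    refine ⟨A, hA, fun φ y hy x => ?_⟩
    have := hA' φ y hy x
    rw [pow_zero, one_mul] at this
    convert this using 3
    funext x; rw [hw]; ring
  choose! A hA hA' using hvan
  have hsum : Dominated k fun φ y => (∫ x in tsupport χ, ‖h x‖) *
      ∑ i ∈ Finset.range (D.order + 1), A i φ y :=
    (Dominated.sum _ fun i hi => hA i (by simpa [Nat.lt_succ_iff] using hi)).const_mul
      (integral_nonneg fun _ => norm_nonneg _)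
  refine hsum.mono fun φ y hy => norm_integral_mul_le hc (hh _ hs hc) (fun x => ?_) fun x hx => ?_
  · refine (norm_sum_le _ _).trans (Finset.sum_le_sum fun i hi => ?_)
    rw [norm_mul, norm_pow, norm_neg, norm_one, one_pow, one_mul]
    exact hA' i (by simpa [Nat.lt_succ_iff] using hi) φ y hy x
  · refine Finset.sum_eq_zero fun i _ => ?_
    rw [iteratedDeriv_eq_zero_of_notMem_tsupport, mul_zero]
    intro hx'
    refine hx (closure_mono ?_ hx')
    intro z hz hz'
    exact hz (by simp [hz'])

/-- Since `1 - χ` is zero on `|x| < ε`, a bounded derivative is dominated by any power of `|x| / ε`.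
This serves the part of the pairing away from `0`. -/
lemma exists_norm_iteratedDeriv_one_sub_le {χ : ℝ → ℂ} (hχ : ContDiff ℝ ∞ χ)
    (hc : HasCompactSupport χ) {ε : ℝ} (hε : 0 < ε) (h1 : ∀ x, |x| < ε → χ x = 1) (r M : ℕ) :
    ∃ C : ℝ, 0 ≤ C ∧ ∀ x, ‖iteratedDeriv r (fun x => 1 - χ x) x‖ ≤ C * |x| ^ M := by
  obtain ⟨B, hB0, hB⟩ : ∃ B : ℝ, 0 ≤ B ∧ ∀ x, ‖iteratedDeriv r (fun x => 1 - χ x) x‖ ≤ B := by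
    obtain ⟨B, hB0, hB⟩ := exists_norm_iteratedDeriv_le_pow (n := 0) hχ hc
      (fun m hm => absurd hm (by omega)) r
    refine ⟨B + 1, by positivity, fun x => ?_⟩
    have hBx := hB x
    rw [Nat.zero_sub, pow_zero, mul_one] at hBx
    rcases Nat.eq_zero_or_pos r with rfl | hr
    · simp only [iteratedDeriv_zero] at hBx ⊢
      calc ‖1 - χ x‖ ≤ ‖(1 : ℂ)‖ + ‖χ x‖ := norm_sub_le _ _
        _ ≤ _ := by rw [norm_one]; linarith
    · rw [iteratedDeriv_const_sub hr, iteratedDeriv_neg, norm_neg]; linarith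
  refine ⟨B * (ε ^ M)⁻¹, by positivity, fun x => ?_⟩
  rcases lt_or_ge |x| ε with hx | hx
  · have h2 : (fun x => 1 - χ x) =ᶠ[𝓝 x] fun _ => 0 := by
      filter_upwards [(isOpen_lt continuous_abs continuous_const).mem_nhds hx] with y hy
      rw [h1 y hy, sub_self]
    rw [h2.iteratedDeriv_eq r]
    simp only [iteratedDeriv_fun_const_zero, norm_zero]
    positivity
  · refine (hB x).trans ?_
    rw [mul_assoc]
    refine le_mul_of_one_le_right hB0 ?_
    rw [inv_mul_eq_div, one_le_div (by positivity)]
    exact pow_le_pow_left₀ hε.le hx M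

lemma exists_le_sup_seminorm (τ : 𝓢'(ℝ, ℂ)) : ∃ (s : Finset (ℕ × ℕ)) (C : ℝ), 0 ≤ C ∧
    ∀ ψ : 𝓢(ℝ, ℂ), ‖τ ψ‖ ≤ C * (s.sup (schwartzSeminormFamily ℂ ℝ ℂ)) ψ := by
  have h1 : Continuous ((normSeminorm ℂ ℂ).comp (τ : 𝓢(ℝ, ℂ) →ₗ[ℂ] ℂ)) :=
    continuous_norm.comp (map_continuous τ)
  obtain ⟨s, C, -, h⟩ := Seminorm.bound_of_continuous (schwartz_withSeminorms ℂ ℝ ℂ) _ h1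
  exact ⟨s, C, C.2, fun ψ => h ψ⟩

/-- A tempered distribution vanishing to order `k` at `0` decays like `y^{-k}` when tested on the
dilates `φ(y x)`, `y → ∞`. -/
lemma VanishesToOrder.dominated_dil {τ : 𝓢'(ℝ, ℂ)} {k : ℕ} (hτ : VanishesToOrder τ k) :
    Dominated k fun φ y => ‖τ (dil y φ)‖ := by
  obtain ⟨U, hU, h0, N, f, D, h, hf, hD, hh, hrep⟩ := hτ
  obtain ⟨χ, hχ, hc, hs, ε, hε, hχ1⟩ := exists_cutoff hU h0
  have hcφ : ∀ (φ : 𝓢(ℝ, ℂ)) (y : ℝ), HasCompactSupport fun x => χ x * φ (y * x) :=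
    fun φ y => hc.mul_right
  have hsφ : ∀ (φ : 𝓢(ℝ, ℂ)) (y : ℝ), ContDiff ℝ ∞ fun x => χ x * φ (y * x) :=
    fun φ y => hχ.mul ((φ.smooth ⊤).comp (by fun_prop))
  set near : 𝓢(ℝ, ℂ) → ℝ → 𝓢(ℝ, ℂ) := fun φ y => (hcφ φ y).toSchwartzMap (hsφ φ y) with hnear
  have hnear_apply : ∀ φ y, (near φ y : ℝ → ℂ) = fun x => χ x * φ (y * x) := fun _ _ => rfl
  -- Near `0` the local representation of `τ` applies to the cut-off dilate.
  have hd1 : Dominated k fun φ y => ‖τ (near φ y)‖ := by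
    refine (Dominated.sum Finset.univ fun j _ => dominated_integral_transpose hU h0 (hf j).1
      (hf j).2 (hD j) (hh j) hχ hc hs).mono fun φ y hy => ?_
    rw [hrep (near φ y) (by rw [hnear_apply]; exact hcφ φ y) (by
      rw [hnear_apply]
      refine (closure_mono ?_).trans hs
      intro z hz hz'
      exact hz (by simp [hz']))]
    exact norm_sum_le _ _
  -- Away from `0` only the continuity of `τ` is used: a Schwartz function dilated by `y` is rapidly
  -- small in `y` off a neighbourhood of `0`.
  have hd2 : Dominated k fun φ y => ‖τ (dil y φ - near φ y)‖ := by
    obtain ⟨s, C, hC, hτs⟩ := exists_le_sup_seminorm τ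
    have h2 : ∀ p : ℕ × ℕ, ∃ A : 𝓢(ℝ, ℂ) → ℝ → ℝ, Dominated k A ∧ ∀ φ y, 1 ≤ y →
        schwartzSeminormFamily ℂ ℝ ℂ p (dil y φ - near φ y) ≤ A φ y := by
      rintro ⟨j, i⟩
      obtain ⟨A, hA, hA'⟩ := exists_dominated_mul_dil (w := fun x => 1 - χ x)
        (contDiff_const.sub hχ) (i := i) (K := i + k) (by omega) j
        (fun r _ => exists_norm_iteratedDeriv_one_sub_le hχ hc hε hχ1 r _)
      rw [Nat.add_sub_cancel_left] at hA
      refine ⟨A, hA, fun φ y hy => ?_⟩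
      have hy0 : y ≠ 0 := by positivity
      have h3 : ((dil y φ - near φ y : 𝓢(ℝ, ℂ)) : ℝ → ℂ) = fun x => (1 - χ x) * φ (y * x) := by
        funext x
        rw [sub_apply, dil_apply hy0, hnear_apply]; ring
      refine SchwartzMap.seminorm_le_bound' ℂ j i _
        (le_trans (by positivity) (hA' φ y hy 0)) fun x => ?_
      rw [h3]
      exact hA' φ y hy x
    choose A hA hA' using h2
    refine ((Dominated.sum s fun p _ => hA p).const_mul hC).mono fun φ y hy => ?_
    refine (hτs _).trans (mul_le_mul_of_nonneg_left ?_ hC)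
    have hpos : ∀ p, 0 ≤ A p φ y := fun p => (apply_nonneg _ _).trans (hA' p φ y hy)
    refine Seminorm.finset_sup_apply_le (Finset.sum_nonneg fun p _ => hpos p) fun p hp => ?_
    exact (hA' p φ y hy).trans (Finset.single_le_sum (f := fun p => A p φ y)
      (fun p _ => hpos p) hp)
  refine (hd1.add hd2).mono fun φ y _ => ?_
  have h3 : τ (dil y φ) = τ (near φ y) + τ (dil y φ - near φ y) := by
    rw [← map_add]; congr 1; abel
  rw [h3]
  exact norm_add_le _ _

/-! ### Moderate growth -/

/-- A uniform version of moderate growth, including small imaginary parts. -/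
def StripBounded (H : ℂ → ℂ) : Prop :=
  ∀ R : ℝ, ∃ C : ℝ, 0 ≤ C ∧ ∃ N : ℕ, ∀ s : ℂ, |s.re| ≤ R → ‖H s‖ ≤ C * (1 + |s.im|) ^ N

lemma StripBounded.moderateGrowth {H : ℂ → ℂ} (h : StripBounded H) : ModerateGrowth H := by
  intro a b _
  obtain ⟨C, hC, N, hN⟩ := h (max |a| |b|)
  refine ⟨1, one_pos, C * 2 ^ N + 1, by positivity, N, fun s ha hb hs => ?_⟩
  have h1 : |s.re| ≤ max |a| |b| := abs_le_max_abs_abs ha hb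
  calc ‖H s‖ ≤ C * (1 + |s.im|) ^ N := hN s h1
    _ ≤ C * (2 * |s.im|) ^ N := by gcongr; linarith
    _ = C * 2 ^ N * |s.im| ^ N := by rw [mul_pow]; ring
    _ ≤ _ := by gcongr; linarith

lemma ModerateGrowth.stripBounded {H : ℂ → ℂ} (h : ModerateGrowth H) (hH : Continuous H) :
    StripBounded H := by
  intro R
  obtain ⟨T, hT, C, hC, N, hN⟩ := h (-|R|) (|R| + 1) (by linarith [abs_nonneg R])
  obtain ⟨B, hB⟩ := ((isCompact_Icc (a := -R) (b := R)).reProdIm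
    (isCompact_Icc (a := -T) (b := T))).exists_bound_of_continuousOn hH.continuousOn
  refine ⟨C + |B|, by positivity, N, fun s hs => ?_⟩
  have h1 : (1 : ℝ) ≤ (1 + |s.im|) ^ N := one_le_pow₀ (by linarith [abs_nonneg s.im])
  rcases le_total T |s.im| with h | h
  · have h2 := abs_le.1 (hs.trans (le_abs_self R))
    calc ‖H s‖ ≤ C * |s.im| ^ N := hN s h2.1 (by linarith) h
      _ ≤ (C + |B|) * (1 + |s.im|) ^ N := by
        gcongr
        · linarith [abs_nonneg B]
        · linarith
  · calc ‖H s‖ ≤ B := hB s ⟨abs_le.1 hs, abs_le.1 h⟩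
      _ ≤ (C + |B|) * 1 := by linarith [le_abs_self B]
      _ ≤ _ := by gcongr

lemma StripBounded.comp_add {H : ℂ → ℂ} (h : StripBounded H) (c : ℂ) :
    StripBounded fun s => H (s + c) := by
  intro R
  obtain ⟨C, hC, N, hN⟩ := h (R + |c.re|)
  refine ⟨C * (1 + |c.im|) ^ N, by positivity, N, fun s hs => ?_⟩
  have h1 : |(s + c).re| ≤ R + |c.re| := by
    rw [Complex.add_re]; exact (abs_add_le _ _).trans (by linarith)
  have h2 : 1 + |(s + c).im| ≤ (1 + |c.im|) * (1 + |s.im|) := by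
    rw [Complex.add_im]
    nlinarith [abs_add_le s.im c.im, mul_nonneg (abs_nonneg s.im) (abs_nonneg c.im)]
  calc ‖H (s + c)‖ ≤ C * (1 + |(s + c).im|) ^ N := hN _ h1
    _ ≤ C * ((1 + |c.im|) * (1 + |s.im|)) ^ N := by gcongr
    _ = _ := by rw [mul_pow]; ring

lemma ExtendsToEntireOfModerateGrowth.comp_add {F : ℂ → ℂ}
    (h : ExtendsToEntireOfModerateGrowth F) (w : ℂ) :
    ExtendsToEntireOfModerateGrowth fun s => F (s + w) := by
  obtain ⟨H, hd, hm, c, hc⟩ := h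
  refine ⟨fun s => H (s + w), hd.comp (differentiable_id.add_const w),
    ((hm.stripBounded hd.continuous).comp_add w).moderateGrowth, c - w.re, fun s hs => hc _ ?_⟩
  rw [Complex.add_re]; linarith

lemma eq_of_eqOn_half_plane {f g : ℂ → ℂ} (hf : Differentiable ℂ f) (hg : Differentiable ℂ g)
    {c : ℝ} (h : ∀ s : ℂ, c < s.re → f s = g s) : f = g := by
  have hf' : AnalyticOnNhd ℂ f univ := fun z _ => hf.analyticAt z
  have hg' : AnalyticOnNhd ℂ g univ := fun z _ => hg.analyticAt z
  refine hf'.eq_of_eventuallyEq hg' (z₀ := ((c + 1 : ℝ) : ℂ)) ?_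
  filter_upwards [(isOpen_lt continuous_const Complex.continuous_re).mem_nhds
    (show c < (((c + 1 : ℝ) : ℂ)).re by simp)] with s hs
  exact h s hs

/-- A function that becomes entire after multiplication by each member of a family of entire
functions without common zeros is entire; bounds on vertical strips carry over. -/
lemma extends_of_family {F : ℂ → ℂ} {c : ℝ} {M Λ : ℝ → ℂ → ℂ}
    (hM : ∀ t, Differentiable ℂ (M t)) (hΛ : ∀ t, Differentiable ℂ (Λ t))
    (hF : ∀ t, ∀ s : ℂ, c < s.re → Λ t s = M t s * F s)
    (hlow : ∀ R : ℝ, ∃ m > 0, ∀ s : ℂ, |s.re| ≤ R → m ≤ ‖M s.im s‖)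
    (hup : ∀ R : ℝ, ∃ C : ℝ, 0 ≤ C ∧ ∃ N : ℕ, ∀ s : ℂ, |s.re| ≤ R →
      ‖Λ s.im s‖ ≤ C * (1 + |s.im|) ^ N) :
    ExtendsToEntireOfModerateGrowth F := by
  have hne : ∀ s : ℂ, M s.im s ≠ 0 := fun s h0 => by
    obtain ⟨m, hm, h⟩ := hlow |s.re|
    have := h s le_rfl
    rw [h0, norm_zero] at this
    linarith
  -- The quotient is formed with the parameter `t = Im s`. By `hcross` it does not depend on `t`, so
  -- near a given point the parameter can be frozen, which gives holomorphy.
  set H : ℂ → ℂ := fun s => Λ s.im s / M s.im s with hH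
  have hcross : ∀ t t' s, Λ t s * M t' s = Λ t' s * M t s := by
    intro t t'
    refine congrFun (eq_of_eqOn_half_plane (c := c) ((hΛ t).mul (hM t'))
      ((hΛ t').mul (hM t)) fun s hs => ?_)
    rw [hF t s hs, hF t' s hs]; ring
  refine ⟨H, fun s => ?_, StripBounded.moderateGrowth fun R => ?_, c, fun s hs => ?_⟩
  · have h1 : H =ᶠ[𝓝 s] fun z => Λ s.im z / M s.im z := by
      filter_upwards [(hM s.im).continuous.continuousAt.eventually_ne (hne s)] with z hz
      rw [hH]
      simp only
      rw [div_eq_div_iff (hne z) hz]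
      exact hcross _ _ _
    exact ((hΛ s.im s).div (hM s.im s) (hne s)).congr_of_eventuallyEq h1
  · obtain ⟨m, hm, h1⟩ := hlow R
    obtain ⟨C, hC, N, h2⟩ := hup R
    refine ⟨C / m, by positivity, N, fun s hs => ?_⟩
    rw [hH]
    simp only
    rw [norm_div, div_mul_eq_mul_div]
    exact div_le_div₀ (by positivity) (h2 s hs) hm (h1 s hs)
  · rw [hH]
    simp only
    rw [hF _ s hs, mul_div_cancel_left₀ _ (hne s)]

/-! ### Families of Schwartz functions with polynomially bounded seminorms -/

/-- All Schwartz seminorms of `φ t` are polynomially bounded in `t`. -/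
def PolyFamily (φ : ℝ → 𝓢(ℝ, ℂ)) : Prop :=
  ∀ p : ℕ × ℕ, ∃ C : ℝ, 0 ≤ C ∧ ∃ N : ℕ, ∀ t, schwartzSeminormFamily ℂ ℝ ℂ p (φ t) ≤
    C * (1 + |t|) ^ N

lemma PolyFamily.sup {φ : ℝ → 𝓢(ℝ, ℂ)} (h : PolyFamily φ) (s : Finset (ℕ × ℕ)) :
    ∃ C : ℝ, 0 ≤ C ∧ ∃ N : ℕ, ∀ t, (s.sup (schwartzSeminormFamily ℂ ℝ ℂ)) (φ t) ≤
      C * (1 + |t|) ^ N := by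
  choose C hC N hN using h
  refine ⟨∑ p ∈ s, C p, Finset.sum_nonneg fun p _ => hC p, ∑ p ∈ s, N p, fun t => ?_⟩
  have ht : 1 ≤ 1 + |t| := by linarith [abs_nonneg t]
  refine Seminorm.finset_sup_apply_le
    (mul_nonneg (Finset.sum_nonneg fun p _ => hC p) (by positivity)) fun p hp => ?_
  exact (hN p t).trans (mul_le_mul (Finset.single_le_sum (f := C) (fun p _ => hC p) hp)
    (pow_le_pow_right₀ ht (Finset.single_le_sum (f := N) (fun p _ => Nat.zero_le _) hp))
    (by positivity) (Finset.sum_nonneg fun p _ => hC p))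

lemma exists_seminorm_le_sup (T : 𝓢(ℝ, ℂ) →L[ℂ] 𝓢(ℝ, ℂ)) (p : ℕ × ℕ) :
    ∃ (s : Finset (ℕ × ℕ)) (C : ℝ), 0 ≤ C ∧ ∀ φ : 𝓢(ℝ, ℂ),
      schwartzSeminormFamily ℂ ℝ ℂ p (T φ) ≤ C * (s.sup (schwartzSeminormFamily ℂ ℝ ℂ)) φ := by
  have h1 : Continuous ((schwartzSeminormFamily ℂ ℝ ℂ p).comp (T : 𝓢(ℝ, ℂ) →ₗ[ℂ] 𝓢(ℝ, ℂ))) :=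
    ((schwartz_withSeminorms ℂ ℝ ℂ).continuous_seminorm p).comp T.continuous
  obtain ⟨s, C, -, h⟩ := Seminorm.bound_of_continuous (schwartz_withSeminorms ℂ ℝ ℂ) _ h1
  exact ⟨s, C, C.2, fun ψ => h ψ⟩

lemma PolyFamily.map {φ : ℝ → 𝓢(ℝ, ℂ)} (h : PolyFamily φ) (T : 𝓢(ℝ, ℂ) →L[ℂ] 𝓢(ℝ, ℂ)) :
    PolyFamily fun t => T (φ t) := by
  intro p
  obtain ⟨s, C, hC, hT⟩ := exists_seminorm_le_sup T p
  obtain ⟨C', hC', N, hN⟩ := h.sup s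
  refine ⟨C * C', by positivity, N, fun t => (hT _).trans ?_⟩
  rw [mul_assoc]
  exact mul_le_mul_of_nonneg_left (hN t) hC

lemma PolyFamily.comp_neg {φ : ℝ → 𝓢(ℝ, ℂ)} (h : PolyFamily φ) : PolyFamily fun t => φ (-t) := by
  intro p
  obtain ⟨C, hC, N, hN⟩ := h p
  exact ⟨C, hC, N, fun t => by simpa using hN (-t)⟩

/-! ### Oscillating bump functions on `[1, 2]`. -/

/-- The function `β(x) x^{it}`. -/
def osc (β : ℝ → ℂ) (t : ℝ) (x : ℝ) : ℂ := Complex.exp (t * Complex.I * Real.log x) * β x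

lemma osc_contDiff {β : ℝ → ℂ} (hβ : ContDiff ℝ ∞ β) (hs : tsupport β ⊆ Icc 1 2) (t : ℝ) :
    ContDiff ℝ ∞ (osc β t) := by
  refine contDiff_mul_of_tsupport_subset isOpen_Ioi ?_ hβ
    (hs.trans fun x hx => (lt_of_lt_of_le one_pos hx.1 : x ∈ Ioi 0))
  refine ContDiffOn.cexp (contDiffOn_const.mul ?_)
  refine Complex.ofRealCLM.contDiff.comp_contDiffOn ?_
  exact Real.contDiffOn_log.mono fun x hx => (ne_of_gt hx : x ≠ 0)

lemma osc_tsupport {β : ℝ → ℂ} (hs : tsupport β ⊆ Icc 1 2) (t : ℝ) :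
    tsupport (osc β t) ⊆ Icc 1 2 := by
  refine (closure_mono ?_).trans hs
  intro x hx h
  exact hx (by simp [osc, h])

lemma osc_hasCompactSupport {β : ℝ → ℂ} (hs : tsupport β ⊆ Icc 1 2) (t : ℝ) :
    HasCompactSupport (osc β t) :=
  isCompact_Icc.of_isClosed_subset (isClosed_tsupport _) (osc_tsupport hs t)

/-- The derivative stays within functions `osc γ t` with `γ` supported in `[1, 2]`, at the cost of
one factor `t`. The induction in `exists_iteratedDeriv_osc_le` runs on this. -/
lemma deriv_osc {β : ℝ → ℂ} (hβ : ContDiff ℝ ∞ β) (hs : tsupport β ⊆ Icc 1 2) (t : ℝ) :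
    deriv (osc β t) = fun x => osc (deriv β) t x +
      (t * Complex.I) * osc (fun x => ((x⁻¹ : ℝ) : ℂ) * β x) t x := by
  funext x
  by_cases hx : 0 < x
  · have h1 : HasDerivAt (fun x : ℝ => (Real.log x : ℂ)) ((x⁻¹ : ℝ) : ℂ) x :=
      (Real.hasDerivAt_log hx.ne').ofReal_comp
    have h2 := ((h1.const_mul (t * Complex.I)).cexp).mul
      (hβ.differentiable (by simp) x).hasDerivAt
    have h3 : deriv (osc β t) x = _ := h2.deriv
    rw [h3]
    simp only [osc]
    ring
  · have hx' : x ∉ tsupport (osc β t) := fun h => hx (by linarith [(osc_tsupport hs t h).1])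
    have hx'' : x ∉ tsupport β := fun h => hx (by linarith [(hs h).1])
    have h1 := iteratedDeriv_eq_zero_of_notMem_tsupport hx' 1
    have h2 := iteratedDeriv_eq_zero_of_notMem_tsupport hx'' 1
    rw [iteratedDeriv_one] at h1 h2
    simp [h1, h2, osc, image_eq_zero_of_notMem_tsupport hx'']

lemma exists_iteratedDeriv_osc_le (n : ℕ) {β : ℝ → ℂ} (hβ : ContDiff ℝ ∞ β)
    (hs : tsupport β ⊆ Icc 1 2) :
    ∃ C : ℝ, 0 ≤ C ∧ ∃ N : ℕ, ∀ t x : ℝ, ‖iteratedDeriv n (osc β t) x‖ ≤ C * (1 + |t|) ^ N := by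
  induction n generalizing β with
  | zero =>
    have hc : HasCompactSupport β := isCompact_Icc.of_isClosed_subset (isClosed_tsupport _) hs
    obtain ⟨C, hC⟩ := hβ.continuous.bounded_above_of_compact_support hc
    refine ⟨C, (norm_nonneg _).trans (hC 0), 0, fun t x => ?_⟩
    rw [iteratedDeriv_zero, osc, norm_mul, pow_zero, mul_one]
    have : ‖Complex.exp (t * Complex.I * Real.log x)‖ = 1 := by
      rw [Complex.norm_exp]; simp
    rw [this, one_mul]; exact hC x
  | succ n ih =>
    have hs1 : tsupport (deriv β) ⊆ Icc 1 2 := (tsupport_deriv_subset).trans hs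
    have hβ1 : ContDiff ℝ ∞ (deriv β) := (contDiff_infty_iff_deriv.1 hβ).2
    have hβ2 : ContDiff ℝ ∞ fun x => ((x⁻¹ : ℝ) : ℂ) * β x := by
      refine contDiff_mul_of_tsupport_subset isOpen_Ioi ?_ hβ
        (hs.trans fun x hx => (lt_of_lt_of_le one_pos hx.1 : x ∈ Ioi 0))
      refine Complex.ofRealCLM.contDiff.comp_contDiffOn ?_
      exact contDiffOn_id.inv fun x hx => (ne_of_gt hx : x ≠ 0)
    have hs2 : tsupport (fun x => ((x⁻¹ : ℝ) : ℂ) * β x) ⊆ Icc 1 2 := by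
      refine (closure_mono ?_).trans hs
      intro x hx h
      exact hx (by simp [h])
    obtain ⟨C1, hC1, N1, h1⟩ := ih hβ1 hs1
    obtain ⟨C2, hC2, N2, h2⟩ := ih hβ2 hs2
    refine ⟨C1 + C2, by positivity, N1 + (N2 + 1), fun t x => ?_⟩
    have ht : 1 ≤ 1 + |t| := by linarith [abs_nonneg t]
    have hd1 : ContDiffAt ℝ n (osc (deriv β) t) x :=
      (osc_contDiff hβ1 hs1 t).contDiffAt.of_le (by exact_mod_cast le_top)
    have hd2 : ContDiffAt ℝ n (osc (fun x => ((x⁻¹ : ℝ) : ℂ) * β x) t) x :=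
      (osc_contDiff hβ2 hs2 t).contDiffAt.of_le (by exact_mod_cast le_top)
    have h3 : iteratedDeriv (n + 1) (osc β t) x = iteratedDeriv n (osc (deriv β) t) x +
        (t * Complex.I) * iteratedDeriv n (osc (fun x => ((x⁻¹ : ℝ) : ℂ) * β x) t) x := by
      rw [iteratedDeriv_succ', deriv_osc hβ hs, ← iteratedDeriv_const_mul_field]
      exact iteratedDeriv_add hd1 (contDiffAt_const.mul hd2)
    rw [h3]
    refine (norm_add_le _ _).trans ?_
    rw [norm_mul, norm_mul, Complex.norm_I, mul_one, Complex.norm_real, Real.norm_eq_abs, add_mul]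
    have e1 : (1 + |t|) ^ N1 ≤ (1 + |t|) ^ (N1 + (N2 + 1)) :=
      pow_le_pow_right₀ ht (by omega)
    have e2 : (1 + |t|) ^ (N2 + 1) ≤ (1 + |t|) ^ (N1 + (N2 + 1)) :=
      pow_le_pow_right₀ ht (by omega)
    refine add_le_add ((h1 t x).trans (by gcongr)) ?_
    calc |t| * ‖iteratedDeriv n (osc (fun x => ((x⁻¹ : ℝ) : ℂ) * β x) t) x‖
        ≤ (1 + |t|) * (C2 * (1 + |t|) ^ N2) := by
          gcongr
          · linarith
          · exact h2 t x
      _ = C2 * (1 + |t|) ^ (N2 + 1) := by ring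
      _ ≤ _ := by gcongr

/-- `osc β t` as a Schwartz function. -/
def oscS {β : ℝ → ℂ} (hβ : ContDiff ℝ ∞ β) (hs : tsupport β ⊆ Icc 1 2) (t : ℝ) : 𝓢(ℝ, ℂ) :=
  (osc_hasCompactSupport hs t).toSchwartzMap (osc_contDiff hβ hs t)

lemma oscS_coe {β : ℝ → ℂ} (hβ : ContDiff ℝ ∞ β) (hs : tsupport β ⊆ Icc 1 2) (t : ℝ) :
    (oscS hβ hs t : ℝ → ℂ) = osc β t := rfl

lemma polyFamily_oscS {β : ℝ → ℂ} (hβ : ContDiff ℝ ∞ β) (hs : tsupport β ⊆ Icc 1 2) :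
    PolyFamily (oscS hβ hs) := by
  rintro ⟨k, n⟩
  obtain ⟨C, hC, N, h⟩ := exists_iteratedDeriv_osc_le n hβ hs
  refine ⟨2 ^ k * C, by positivity, N, fun t => ?_⟩
  refine SchwartzMap.seminorm_le_bound' ℂ k n _ (by positivity) fun x => ?_
  rw [oscS_coe]
  by_cases hx : x ∈ tsupport (osc β t)
  · have hx' := osc_tsupport hs t hx
    have h1 : |x| ≤ 2 := by rw [abs_of_nonneg (by linarith [hx'.1])]; exact hx'.2
    rw [mul_assoc]
    gcongr
    exact h t x
  · rw [iteratedDeriv_eq_zero_of_notMem_tsupport hx, norm_zero, mul_zero]; positivity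

lemma exists_bump : ∃ β : ℝ → ℝ, ContDiff ℝ ∞ (fun x => (β x : ℂ)) ∧
    tsupport (fun x => (β x : ℂ)) ⊆ Icc 1 2 ∧ (∀ x, 0 ≤ β x) ∧ Continuous β ∧ 0 < ∫ x, β x := by
  let f : ContDiffBump (3 / 2 : ℝ) := ⟨1 / 4, 1 / 2, by norm_num, by norm_num⟩
  refine ⟨f, Complex.ofRealCLM.contDiff.comp f.contDiff, ?_, fun x => f.nonneg, f.continuous,
    f.integral_pos⟩
  have h1 : tsupport (fun x => (f x : ℂ)) ⊆ tsupport f := by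
    apply closure_mono
    intro x hx h
    exact hx (by simp [h])
  refine h1.trans ?_
  rw [f.tsupport_eq, Real.closedBall_eq_Icc]
  norm_num [f]

lemma decaysBothEnds_of_tsupport {ψ : ℝ → ℂ} (hψ : Continuous ψ) (hs : tsupport ψ ⊆ Icc 1 2)
    (K : ℕ) : ∃ P : ℝ, DecaysBothEnds ψ K P := by
  obtain ⟨C, hC⟩ := hψ.bounded_above_of_compact_support
    (isCompact_Icc.of_isClosed_subset (isClosed_tsupport _) hs)
  have hC0 : 0 ≤ C := (norm_nonneg _).trans (hC 0)
  refine ⟨2 ^ K * C, fun v hv => ?_, fun v hv0 hv1 => ?_⟩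
  · have hv0 : 0 < v := by linarith
    by_cases hx : v ∈ tsupport ψ
    · have h2 : v ^ K ≤ 2 ^ K := pow_le_pow_left₀ hv0.le (hs hx).2 K
      refine (hC v).trans ?_
      rw [← div_eq_mul_inv, le_div_iff₀ (by positivity), mul_comm]
      gcongr
    · rw [image_eq_zero_of_notMem_tsupport hx, norm_zero]; positivity
  · by_cases hx : v ∈ tsupport ψ
    · have h2 : v = 1 := le_antisymm hv1 (hs hx).1
      refine (hC v).trans ?_
      rw [h2, one_pow, mul_one]
      exact le_mul_of_one_le_left hC0 (one_le_pow₀ (by norm_num))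
    · rw [image_eq_zero_of_notMem_tsupport hx, norm_zero]; positivity

lemma differentiable_mellin_osc {β : ℝ → ℂ} (hβ : ContDiff ℝ ∞ β) (hs : tsupport β ⊆ Icc 1 2)
    (t : ℝ) : Differentiable ℂ (mellin (osc β t)) :=
  differentiable_mellin_of_decaysBothEnds (osc_contDiff hβ hs t).continuous.continuousOn
    (decaysBothEnds_of_tsupport (osc_contDiff hβ hs t).continuous (osc_tsupport hs t))

/-- The phase `x^{-i Im s}` cancels the oscillation of `x^{s-1}`, leaving the integral of `x^{Re s -
1} β(x) ≥ 0`. On `[1, 2]` the power is at least `2^{-(|R|+1)}`. -/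
lemma exists_le_norm_mellin_osc {β : ℝ → ℝ} (hs : tsupport (fun x => (β x : ℂ)) ⊆ Icc 1 2)
    (h0 : ∀ x, 0 ≤ β x) (hc : Continuous β) (hpos : 0 < ∫ x, β x) (R : ℝ) :
    ∃ m > 0, ∀ s : ℂ, |s.re| ≤ R → m ≤ ‖mellin (osc (fun x => (β x : ℂ)) (-s.im)) s‖ := by
  have hz : ∀ x, x ∉ Icc (1 : ℝ) 2 → β x = 0 := fun x hx => by
    have := image_eq_zero_of_notMem_tsupport (f := fun x => (β x : ℂ)) fun h => hx (hs h)
    exact_mod_cast this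
  have hsub : Icc (1 : ℝ) 2 ⊆ Ioi 0 := fun x hx => lt_of_lt_of_le one_pos hx.1
  refine ⟨2 ^ (-(|R| + 1)) * ∫ x, β x, by positivity, fun s hsR => ?_⟩
  have h1 : mellin (osc (fun x => (β x : ℂ)) (-s.im)) s =
      ((∫ x in Icc (1 : ℝ) 2, x ^ (s.re - 1) * β x : ℝ) : ℂ) := by
    rw [mellin, ← integral_complex_ofReal, ← setIntegral_eq_of_subset_of_forall_sdiff_eq_zero
      measurableSet_Ioi hsub (fun x hx => by simp [hz x hx.2])]
    refine setIntegral_congr_fun measurableSet_Ioi fun x hx => ?_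
    have hx : 0 < x := hx
    have hxc : (x : ℂ) ≠ 0 := by exact_mod_cast hx.ne'
    simp only [osc, smul_eq_mul]
    push_cast
    rw [← mul_assoc, Complex.cpow_def_of_ne_zero hxc, Complex.ofReal_cpow hx.le,
      Complex.cpow_def_of_ne_zero hxc, ← Complex.exp_add, ← Complex.ofReal_log hx.le]
    congr 2
    push_cast
    linear_combination -(Real.log x : ℂ) * Complex.re_add_im s
  have hcont : ContinuousOn (fun x : ℝ => x ^ (s.re - 1) * β x) (Icc 1 2) :=
    (continuousOn_id.rpow_const fun x hx => Or.inl (ne_of_gt (hsub hx))).mul hc.continuousOn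
  have hβi : ∫ x, β x = ∫ x in Icc (1 : ℝ) 2, β x :=
    (setIntegral_eq_integral_of_forall_compl_eq_zero hz).symm
  rw [h1, Complex.norm_real, hβi, ← integral_const_mul]
  refine le_trans ?_ (le_abs_self _)
  refine setIntegral_mono_on ((hc.continuousOn.const_mul _).integrableOn_compact isCompact_Icc)
    (hcont.integrableOn_compact isCompact_Icc) measurableSet_Icc fun x hx => ?_
  refine mul_le_mul_of_nonneg_right ?_ (h0 x)
  have h3 := abs_le.1 (hsR.trans (le_abs_self R))
  have hx0 : 0 < x := hsub hx
  calc (2 : ℝ) ^ (-(|R| + 1)) ≤ x ^ (-(|R| + 1)) :=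
        Real.rpow_le_rpow_of_nonpos hx0 hx.2 (by linarith [abs_nonneg R])
    _ ≤ x ^ (s.re - 1) := Real.rpow_le_rpow_of_exponent_le hx.1 (by linarith)

/-! ### The Mellin transform of a Fourier transform -/

lemma integrableOn_rpow_mul_exp_neg_mul {σ b : ℝ} (hσ : -1 < σ) (hb : 0 < b) :
    IntegrableOn (fun t : ℝ => t ^ σ * Real.exp (-b * t)) (Ioi 0) := by
  simpa using integrableOn_rpow_mul_exp_neg_mul_rpow hσ one_pos hb

lemma norm_exp_neg_mul_ofReal (r : ℂ) (t : ℝ) :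
    ‖Complex.exp (-(r * t))‖ = Real.exp (-r.re * t) := by
  rw [Complex.norm_exp]; simp

lemma aestronglyMeasurable_cpow_mul_exp (a r : ℂ) :
    AEStronglyMeasurable (fun t : ℝ => (t : ℂ) ^ a * Complex.exp (-(r * t)))
      (volume.restrict (Ioi 0)) :=
  (by fun_prop : Measurable fun t : ℝ => (t : ℂ) ^ a * Complex.exp (-(r * t))).aestronglyMeasurable

/-- Euler's integral with a complex rate. -/
lemma integral_cpow_mul_exp_neg_complex_mul_Ioi {s : ℂ} (hs : 0 < s.re) {r : ℂ} (hr : 0 < r.re) :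
    ∫ t in Ioi (0 : ℝ), (t : ℂ) ^ (s - 1) * Complex.exp (-(r * t)) =
      (1 / r) ^ s * Complex.Gamma s := by
  set F : ℂ → ℂ := fun r => ∫ t in Ioi (0 : ℝ), (t : ℂ) ^ (s - 1) * Complex.exp (-(r * t)) with hF
  have hU : IsOpen {r : ℂ | 0 < r.re} := isOpen_lt continuous_const Complex.continuous_re
  have hFd : DifferentiableOn ℂ F {r : ℂ | 0 < r.re} := by
    intro r hr
    have hr : 0 < r.re := hr
    have hint : IntegrableOn (fun t : ℝ => (t : ℂ) ^ (s - 1) * Complex.exp (-(r * t))) (Ioi 0) := by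
      refine (integrableOn_rpow_mul_exp_neg_mul (σ := s.re - 1) (by linarith) hr).mono'
        (aestronglyMeasurable_cpow_mul_exp _ _)
        ((ae_restrict_iff' measurableSet_Ioi).2 (Eventually.of_forall fun t ht => ?_))
      rw [norm_mul, Complex.norm_cpow_eq_rpow_re_of_pos ht, norm_exp_neg_mul_ofReal]
      simp
    have hball : ∀ z ∈ Metric.ball r (r.re / 2), r.re / 2 < z.re := fun z hz => by
      have h1 := (Complex.abs_re_le_norm (z - r)).trans_lt (mem_ball_iff_norm.1 hz)
      rw [Complex.sub_re] at h1
      linarith [(abs_lt.1 h1).1]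
    have h := hasDerivAt_integral_of_dominated_loc_of_deriv_le
      (μ := volume.restrict (Ioi (0 : ℝ))) (x₀ := r)
      (F := fun (r : ℂ) (t : ℝ) => (t : ℂ) ^ (s - 1) * Complex.exp (-(r * t)))
      (F' := fun (r : ℂ) (t : ℝ) => (t : ℂ) ^ (s - 1) * (Complex.exp (-(r * t)) * (-t)))
      (bound := fun t : ℝ => t ^ s.re * Real.exp (-(r.re / 2) * t))
      (Metric.ball_mem_nhds r (show 0 < r.re / 2 by linarith))
      (Eventually.of_forall fun z => aestronglyMeasurable_cpow_mul_exp _ _) hint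
      (by fun_prop : Measurable fun t : ℝ => (t : ℂ) ^ (s - 1) *
        (Complex.exp (-(r * t)) * (-t))).aestronglyMeasurable
      ((ae_restrict_iff' measurableSet_Ioi).2 (Eventually.of_forall fun t ht z hz => ?_))
      (integrableOn_rpow_mul_exp_neg_mul (by linarith) (by linarith))
      (Eventually.of_forall fun t z _ => ?_)
    · exact h.2.differentiableAt.differentiableWithinAt
    · have ht : 0 < t := ht
      rw [norm_mul, norm_mul, Complex.norm_cpow_eq_rpow_re_of_pos ht, norm_exp_neg_mul_ofReal,
        norm_neg, Complex.norm_real, Real.norm_of_nonneg ht.le, Complex.sub_re, Complex.one_re,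
        Real.rpow_sub_one ht.ne', mul_comm (Real.exp _) t, ← mul_assoc, div_mul_cancel₀ _ ht.ne']
      gcongr
      exact (hball z hz).le
    · have h1 : HasDerivAt (fun z : ℂ => -(z * (t : ℂ))) (-t) z := by
        have h2 := ((hasDerivAt_id z).mul_const (t : ℂ)).neg
        rw [one_mul] at h2
        exact h2
      exact h1.cexp.const_mul _
  have hGd : DifferentiableOn ℂ (fun r : ℂ => (1 / r) ^ s * Complex.Gamma s)
      {r : ℂ | 0 < r.re} := by
    intro r hr
    have hr : 0 < r.re := hr
    have hr0 : r ≠ 0 := fun h => by simp [h] at hr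
    have hsl : 1 / r ∈ Complex.slitPlane := by
      refine Or.inl ?_
      rw [one_div, Complex.inv_re]
      exact div_pos hr (Complex.normSq_pos.2 hr0)
    exact ((((differentiableAt_const _).div differentiableAt_id hr0).cpow
      (differentiableAt_const _) hsl).mul_const _).differentiableWithinAt
  -- Both sides are analytic in `r` on the right half plane and agree at real `r > 1`, a set
  -- accumulating at `1`.
  refine (hFd.analyticOnNhd hU).eqOn_of_preconnected_of_frequently_eq (hGd.analyticOnNhd hU)
    (convex_halfSpace_re_gt 0).isPreconnected (z₀ := 1) (by simp) ?_ hr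
  have hmap : Tendsto (fun x : ℝ => (x : ℂ)) (𝓝[>] 1) (𝓝[≠] 1) := by
    refine tendsto_nhdsWithin_iff.2 ⟨?_, ?_⟩
    · have := Complex.continuous_ofReal.tendsto (1 : ℝ)
      rw [Complex.ofReal_one] at this
      exact this.mono_left nhdsWithin_le_nhds
    · filter_upwards [self_mem_nhdsWithin] with x hx
      have hx : 1 < x := hx
      intro h
      have h : (x : ℂ) = 1 := h
      exact hx.ne' (by exact_mod_cast h)
  refine hmap.frequently (Eventually.frequently ?_)
  filter_upwards [self_mem_nhdsWithin] with x hx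
  have hx : 1 < x := hx
  exact Complex.integral_cpow_mul_exp_neg_mul_Ioi hs (by linarith)

/-- The bound does not involve `ε`, since only the imaginary part `2πx` and `|arg| ≤ π` enter. It is
the dominating function for the limit `ε → 0`. -/
lemma norm_one_div_cpow_le {s : ℂ} (hs : 0 < s.re) {ε x : ℝ} (hx : x ≠ 0) :
    ‖(1 / ((ε : ℂ) + 2 * Real.pi * Complex.I * x)) ^ s‖ ≤
      (2 * Real.pi) ^ (-s.re) * Real.exp (Real.pi * |s.im|) * |x| ^ (-s.re) := by
  set z : ℂ := (ε : ℂ) + 2 * Real.pi * Complex.I * x with hz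
  have him : z.im = 2 * Real.pi * x := by simp [hz]
  have hx0 : 0 < |x| := abs_pos.2 hx
  have h1 : 2 * Real.pi * |x| ≤ ‖z‖ := by
    have := Complex.abs_im_le_norm z
    rwa [him, abs_mul, abs_of_pos Real.two_pi_pos] at this
  have h2 : ‖1 / z‖ ^ s.re ≤ (2 * Real.pi) ^ (-s.re) * |x| ^ (-s.re) := by
    rw [← Real.mul_rpow Real.two_pi_pos.le hx0.le, norm_div, norm_one, one_div,
      Real.inv_rpow (norm_nonneg _), ← Real.rpow_neg (norm_nonneg _)]
    exact Real.rpow_le_rpow_of_nonpos (by positivity) h1 (by linarith)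
  have h3 : (Real.exp (Complex.arg (1 / z) * s.im))⁻¹ ≤ Real.exp (Real.pi * |s.im|) := by
    rw [← Real.exp_neg]
    refine Real.exp_le_exp.2 ((neg_le_abs _).trans ?_)
    rw [abs_mul]
    exact mul_le_mul_of_nonneg_right (Complex.abs_arg_le_pi _) (abs_nonneg _)
  calc _ ≤ ‖1 / z‖ ^ s.re / Real.exp (Complex.arg (1 / z) * s.im) := Complex.norm_cpow_le _ _
    _ = ‖1 / z‖ ^ s.re * (Real.exp (Complex.arg (1 / z) * s.im))⁻¹ := div_eq_mul_inv _ _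
    _ ≤ ((2 * Real.pi) ^ (-s.re) * |x| ^ (-s.re)) * Real.exp (Real.pi * |s.im|) := by gcongr
    _ = _ := by ring

/-- The factor `e^{-εv}` makes the double integral absolutely convergent. After Fubini the inner
integral is Euler's, with complex rate `ε + 2πix`. -/
lemma mellin_exp_mul_fourier {f : ℝ → ℂ} (hf : Integrable f) {s : ℂ} (hs : 0 < s.re) {ε : ℝ}
    (hε : 0 < ε) :
    ∫ v in Ioi (0 : ℝ), (v : ℂ) ^ (s - 1) * (Complex.exp (-(ε * v)) * 𝓕 f v) =
      Complex.Gamma s * ∫ x, f x * (1 / ((ε : ℂ) + 2 * Real.pi * Complex.I * x)) ^ s := by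
  have h1 : Integrable (fun v : ℝ => (v : ℂ) ^ (s - 1) * Complex.exp (-(ε * v)))
      (volume.restrict (Ioi 0)) := by
    have h := Complex.GammaIntegral_convergent hs
    have h' := (integrableOn_Ioi_comp_mul_left_iff _ 0 hε).2 (by simpa using h)
    refine (IntegrableOn.congr_fun (h'.const_mul (((ε : ℂ) ^ (s - 1))⁻¹)) (fun v hv => ?_)
      measurableSet_Ioi)
    have hv : 0 < v := hv
    have he : ((ε : ℂ) ^ (s - 1)) ≠ 0 := by
      rw [Ne, Complex.cpow_eq_zero_iff, not_and_or]
      exact Or.inl (by exact_mod_cast hε.ne')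
    simp only [Complex.ofReal_mul]
    rw [Complex.mul_cpow_ofReal_nonneg hε.le hv.le]
    field_simp
  have hprod : Integrable (fun p : ℝ × ℝ => Complex.exp (-(2 * Real.pi * Complex.I * p.2 * p.1)) *
      (((p.1 : ℂ) ^ (s - 1) * Complex.exp (-(ε * p.1))) * f p.2))
      ((volume.restrict (Ioi 0)).prod volume) := by
    refine (h1.mul_prod hf).bdd_mul (c := 1) ?_ (Eventually.of_forall fun p => ?_)
    · exact (by fun_prop : Continuous fun p : ℝ × ℝ =>
        Complex.exp (-(2 * Real.pi * Complex.I * p.2 * p.1))).aestronglyMeasurable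
    · rw [Complex.norm_exp]; simp
  have h2 : ∀ v : ℝ, (v : ℂ) ^ (s - 1) * (Complex.exp (-(ε * v)) * 𝓕 f v) =
      ∫ x : ℝ, Complex.exp (-(2 * Real.pi * Complex.I * x * v)) *
      (((v : ℂ) ^ (s - 1) * Complex.exp (-(ε * v))) * f x) := by
    intro v
    rw [Real.fourier_eq', ← integral_const_mul, ← integral_const_mul]
    refine integral_congr_ae (Eventually.of_forall fun x => ?_)
    simp only [smul_eq_mul, RCLike.inner_apply, conj_trivial]
    have : (((-2 * Real.pi * (v * x) : ℝ) : ℂ) * Complex.I) =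
      (-(2 * Real.pi * Complex.I * x * v)) := by push_cast; ring
    rw [this]; ring
  simp only [h2]
  rw [integral_integral_swap hprod, ← integral_const_mul]
  refine integral_congr_ae (Eventually.of_forall fun x => ?_)
  have hr : 0 < ((ε : ℂ) + 2 * Real.pi * Complex.I * x).re := by simpa using hε
  have h3 := integral_cpow_mul_exp_neg_complex_mul_Ioi hs hr
  simp only
  rw [mul_comm (f x), ← mul_assoc, mul_comm (Complex.Gamma s), ← h3, ← integral_mul_const]
  refine integral_congr_ae (Eventually.of_forall fun v => ?_)
  simp only
  rw [add_mul, neg_add, Complex.exp_add]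
  ring

/-- Let `ε → 0` in `mellin_exp_mul_fourier`, by dominated convergence on both sides. Off `x = 0` the
limiting base lies on the imaginary axis, inside the slit plane, so the power is continuous there.
-/
lemma mellin_fourier {f : ℝ → ℂ} (hf : Integrable f) {s : ℂ} (hs : 0 < s.re)
    (hfs : Integrable fun x => ‖f x‖ * |x| ^ (-s.re)) (hm : MellinConvergent (𝓕 f) s) :
    mellin (𝓕 f) s = Complex.Gamma s * ∫ x, f x * (1 / (2 * Real.pi * Complex.I * x)) ^ s := by
  have h1 : Tendsto (fun ε : ℝ => ∫ v in Ioi (0 : ℝ),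
      (v : ℂ) ^ (s - 1) * (Complex.exp (-(ε * v)) * 𝓕 f v)) (𝓝[>] 0) (𝓝 (mellin (𝓕 f) s)) := by
    refine tendsto_integral_filter_of_dominated_convergence (fun v => ‖(v : ℂ) ^ (s - 1) • 𝓕 f v‖)
      ?_ ?_ hm.norm ?_
    · refine Eventually.of_forall fun ε => ?_
      have : (fun v : ℝ => (v : ℂ) ^ (s - 1) * (Complex.exp (-(ε * v)) * 𝓕 f v)) =
          fun v : ℝ => Complex.exp (-(ε * v)) * ((v : ℂ) ^ (s - 1) • 𝓕 f v) := by
        funext v; simp only [smul_eq_mul]; ring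
      rw [this]
      exact (by fun_prop : Continuous fun v : ℝ => Complex.exp (-(ε * v))).aestronglyMeasurable.mul
        hm.aestronglyMeasurable
    · filter_upwards [self_mem_nhdsWithin] with ε hε
      refine (ae_restrict_iff' measurableSet_Ioi).2 (Eventually.of_forall fun v hv => ?_)
      have h2 : ‖Complex.exp (-(ε * v))‖ ≤ 1 := by
        rw [Complex.norm_exp]
        have : 0 ≤ ε * v := mul_nonneg (le_of_lt hε) (le_of_lt hv)
        simpa using this
      rw [norm_smul, norm_mul, norm_mul]
      gcongr
      exact mul_le_of_le_one_left (norm_nonneg _) h2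
    · refine Eventually.of_forall fun v => ?_
      have : Continuous fun ε : ℝ => (v : ℂ) ^ (s - 1) * (Complex.exp (-(ε * v)) * 𝓕 f v) := by
        fun_prop
      have h2 := (this.tendsto 0).mono_left (nhdsWithin_le_nhds (s := Ioi 0))
      simpa using h2
  have h2 : Tendsto (fun ε : ℝ => Complex.Gamma s *
      ∫ x, f x * (1 / ((ε : ℂ) + 2 * Real.pi * Complex.I * x)) ^ s) (𝓝[>] 0)
      (𝓝 (Complex.Gamma s * ∫ x, f x * (1 / (2 * Real.pi * Complex.I * x)) ^ s)) := by
    refine Tendsto.const_mul _ ?_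
    have hne : ∀ᵐ x : ℝ, x ≠ 0 := by simp [ae_iff, measure_singleton]
    refine tendsto_integral_filter_of_dominated_convergence
      (fun x => ((2 * Real.pi) ^ (-s.re) * Real.exp (Real.pi * |s.im|)) *
        (‖f x‖ * |x| ^ (-s.re))) ?_ ?_ (hfs.const_mul _) ?_
    · refine Eventually.of_forall fun ε => hf.aestronglyMeasurable.mul ?_
      exact (by fun_prop : Measurable fun x : ℝ =>
        (1 / ((ε : ℂ) + 2 * Real.pi * Complex.I * x)) ^ s).aestronglyMeasurable
    · refine Eventually.of_forall fun ε => ?_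
      filter_upwards [hne] with x hx
      rw [norm_mul]
      calc _ ≤ ‖f x‖ * ((2 * Real.pi) ^ (-s.re) * Real.exp (Real.pi * |s.im|) * |x| ^ (-s.re)) :=
            mul_le_mul_of_nonneg_left (norm_one_div_cpow_le hs hx) (norm_nonneg _)
        _ = _ := by ring
    · filter_upwards [hne] with x hx
      have hpi := Real.pi_ne_zero
      have h0 : (2 * Real.pi * Complex.I * x : ℂ) ≠ 0 := by
        have : (x : ℂ) ≠ 0 := by exact_mod_cast hx
        have : (Real.pi : ℂ) ≠ 0 := by exact_mod_cast hpi
        simp_all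
      have hslit : 1 / (((0 : ℝ) : ℂ) + 2 * Real.pi * Complex.I * x) ∈ Complex.slitPlane := by
        refine Or.inr ?_
        rw [Complex.ofReal_zero, zero_add, one_div, Complex.inv_im]
        have h3 : Complex.normSq (2 * Real.pi * Complex.I * x) ≠ 0 := by simpa using h0
        have h4 : (2 * Real.pi * Complex.I * x : ℂ).im = 2 * Real.pi * x := by simp
        rw [h4]
        exact div_ne_zero (by simp [hx, hpi]) h3
      have hc : ContinuousAt (fun ε : ℝ => f x *
          (1 / ((ε : ℂ) + 2 * Real.pi * Complex.I * x)) ^ s) 0 := by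
        refine continuousAt_const.mul (ContinuousAt.cpow ?_ continuousAt_const hslit)
        refine continuousAt_const.div (by fun_prop) ?_
        simpa using h0
      have h5 := hc.tendsto.mono_left (nhdsWithin_le_nhds (s := Ioi 0))
      simpa using h5
  refine tendsto_nhds_unique h1 (h2.congr' ?_)
  filter_upwards [self_mem_nhdsWithin] with ε hε
  exact (mellin_exp_mul_fourier hf hs hε).symm

/-- For `x > 0` the base is a positive number times `-i`, whose principal logarithm is `-πi/2`; for
`-x` the factor is `i`. The two exponentials combine in `gamma_factor`. -/
lemma one_div_cpow_of_pos {x : ℝ} (hx : 0 < x) (s : ℂ) :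
    (1 / (2 * Real.pi * Complex.I * x)) ^ s =
      Complex.exp (-(Real.pi / 2 * Complex.I * s)) * ((2 * Real.pi : ℂ) ^ (-s) * (x : ℂ) ^ (-s)) := by
  have hp : 0 < (2 * Real.pi * x)⁻¹ := by positivity
  have h1 : (1 / (2 * Real.pi * Complex.I * x) : ℂ) =
      (((2 * Real.pi * x)⁻¹ : ℝ) : ℂ) * (-Complex.I) := by
    push_cast
    rw [one_div, mul_inv, mul_inv, mul_inv, mul_inv, mul_inv, Complex.inv_I]; ring
  have hI : (-Complex.I) ≠ 0 := by simp
  have h2 : (2 * Real.pi : ℂ) ^ (-s) * (x : ℂ) ^ (-s) = ((2 * Real.pi * x : ℝ) : ℂ) ^ (-s) := by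
    rw [Complex.ofReal_mul, Complex.mul_cpow_ofReal_nonneg Real.two_pi_pos.le hx.le]
    push_cast; rfl
  have h3 : ((2 * Real.pi * x : ℝ) : ℂ) ≠ 0 := by
    exact_mod_cast (by positivity : (2 * Real.pi * x : ℝ) ≠ 0)
  rw [h2, h1, Complex.cpow_def_of_ne_zero (mul_ne_zero (by exact_mod_cast hp.ne') hI),
    Complex.log_ofReal_mul hp hI, Complex.log_neg_I, Complex.cpow_def_of_ne_zero h3,
    ← Complex.exp_add, ← Complex.ofReal_log (by positivity), Real.log_inv]
  congr 1
  push_cast; ring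

lemma one_div_neg_cpow_of_pos {x : ℝ} (hx : 0 < x) (s : ℂ) :
    (1 / (2 * Real.pi * Complex.I * (-x : ℝ))) ^ s =
      Complex.exp (Real.pi / 2 * Complex.I * s) * ((2 * Real.pi : ℂ) ^ (-s) * (x : ℂ) ^ (-s)) := by
  have hp : 0 < (2 * Real.pi * x)⁻¹ := by positivity
  have h1 : (1 / (2 * Real.pi * Complex.I * (-x : ℝ)) : ℂ) =
      (((2 * Real.pi * x)⁻¹ : ℝ) : ℂ) * Complex.I := by
    push_cast
    rw [one_div, mul_neg, inv_neg, mul_inv, mul_inv, mul_inv, mul_inv, mul_inv, Complex.inv_I]; ring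
  have h2 : (2 * Real.pi : ℂ) ^ (-s) * (x : ℂ) ^ (-s) = ((2 * Real.pi * x : ℝ) : ℂ) ^ (-s) := by
    rw [Complex.ofReal_mul, Complex.mul_cpow_ofReal_nonneg Real.two_pi_pos.le hx.le]
    push_cast; rfl
  have h3 : ((2 * Real.pi * x : ℝ) : ℂ) ≠ 0 := by
    exact_mod_cast (by positivity : (2 * Real.pi * x : ℝ) ≠ 0)
  rw [h2, h1, Complex.cpow_def_of_ne_zero (mul_ne_zero (by exact_mod_cast hp.ne') Complex.I_ne_zero),
    Complex.log_ofReal_mul hp Complex.I_ne_zero, Complex.log_I, Complex.cpow_def_of_ne_zero h3,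
    ← Complex.exp_add, ← Complex.ofReal_log (by positivity), Real.log_inv]
  congr 1
  push_cast; ring

lemma gamma_factor (δ : ZMod 2) (s : ℂ) :
    Complex.exp (Real.pi / 2 * Complex.I * s) + sgn δ * Complex.exp (-(Real.pi / 2 * Complex.I * s))
      = 2 * Complex.I ^ δ.val * Complex.cos (Real.pi * (s - δ.val) / 2) := by
  have hδ : δ.val = 0 ∨ δ.val = 1 := by have := δ.val_lt; omega
  rcases hδ with h | h
  · rw [sgn, h, pow_zero, pow_zero, Nat.cast_zero, Complex.cos]
    ring_nf
  · rw [sgn, h, pow_one, pow_one, Nat.cast_one, show (Real.pi * (s - 1) / 2 : ℂ) =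
      Real.pi * s / 2 - Real.pi / 2 by ring, Complex.cos_sub_pi_div_two, Complex.sin]
    have e1 : (-(Real.pi * s / 2) * Complex.I : ℂ) = -(Real.pi / 2 * Complex.I * s) := by ring
    have e2 : (Real.pi * s / 2 * Complex.I : ℂ) = Real.pi / 2 * Complex.I * s := by ring
    rw [e1, e2]
    linear_combination (-(Complex.exp (-(Real.pi / 2 * Complex.I * s)) -
      Complex.exp (Real.pi / 2 * Complex.I * s))) * Complex.I_mul_I

/-- The part of parity `δ` of `φ`, up to a factor `2`. -/
def parPart (δ : ZMod 2) (φ : ℝ → ℂ) (x : ℝ) : ℂ := φ x + sgn δ * φ (-x)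

lemma integral_eq_integral_Ioi_add {F : ℝ → ℂ} (hF : Integrable F) :
    ∫ x, F x = ∫ x in Ioi (0 : ℝ), (F x + F (-x)) := by
  rw [integral_add hF.integrableOn hF.comp_neg.integrableOn, integral_comp_neg_Ioi, neg_zero,
    add_comm, intervalIntegral.integral_Iic_add_Ioi hF.integrableOn hF.integrableOn]

lemma integrable_mul_one_div_cpow {f : ℝ → ℂ} (hf : Integrable f) {s : ℂ} (hs : 0 < s.re)
    (hfs : Integrable fun x => ‖f x‖ * |x| ^ (-s.re)) :
    Integrable fun x => f x * (1 / (2 * Real.pi * Complex.I * x)) ^ s := by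
  have hne : ∀ᵐ x : ℝ, x ≠ 0 := by simp [ae_iff, measure_singleton]
  refine (hfs.const_mul ((2 * Real.pi) ^ (-s.re) * Real.exp (Real.pi * |s.im|))).mono'
    (hf.aestronglyMeasurable.mul (by fun_prop : Measurable fun x : ℝ =>
        (1 / (2 * Real.pi * Complex.I * x)) ^ s).aestronglyMeasurable) ?_
  filter_upwards [hne] with x hx
  have h1 := norm_one_div_cpow_le hs (ε := 0) hx
  rw [Complex.ofReal_zero, zero_add] at h1
  rw [norm_mul]
  calc _ ≤ ‖f x‖ * ((2 * Real.pi) ^ (-s.re) * Real.exp (Real.pi * |s.im|) * |x| ^ (-s.re)) :=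
        mul_le_mul_of_nonneg_left h1 (norm_nonneg _)
    _ = _ := by ring

/-- The functional equation of the Mellin transform under the Fourier transform. -/
lemma mellin_parFourier (δ : ZMod 2) (φ : 𝓢(ℝ, ℂ)) {s : ℂ} (hs : 0 < s.re)
    (hφ : Integrable fun x => ‖φ x‖ * |x| ^ (-s.re)) :
    mellin (parFourier δ φ) s = G δ s * mellin (parPart δ φ) (1 - s) := by
  have hφ' : Integrable fun x => ‖φ (-x)‖ * |x| ^ (-s.re) := by simpa using hφ.comp_neg
  have hm := mellinConvergent_schwartz (𝓕 φ) hs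
  have hm' := mellinConvergent_schwartz (𝓕⁻ φ) hs
  rw [SchwartzMap.fourier_coe] at hm
  rw [SchwartzMap.fourierInv_coe] at hm'
  have h1 := mellin_fourier φ.integrable hs hφ hm
  have h2 : mellin (𝓕⁻ (φ : ℝ → ℂ)) s = Complex.Gamma s *
      ∫ x : ℝ, φ (-x) * (1 / (2 * Real.pi * Complex.I * x)) ^ s := by
    rw [Real.fourierInv_eq_fourier_comp_neg] at hm' ⊢
    exact mellin_fourier (f := fun x => φ (-x)) φ.integrable.comp_neg hs hφ' hm'
  have h3 : mellin (parFourier δ φ) s = mellin (𝓕⁻ (φ : ℝ → ℂ)) s +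
      sgn δ * mellin (𝓕 (φ : ℝ → ℂ)) s := by
    have h4 := (hasMellin_add hm' (hm.const_smul (sgn δ))).2
    rw [mellin_const_smul] at h4
    rw [← smul_eq_mul, ← h4]
    congr 1
    funext x
    simp [parFourier_apply]
  have hint := integrable_mul_one_div_cpow φ.integrable hs hφ
  have hint' := integrable_mul_one_div_cpow (f := fun x => φ (-x)) φ.integrable.comp_neg hs hφ'
  have hadd : Integrable fun x : ℝ => φ (-x) * (1 / (2 * Real.pi * Complex.I * x)) ^ s +
      sgn δ * (φ x * (1 / (2 * Real.pi * Complex.I * x)) ^ s) := hint'.add (hint.const_mul _)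
  rw [h3, h1, h2, mul_left_comm, ← mul_add, ← integral_const_mul, ← integral_add hint'
    (hint.const_mul _), integral_eq_integral_Ioi_add hadd, G, mellin,
    ← integral_const_mul, ← integral_const_mul]
  refine setIntegral_congr_fun measurableSet_Ioi fun x hx => ?_
  have hx : 0 < x := hx
  simp only [parPart, neg_neg, smul_eq_mul]
  rw [one_div_cpow_of_pos hx, one_div_neg_cpow_of_pos hx, show (1 - s - 1 : ℂ) = -s by ring]
  linear_combination (Complex.Gamma s * (2 * Real.pi : ℂ) ^ (-s) * (x : ℂ) ^ (-s) *
    (φ x + sgn δ * φ (-x))) * gamma_factor δ s + (-Complex.Gamma s * (2 * Real.pi : ℂ) ^ (-s) *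
    (x : ℂ) ^ (-s) * φ (-x) * Complex.exp (-(Real.pi / 2 * Complex.I * s))) * sgn_mul_self δ

/-! ### From vanishing to infinite order to analytic continuation -/

lemma fourierInv_dil {y : ℝ} (hy : 0 < y) (φ : 𝓢(ℝ, ℂ)) (w : ℝ) :
    𝓕⁻ (dil y φ : ℝ → ℂ) w = (y : ℂ)⁻¹ * 𝓕⁻ (φ : ℝ → ℂ) (w / y) := by
  rw [← integral_e_mul, ← integral_e_mul]
  have h1 := Measure.integral_comp_mul_left (fun u : ℝ => e (w / y * u) * φ u) y
  have h2 : ∀ x : ℝ, e (w * x) * dil y φ x = e (w / y * (y * x)) * φ (y * x) := fun x => by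
    rw [dil_apply hy.ne', show w / y * (y * x) = w * x by field_simp]
  simp only [h2]
  rw [h1, abs_of_pos (inv_pos.2 hy), Complex.real_smul, Complex.ofReal_inv]

lemma parFourier_dil (δ : ZMod 2) {y : ℝ} (hy : 0 < y) (φ : 𝓢(ℝ, ℂ)) (w : ℝ) :
    parFourier δ (dil y φ) w = (y : ℂ)⁻¹ * parFourier δ φ (w / y) := by
  have h : ∀ (ψ : 𝓢(ℝ, ℂ)) (x : ℝ), 𝓕 (ψ : ℝ → ℂ) x = 𝓕⁻ (ψ : ℝ → ℂ) (-x) := fun ψ x => by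
    rw [Real.fourierInv_eq_fourier_neg, neg_neg]
  rw [parFourier_apply, parFourier_apply, h, h, fourierInv_dil hy, fourierInv_dil hy, neg_div]
  ring

variable {ν : ℂ} {δ : ZMod 2} {a : ℤ → ℂ} {τ : 𝓢'(ℝ, ℂ)}

/-- This converts the behaviour of `theta` as `v → 0` into that of `τ` on dilates by `y = v⁻¹ → ∞`.
-/
lemma IsFourierSeries.theta_eq
    (hpar : ∀ n : ℕ, 1 ≤ n → a (-(n : ℤ)) = (-1) ^ δ.val * a n)
    (hτ : IsFourierSeries ν a τ) (φ : 𝓢(ℝ, ℂ)) {v : ℝ} (hv : 0 < v) :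
    theta (coef ν a) (parFourier δ φ) v = (v : ℂ)⁻¹ * τ (dil v⁻¹ φ) := by
  rw [← (hτ.hasSum hpar (dil v⁻¹ φ)).tsum_eq, ← tsum_mul_left, theta]
  refine tsum_congr fun n => ?_
  have hvc : (v : ℂ) ≠ 0 := by exact_mod_cast hv.ne'
  rw [parFourier_dil δ (inv_pos.2 hv), div_inv_eq_mul, Complex.ofReal_inv, inv_inv]
  field_simp

/-- Decay at `∞` holds for every `τ` of this form; decay at `0` is where vanishing enters. -/
lemma IsFourierSeries.exists_decaysBothEnds
    (hpar : ∀ n : ℕ, 1 ≤ n → a (-(n : ℤ)) = (-1) ^ δ.val * a n)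
    (hb : PolySeq (coef ν a)) (hτ : IsFourierSeries ν a τ) (hv : VanishesToInfiniteOrder τ)
    (K : ℕ) : ∃ C : ℝ, 0 ≤ C ∧ ∃ s : Finset (ℕ × ℕ), ∀ φ : 𝓢(ℝ, ℂ),
      DecaysBothEnds (theta (coef ν a) (parFourier δ φ)) K
        (C * (s.sup (schwartzSeminormFamily ℂ ℝ ℂ)) φ) := by
  obtain ⟨C1, hC1, p, h1⟩ := hb.norm_theta_le K
  obtain ⟨s2, C2, hC2, h2⟩ := exists_seminorm_le_sup (parFourier δ) (p, 0)
  -- Order `K + 1`, because the factor `v⁻¹` in `theta_eq` loses one power.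
  obtain ⟨C3, hC3, s3, h3⟩ := (hv (K + 1)).dominated_dil
  refine ⟨C1 * C2 + C3, by positivity, s2 ∪ s3, fun φ => ⟨fun v hv1 => ?_, fun v hv0 hv1 => ?_⟩⟩
  · have hv0 : 0 < v := by linarith
    have h4 := finset_sup_mono (Finset.subset_union_left (s₁ := s2) (s₂ := s3)) φ
    have h5 : 0 ≤ ((s2 ∪ s3).sup (schwartzSeminormFamily ℂ ℝ ℂ)) φ := apply_nonneg _ _
    calc _ ≤ C1 * SchwartzMap.seminorm ℂ p 0 (parFourier δ φ) * (v ^ K)⁻¹ := h1 _ v hv1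
      _ ≤ C1 * (C2 * ((s2 ∪ s3).sup (schwartzSeminormFamily ℂ ℝ ℂ)) φ) * (v ^ K)⁻¹ := by
        gcongr
        exact (h2 φ).trans (mul_le_mul_of_nonneg_left h4 hC2)
      _ = C1 * C2 * ((s2 ∪ s3).sup (schwartzSeminormFamily ℂ ℝ ℂ)) φ * (v ^ K)⁻¹ := by ring
      _ ≤ _ := by gcongr; linarith
  · have h4 := finset_sup_mono (Finset.subset_union_right (s₁ := s2) (s₂ := s3)) φ
    have h5 : 0 ≤ ((s2 ∪ s3).sup (schwartzSeminormFamily ℂ ℝ ℂ)) φ := apply_nonneg _ _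
    have h6 := h3 φ v⁻¹ ((one_le_inv₀ hv0).2 hv1)
    rw [inv_pow, inv_inv] at h6
    rw [hτ.theta_eq hpar φ hv0, norm_mul, norm_inv, Complex.norm_real, Real.norm_of_nonneg hv0.le]
    calc _ ≤ v⁻¹ * (C3 * v ^ (K + 1) * (s3.sup (schwartzSeminormFamily ℂ ℝ ℂ)) φ) := by gcongr
      _ = C3 * (s3.sup (schwartzSeminormFamily ℂ ℝ ℂ)) φ * v ^ K := by
        rw [pow_succ]; field_simp
      _ ≤ C3 * ((s2 ∪ s3).sup (schwartzSeminormFamily ℂ ℝ ℂ)) φ * v ^ K := by gcongr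
      _ ≤ _ := by
        gcongr
        linarith [mul_nonneg hC1 hC2]

lemma IsFourierSeries.differentiable_mellin_theta
    (hpar : ∀ n : ℕ, 1 ≤ n → a (-(n : ℤ)) = (-1) ^ δ.val * a n)
    (hb : PolySeq (coef ν a)) (hτ : IsFourierSeries ν a τ) (hv : VanishesToInfiniteOrder τ)
    (φ : 𝓢(ℝ, ℂ)) : Differentiable ℂ (mellin (theta (coef ν a) (parFourier δ φ))) := by
  refine differentiable_mellin_of_decaysBothEnds (hb.continuousOn_theta _) fun K => ?_
  obtain ⟨C, -, s, h⟩ := hτ.exists_decaysBothEnds hpar hb hv K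
  exact ⟨_, h φ⟩

lemma IsFourierSeries.mellin_theta_le
    (hpar : ∀ n : ℕ, 1 ≤ n → a (-(n : ℤ)) = (-1) ^ δ.val * a n)
    (hb : PolySeq (coef ν a)) (hτ : IsFourierSeries ν a τ) (hv : VanishesToInfiniteOrder τ)
    {φ : ℝ → 𝓢(ℝ, ℂ)} (hφ : PolyFamily φ) (R : ℝ) :
    ∃ C : ℝ, 0 ≤ C ∧ ∃ N : ℕ, ∀ s : ℂ, |s.re| ≤ R →
      ‖mellin (theta (coef ν a) (parFourier δ (φ s.im))) s‖ ≤ C * (1 + |s.im|) ^ N := by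
  obtain ⟨K, hK⟩ := exists_nat_ge (R + 1)
  obtain ⟨C0, hC0, h0⟩ := exists_norm_mellin_le
  obtain ⟨C1, hC1, s1, h1⟩ := hτ.exists_decaysBothEnds hpar hb hv K
  obtain ⟨C2, hC2, N, h2⟩ := hφ.sup s1
  refine ⟨C0 * (C1 * C2), by positivity, N, fun s hs => ?_⟩
  refine (h0 _ K _ s (mul_nonneg hC1 (apply_nonneg _ _)) (h1 (φ s.im)) (by linarith)).trans ?_
  rw [mul_assoc, mul_assoc]
  gcongr
  exact h2 s.im

/-- On `x > 0` the term `𝓕⁻ 𝓕 ψ` gives `ψ(x)`, while `𝓕 𝓕 ψ` gives `ψ(-x) = 0`. -/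
lemma mellin_parFourier_fourier (δ : ZMod 2) {ψ : 𝓢(ℝ, ℂ)} (hψ : tsupport ψ ⊆ Icc 1 2) (s : ℂ) :
    mellin (parFourier δ (𝓕 ψ)) s = mellin ψ s := by
  refine setIntegral_congr_fun measurableSet_Ioi fun x hx => ?_
  have hx : 0 < x := hx
  have h1 : ψ (-x) = 0 := image_eq_zero_of_notMem_tsupport fun h => by
    have := (hψ h).1; linarith
  have h2 : 𝓕⁻ (𝓕 ψ : 𝓢(ℝ, ℂ)) = ψ := FourierTransform.fourierInv_fourier_eq ψ
  have h3 : 𝓕⁻ ((𝓕 ψ : 𝓢(ℝ, ℂ)) : ℝ → ℂ) = ψ := by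
    rw [← SchwartzMap.fourierInv_coe, h2]
  have h4 : 𝓕 ((𝓕 ψ : 𝓢(ℝ, ℂ)) : ℝ → ℂ) x = ψ (-x) := by
    rw [← h3, Real.fourierInv_eq_fourier_neg, neg_neg]
  simp only [parFourier_apply]
  rw [h3, h4, h1, mul_zero, add_zero]

lemma integrable_mul_rpow_of_tsupport {ψ : 𝓢(ℝ, ℂ)} (hψ : tsupport ψ ⊆ Icc 1 2) (r : ℝ) :
    Integrable fun x => ‖ψ x‖ * |x| ^ r := by
  have hz : ∀ x, x ∉ Icc (1 : ℝ) 2 → ‖ψ x‖ * |x| ^ r = 0 := fun x hx => by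
    rw [image_eq_zero_of_notMem_tsupport fun h => hx (hψ h), norm_zero, zero_mul]
  refine (integrableOn_iff_integrable_of_support_subset (s := Icc (1 : ℝ) 2) fun x hx => ?_).1 ?_
  · by_contra h
    exact hx (hz x h)
  · refine ContinuousOn.integrableOn_compact isCompact_Icc ?_
    refine ψ.continuous.norm.continuousOn.mul (continuous_abs.continuousOn.rpow_const fun x hx => ?_)
    exact Or.inl (abs_ne_zero.2 (by linarith [hx.1]))

lemma mellin_parPart_of_tsupport (δ : ZMod 2) {ψ : ℝ → ℂ} (hψ : tsupport ψ ⊆ Icc 1 2) (s : ℂ) :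
    mellin (parPart δ ψ) s = mellin ψ s := by
  refine setIntegral_congr_fun measurableSet_Ioi fun x hx => ?_
  have hx : 0 < x := hx
  have h1 : ψ (-x) = 0 := image_eq_zero_of_notMem_tsupport fun h => by
    have := (hψ h).1; linarith
  simp only [parPart, h1, mul_zero, add_zero]

/-- Testing on the Fourier transform of a bump makes `parFourier` equal to the bump on `(0, ∞)`, so
no Gamma factor appears. The parameter is `-t` to cancel the phase of `x^s` at `t = Im s`. -/
lemma IsFourierSeries.extends_lseries
    (hpar : ∀ n : ℕ, 1 ≤ n → a (-(n : ℤ)) = (-1) ^ δ.val * a n)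
    (hb : PolySeq (coef ν a)) (hτ : IsFourierSeries ν a τ) (hv : VanishesToInfiniteOrder τ) :
    ExtendsToEntireOfModerateGrowth (LSeries (coef ν a)) := by
  obtain ⟨c, hc⟩ := PolySeq.exists_lseriesSummable (b := coef ν a)
    (by obtain ⟨-, C, -, N, h⟩ := hb; exact ⟨C, N, h⟩)
  obtain ⟨β, hβ, hs, h0, hcont, hpos⟩ := exists_bump
  set φ : ℝ → 𝓢(ℝ, ℂ) := fun t => 𝓕 (oscS hβ hs (-t)) with hφ
  have hφp : PolyFamily φ := (polyFamily_oscS hβ hs).comp_neg.map (fourierCLM ℂ 𝓢(ℝ, ℂ))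
  refine extends_of_family (c := max c 0) (M := fun t => mellin (osc (fun x => (β x : ℂ)) (-t)))
    (Λ := fun t => mellin (theta (coef ν a) (parFourier δ (φ t))))
    (fun t => differentiable_mellin_osc hβ hs _)
    (fun t => hτ.differentiable_mellin_theta hpar hb hv _) (fun t s hs' => ?_)
    (exists_le_norm_mellin_osc hs h0 hcont hpos) (hτ.mellin_theta_le hpar hb hv hφp)
  have hs1 : c < s.re := (le_max_left _ _).trans_lt hs'
  have hs2 : 0 < s.re := (le_max_right _ _).trans_lt hs'
  rw [hb.mellin_theta _ hs2 (hc s hs1), hφ, mellin_parFourier_fourier δ (osc_tsupport hs _),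
    oscS_coe, mul_comm]

/-- Testing on the bump itself brings in `G δ s` and the Mellin transform at `1 - s`. Since `Im (1 -
s) = -Im s`, the cancelling parameter is now `+t`. -/
lemma IsFourierSeries.extends_G_mul_lseries
    (hpar : ∀ n : ℕ, 1 ≤ n → a (-(n : ℤ)) = (-1) ^ δ.val * a n)
    (hb : PolySeq (coef ν a)) (hτ : IsFourierSeries ν a τ) (hv : VanishesToInfiniteOrder τ) :
    ExtendsToEntireOfModerateGrowth fun s => G δ s * LSeries (coef ν a) s := by
  obtain ⟨c, hc⟩ := PolySeq.exists_lseriesSummable (b := coef ν a)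
    (by obtain ⟨-, C, -, N, h⟩ := hb; exact ⟨C, N, h⟩)
  obtain ⟨β, hβ, hs, h0, hcont, hpos⟩ := exists_bump
  refine extends_of_family (c := max c 0)
    (M := fun t s => mellin (osc (fun x => (β x : ℂ)) t) (1 - s))
    (Λ := fun t => mellin (theta (coef ν a) (parFourier δ (oscS hβ hs t))))
    (fun t => (differentiable_mellin_osc hβ hs _).comp (differentiable_id.const_sub 1))
    (fun t => hτ.differentiable_mellin_theta hpar hb hv _) (fun t s hs' => ?_)
    (fun R => ?_) (hτ.mellin_theta_le hpar hb hv (polyFamily_oscS hβ hs))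
  · have hs1 : c < s.re := (le_max_left _ _).trans_lt hs'
    have hs2 : 0 < s.re := (le_max_right _ _).trans_lt hs'
    rw [hb.mellin_theta _ hs2 (hc s hs1), mellin_parFourier δ _ hs2
      (integrable_mul_rpow_of_tsupport (osc_tsupport hs _) _),
      oscS_coe, mellin_parPart_of_tsupport δ (osc_tsupport hs _)]
    ring
  -- `R + 1`, because `|Re (1 - s)| ≤ R + 1` when `|Re s| ≤ R`.
  · obtain ⟨m, hm, h⟩ := exists_le_norm_mellin_osc hs h0 hcont hpos (R + 1)
    refine ⟨m, hm, fun s hs' => ?_⟩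
    have h1 := h (1 - s) (by
      rw [Complex.sub_re, Complex.one_re]
      have := abs_le.1 hs'
      exact abs_le.2 ⟨by linarith, by linarith⟩)
    simpa using h1

/-! ### Decay of Mellin transforms on vertical lines -/

lemma mellin_derivCLM (g : 𝓢(ℝ, ℂ)) {s : ℂ} (hs : 0 < s.re) :
    mellin (SchwartzMap.derivCLM ℂ ℂ g) (s + 1) = -s * mellin g s := by
  have hs0 : s ≠ 0 := fun h => by simp [h] at hs
  have hg := mellinConvergent_schwartz g hs
  have hg' := mellinConvergent_schwartz (SchwartzMap.derivCLM ℂ ℂ g) (s := s + 1)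
    (by rw [Complex.add_re, Complex.one_re]; linarith)
  rw [MellinConvergent, add_sub_cancel_right] at hg'
  have h1 := integral_Ioi_of_hasDerivAt_of_tendsto (a := 0) (m := 0)
    (f := fun x : ℝ => (x : ℂ) ^ s * g x)
    (f' := fun x : ℝ => s * ((x : ℂ) ^ (s - 1) • g x) +
      (x : ℂ) ^ s • SchwartzMap.derivCLM ℂ ℂ g x)
    (((Complex.continuousAt_ofReal_cpow_const 0 s (Or.inl hs)).mul
      g.continuous.continuousAt).continuousWithinAt)
    (fun x hx => by
      have hx : 0 < x := hx
      have h3 := hasDerivAt_ofReal_cpow_const hx.ne' hs0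
      have h5 := h3.mul (g.hasDerivAt x)
      rw [SchwartzMap.derivCLM_apply, smul_eq_mul, smul_eq_mul, ← mul_assoc]
      exact h5)
    ((hg.const_mul s).add hg') (by
      have h2 : (fun x : ℝ => (x : ℂ) ^ s * g x) =O[atTop] fun x : ℝ => x ^ (-(1 : ℝ)) := by
        have h3 : (fun x : ℝ => (x : ℂ) ^ s) =O[atTop] fun x : ℝ => x ^ s.re := by
          refine IsBigO.of_bound 1 ?_
          filter_upwards [eventually_gt_atTop 0] with x hx
          rw [Complex.norm_cpow_eq_rpow_re_of_pos hx, one_mul]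
          exact le_abs_self _
        refine (h3.mul (isBigO_atTop_rpow g (s.re + 1))).congr' EventuallyEq.rfl ?_
        filter_upwards [eventually_gt_atTop 0] with x hx
        rw [← Real.rpow_add hx]; congr 1; ring
      exact h2.trans_tendsto (tendsto_rpow_neg_atTop one_pos))
  rw [integral_add (hg.const_mul s) hg', integral_const_mul] at h1
  simp only [Complex.ofReal_zero, Complex.zero_cpow hs0, zero_mul, sub_zero] at h1
  rw [mellin, add_sub_cancel_right, mellin]
  linear_combination h1

lemma exists_mellin_le (g : 𝓢(ℝ, ℂ)) {α β : ℝ} (hα : 0 < α) (hβ : 0 < β) :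
    ∃ C : ℝ, ∀ s : ℂ, α ≤ s.re → s.re ≤ β → ‖mellin g s‖ ≤ C := by
  have h1 := (mellinConvergent_schwartz g (s := α) (by simpa using hα)).norm
  have h2 := (mellinConvergent_schwartz g (s := β) (by simpa using hβ)).norm
  refine ⟨_, fun s hs1 hs2 => norm_integral_le_of_norm_le (h1.add h2)
    ((ae_restrict_iff' measurableSet_Ioi).2 (Eventually.of_forall fun x hx => ?_))⟩
  have hx : 0 < x := hx
  simp only [Pi.add_apply, norm_smul]
  rw [Complex.norm_cpow_eq_rpow_re_of_pos hx, Complex.norm_cpow_eq_rpow_re_of_pos hx,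
    Complex.norm_cpow_eq_rpow_re_of_pos hx, ← add_mul]
  refine mul_le_mul_of_nonneg_right ?_ (norm_nonneg _)
  simp only [Complex.sub_re, Complex.ofReal_re, Complex.one_re]
  have e1 : 0 ≤ x ^ (α - 1) := by positivity
  have e2 : 0 ≤ x ^ (β - 1) := by positivity
  rcases le_total 1 x with h | h
  · have := Real.rpow_le_rpow_of_exponent_le h (show s.re - 1 ≤ β - 1 by linarith)
    linarith
  · have := Real.rpow_le_rpow_of_exponent_ge hx h (show α - 1 ≤ s.re - 1 by linarith)
    linarith

/-- Integration by parts (`mellin_derivCLM`) gains a factor `|s|` and moves the strip right by `1`.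
The constant `1 + α⁻¹` comes from `1 + |Im s| ≤ (1 + α⁻¹)|s|` for `Re s ≥ α`. -/
lemma exists_mellin_decay (m : ℕ) (g : 𝓢(ℝ, ℂ)) {α β : ℝ} (hα : 0 < α) (hβ : 0 < β) :
    ∃ C : ℝ, 0 ≤ C ∧ ∀ s : ℂ, α ≤ s.re → s.re ≤ β → ‖mellin g s‖ * (1 + |s.im|) ^ m ≤ C := by
  induction m generalizing g α β with
  | zero =>
    obtain ⟨C, hC⟩ := exists_mellin_le g hα hβ
    refine ⟨|C|, abs_nonneg _, fun s h1 h2 => ?_⟩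
    rw [pow_zero, mul_one]
    exact (hC s h1 h2).trans (le_abs_self C)
  | succ m ih =>
    obtain ⟨C, hC, h⟩ := ih (SchwartzMap.derivCLM ℂ ℂ g) (α := α + 1) (β := β + 1)
      (by linarith) (by linarith)
    refine ⟨(1 + α⁻¹) * C, by positivity, fun s h1 h2 => ?_⟩
    have h3 := h (s + 1) (by simpa using h1) (by simpa using h2)
    rw [mellin_derivCLM g (by linarith), norm_mul, norm_neg, Complex.add_im, Complex.one_im,
      add_zero] at h3
    have h4 : α ≤ ‖s‖ := h1.trans ((le_abs_self _).trans (Complex.abs_re_le_norm s))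
    have h5 : 1 + |s.im| ≤ (1 + α⁻¹) * ‖s‖ := by
      have e1 : 1 ≤ α⁻¹ * ‖s‖ := by
        rw [inv_mul_eq_div, one_le_div hα]; exact h4
      have e2 := Complex.abs_im_le_norm s
      linarith
    calc ‖mellin g s‖ * (1 + |s.im|) ^ (m + 1)
        = (1 + |s.im|) * (‖mellin g s‖ * (1 + |s.im|) ^ m) := by ring
      _ ≤ ((1 + α⁻¹) * ‖s‖) * (‖mellin g s‖ * (1 + |s.im|) ^ m) := by gcongr
      _ = (1 + α⁻¹) * (‖s‖ * ‖mellin g s‖ * (1 + |s.im|) ^ m) := by ring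
      _ ≤ _ := by gcongr

/-! ### Shifting a vertical line of integration -/

lemma inv_one_add_abs_sq_le (t : ℝ) : ((1 + |t|) ^ 2)⁻¹ ≤ (1 + t ^ 2)⁻¹ := by
  refine inv_anti₀ (by positivity) ?_
  nlinarith [abs_nonneg t, sq_abs t]

lemma integrable_of_norm_le_inv_sq {f : ℝ → ℂ} (hf : Continuous f) {C : ℝ}
    (h : ∀ t, ‖f t‖ ≤ C * ((1 + |t|) ^ 2)⁻¹) : Integrable f := by
  have hC : 0 ≤ C := by simpa using (norm_nonneg _).trans (h 0)
  refine (integrable_inv_one_add_sq.const_mul C).mono' hf.aestronglyMeasurable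
    (Eventually.of_forall fun t => (h t).trans ?_)
  exact mul_le_mul_of_nonneg_left (inv_one_add_abs_sq_le t) hC

/-- The vertical line `Re s = σ`, as a function of the imaginary part. -/
def vline (σ t : ℝ) : ℂ := σ + t * Complex.I

@[simp] lemma vline_re (σ t : ℝ) : (vline σ t).re = σ := by simp [vline]

@[simp] lemma vline_im (σ t : ℝ) : (vline σ t).im = t := by simp [vline]

lemma continuous_vline (σ : ℝ) : Continuous (vline σ) := by unfold vline; fun_prop

lemma continuous_comp_vline {f : ℂ → ℂ} {σ : ℝ} (hd : ∀ s : ℂ, s.re = σ → DifferentiableAt ℂ f s) :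
    Continuous fun t => f (vline σ t) :=
  continuous_iff_continuousAt.2 fun t =>
    ContinuousAt.comp (hd (vline σ t) (by simp)).continuousAt (continuous_vline σ).continuousAt

/-- Cauchy's theorem on the rectangle of height `2T`; the horizontal sides are `O(T^{-2})`. -/
lemma integral_vline_eq {f : ℂ → ℂ} {α β : ℝ} (hαβ : α ≤ β)
    (hd : ∀ s : ℂ, α ≤ s.re → s.re ≤ β → DifferentiableAt ℂ f s) {C : ℝ}
    (hC : ∀ s : ℂ, α ≤ s.re → s.re ≤ β → ‖f s‖ ≤ C * ((1 + |s.im|) ^ 2)⁻¹) :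
    ∫ t, f (vline α t) = ∫ t, f (vline β t) := by
  have hint : ∀ σ, α ≤ σ → σ ≤ β → Integrable fun t => f (vline σ t) := fun σ h1 h2 =>
    integrable_of_norm_le_inv_sq (continuous_comp_vline fun s hs => hd s (by linarith) (by linarith))
      (C := C) fun t => by simpa using hC (vline σ t) (by simpa using h1) (by simpa using h2)
  have hC0 : 0 ≤ C := by
    simpa using (norm_nonneg _).trans (hC α (by simp) (by simpa using hαβ))
  have hlim : ∀ σ, α ≤ σ → σ ≤ β → Tendsto (fun T : ℝ => ∫ t in (-T)..T, f (vline σ t)) atTop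
      (𝓝 (∫ t, f (vline σ t))) := fun σ h1 h2 =>
    intervalIntegral_tendsto_integral (hint σ h1 h2) tendsto_neg_atTop_atBot tendsto_id
  have hhor : ∀ ι : ℝ → ℝ, (∀ T, |ι T| = |T|) →
      Tendsto (fun T : ℝ => ∫ x in α..β, f (x + ι T * Complex.I)) atTop (𝓝 0) := by
    intro ι hι
    have h0 : Tendsto (fun T : ℝ => C * (T ^ 2)⁻¹ * |β - α|) atTop (𝓝 0) := by
      have h := (tendsto_pow_atTop (α := ℝ) two_ne_zero).inv_tendsto_atTop
      simpa using (h.const_mul C).mul_const |β - α|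
    refine squeeze_zero_norm' ?_ h0
    filter_upwards [eventually_gt_atTop 0] with T hT
    refine intervalIntegral.norm_integral_le_of_norm_le_const fun x hx => ?_
    rw [uIoc_of_le hαβ] at hx
    have h1 := hC (x + ι T * Complex.I) (by simpa using hx.1.le) (by simpa using hx.2)
    have h2 : (x + ι T * Complex.I : ℂ).im = ι T := by simp
    rw [h2, hι, abs_of_pos hT] at h1
    refine h1.trans ?_
    gcongr
    linarith
  have hrect : ∀ T : ℝ, (∫ x in α..β, f (x + (-T : ℝ) * Complex.I)) -
      (∫ x in α..β, f (x + T * Complex.I)) + Complex.I • (∫ t in (-T)..T, f (vline β t)) -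
      Complex.I • (∫ t in (-T)..T, f (vline α t)) = 0 := by
    intro T
    have h := Complex.integral_boundary_rect_eq_zero_of_differentiableOn f
      (vline α (-T)) (vline β T) (fun s hs => by
        have hs' : s.re ∈ uIcc α β := by simpa using hs.1
        rw [uIcc_of_le hαβ] at hs'
        exact (hd s hs'.1 hs'.2).differentiableWithinAt)
    simp only [vline_re, vline_im] at h
    exact h
  have hsum := (((hhor (fun T => -T) (fun T => abs_neg T)).sub (hhor (fun T => T) fun T => rfl)).add
    ((hlim β hαβ le_rfl).const_smul Complex.I)).sub ((hlim α le_rfl hαβ).const_smul Complex.I)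
  simp only [hrect] at hsum
  have h := tendsto_nhds_unique hsum tendsto_const_nhds
  rw [sub_zero, zero_add, ← smul_sub, smul_eq_mul, mul_eq_zero] at h
  exact (sub_eq_zero.1 (h.resolve_left Complex.I_ne_zero)).symm

/-! ### The operators `u ↦ (d/dx)^i (x^i u)` on Schwartz functions -/

/-- Multiplication by the coordinate. -/
def mulX : 𝓢(ℝ, ℂ) →L[ℂ] 𝓢(ℝ, ℂ) := SchwartzMap.smulLeftCLM ℂ fun x : ℝ => (x : ℂ)

lemma mulX_apply (φ : 𝓢(ℝ, ℂ)) (x : ℝ) : mulX φ x = x * φ x := by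
  have h : Function.HasTemperateGrowth fun x : ℝ => (x : ℂ) :=
    Complex.ofRealCLM.hasTemperateGrowth
  rw [mulX, SchwartzMap.smulLeftCLM_apply_apply h, smul_eq_mul]

lemma mulX_iterate_apply (n : ℕ) (φ : 𝓢(ℝ, ℂ)) (x : ℝ) :
    (mulX^[n] φ) x = (x : ℂ) ^ n * φ x := by
  induction n generalizing φ with
  | zero => simp
  | succ n ih => rw [Function.iterate_succ_apply, ih, mulX_apply, pow_succ]; ring

/-- Differentiation. -/
def dX : 𝓢(ℝ, ℂ) →L[ℂ] 𝓢(ℝ, ℂ) := SchwartzMap.derivCLM ℂ ℂ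

lemma dX_iterate_coe (n : ℕ) (φ : 𝓢(ℝ, ℂ)) : ((dX^[n] φ : 𝓢(ℝ, ℂ)) : ℝ → ℂ) =
    iteratedDeriv n φ := by
  induction n with
  | zero => simp
  | succ n ih =>
    rw [Function.iterate_succ_apply', iteratedDeriv_succ, ← ih]
    funext x
    exact SchwartzMap.derivCLM_apply ℂ _ x

lemma dX_mulX (φ : 𝓢(ℝ, ℂ)) : dX (mulX φ) = φ + mulX (dX φ) := by
  ext x
  have h1 : ((mulX φ : 𝓢(ℝ, ℂ)) : ℝ → ℂ) = fun x : ℝ => (x : ℂ) * φ x := funext (mulX_apply φ)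
  have h2 := ((Complex.ofRealCLM.hasDerivAt (x := x)).mul (φ.hasDerivAt x)).deriv
  have h3 : deriv (fun x : ℝ => (x : ℂ) * φ x) x = _ := h2
  have h4 : dX (mulX φ) x = deriv (mulX φ) x := SchwartzMap.derivCLM_apply ℂ _ x
  have h5 : dX φ x = deriv φ x := SchwartzMap.derivCLM_apply ℂ _ x
  rw [h4, h1, h3, add_apply, mulX_apply, h5]
  simp

lemma dX_iterate_mulX (i : ℕ) (φ : 𝓢(ℝ, ℂ)) :
    dX^[i + 1] (mulX φ) = dX (mulX (dX^[i] φ)) + (i : ℂ) • dX^[i] φ := by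
  induction i with
  | zero => simp
  | succ i ih =>
    rw [Function.iterate_succ_apply', ih, map_add, map_smul, ← Function.iterate_succ_apply' dX,
      dX_mulX (dX^[i] φ), map_add, ← Function.iterate_succ_apply' dX]
    push_cast
    rw [add_smul, one_smul]
    abel

/-- The function `(d/dx)^i (x^i u)`. -/
def euler (i : ℕ) (u : 𝓢(ℝ, ℂ)) : 𝓢(ℝ, ℂ) := dX^[i] (mulX^[i] u)

lemma euler_coe (i : ℕ) (u : 𝓢(ℝ, ℂ)) :
    (euler i u : ℝ → ℂ) = iteratedDeriv i fun x : ℝ => (x : ℂ) ^ i * u x := by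
  rw [euler, dX_iterate_coe, funext (mulX_iterate_apply i u)]

lemma euler_succ (i : ℕ) (u : 𝓢(ℝ, ℂ)) :
    euler (i + 1) u = dX (mulX (euler i u)) + (i : ℂ) • euler i u := by
  rw [euler, Function.iterate_succ_apply' mulX, dX_iterate_mulX, euler]

lemma mellin_mulX (g : 𝓢(ℝ, ℂ)) (s : ℂ) : mellin (mulX g) s = mellin g (s + 1) := by
  have h := mellin_cpow_smul g s 1
  rw [← h]
  congr 1
  funext x
  rw [mulX_apply, Complex.cpow_one, smul_eq_mul]

lemma mellin_mulX_iterate (k : ℕ) (g : 𝓢(ℝ, ℂ)) (s : ℂ) :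
    mellin (mulX^[k] g) s = mellin g (s + k) := by
  induction k generalizing s with
  | zero => simp
  | succ k ih =>
    rw [Function.iterate_succ_apply', mellin_mulX, ih]
    congr 1
    push_cast; ring

/-- The Mellin multiplier of `euler m`. -/
def eulerPoly (m : ℕ) (z : ℂ) : ℂ := ∏ i ∈ Finset.range m, ((i : ℂ) + 1 - z)

/-- By `euler_succ`, passing from `m` to `m + 1` applies `(d/dx) x + m`, which multiplies the Mellin
transform by `m + 1 - z`. The condition `Re z > 1` is convergence at `z - 1`. -/
lemma mellin_euler (m : ℕ) (u : 𝓢(ℝ, ℂ)) {z : ℂ} (hz : 1 < z.re) :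
    mellin (euler m u) z = eulerPoly m z * mellin u z := by
  induction m with
  | zero => simp [euler, eulerPoly]
  | succ m ih =>
    have h0 : 0 < z.re := by linarith
    have h1 := mellin_derivCLM (mulX (euler m u)) (s := z - 1)
      (by rw [Complex.sub_re, Complex.one_re]; linarith)
    rw [sub_add_cancel, mellin_mulX, sub_add_cancel] at h1
    have h2 : mellin (euler (m + 1) u) z = mellin (dX (mulX (euler m u))) z +
        (m : ℂ) • mellin (euler m u) z := by
      rw [← mellin_const_smul, ← (hasMellin_add (mellinConvergent_schwartz _ h0)
        ((mellinConvergent_schwartz _ h0).const_smul (m : ℂ))).2, euler_succ]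
      rfl
    rw [h2, dX, h1, ih, eulerPoly, eulerPoly, Finset.prod_range_succ, smul_eq_mul]
    ring

/-- The zeros are positive integers, at distance at least `1/2` from the line `Re z = 3/2`. Each
factor is thus at least `1/2` and at least `|t|` in modulus, hence at least `(1 + |t|)/3`. -/
lemma le_norm_eulerPoly (m : ℕ) (t : ℝ) :
    ((1 + |t|) / 3) ^ m ≤ ‖eulerPoly m (vline (3 / 2) (-t))‖ := by
  rw [eulerPoly, norm_prod, ← Finset.card_range m, ← Finset.prod_const, Finset.card_range]
  refine Finset.prod_le_prod (fun _ _ => by positivity) fun i _ => ?_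
  set z : ℂ := (i : ℂ) + 1 - vline (3 / 2) (-t) with hz
  have hre : z.re = i - 1 / 2 := by rw [hz]; simp; ring
  have him : z.im = t := by rw [hz]; simp
  have h1 := Complex.abs_re_le_norm z
  have h2 := Complex.abs_im_le_norm z
  rw [him] at h2
  have h3 : 1 / 2 ≤ |z.re| := by
    rw [hre]
    rcases Nat.eq_zero_or_pos i with rfl | hi
    · norm_num
    · have : (1 : ℝ) ≤ i := by exact_mod_cast hi
      exact le_trans (by linarith) (le_abs_self _)
  linarith

lemma continuous_eulerPoly (m : ℕ) : Continuous (eulerPoly m) := by unfold eulerPoly; fun_prop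

/-- `parPart` as a Schwartz function. -/
def parPartS (δ : ZMod 2) (φ : 𝓢(ℝ, ℂ)) : 𝓢(ℝ, ℂ) := φ + sgn δ • dil (-1) φ

lemma parPartS_coe (δ : ZMod 2) (φ : 𝓢(ℝ, ℂ)) : (parPartS δ φ : ℝ → ℂ) = parPart δ φ := by
  funext x
  simp [parPartS, parPart, dil_apply (show (-1 : ℝ) ≠ 0 by norm_num)]

/-- The operator `(d/dx)^m x^m` commutes with `x ↦ -x`, while `x^k` contributes the sign `(-1)^k`.
-/
lemma euler_mulX_parPartS (m k : ℕ) (δ : ZMod 2) (φ : 𝓢(ℝ, ℂ)) (x : ℝ) :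
    euler m (mulX^[k] (parPartS δ φ)) x = euler m (mulX^[k] φ) x +
      sgn δ * (-1) ^ k * euler m (mulX^[k] φ) (-x) := by
  set F : ℝ → ℂ := fun x : ℝ => (x : ℂ) ^ m * (mulX^[k] φ) x with hF
  have hFs : ContDiff ℝ ∞ F := (contDiff_ofReal_pow m).mul (SchwartzMap.smooth _ ⊤)
  have hFn : ContDiffAt ℝ m F x := hFs.contDiffAt.of_le (by exact_mod_cast le_top)
  have hFn' : ContDiffAt ℝ m (fun x => F (-x)) x :=
    (hFs.comp contDiff_neg).contDiffAt.of_le (by exact_mod_cast le_top)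
  have h1 : (fun x : ℝ => (x : ℂ) ^ m * (mulX^[k] (parPartS δ φ)) x) =
      F + fun x => (sgn δ * (-1) ^ (m + k)) * F (-x) := by
    funext x
    simp only [hF, mulX_iterate_apply, parPartS_coe, parPart, Pi.add_apply, Complex.ofReal_neg]
    have e1 : ((-1 : ℂ) ^ (m + k)) * ((-x : ℂ) ^ m * (-x) ^ k) = x ^ m * x ^ k := by
      rw [← pow_add, ← mul_pow, neg_one_mul, neg_neg, pow_add]
    linear_combination (-sgn δ * φ (-x)) * e1
  have h2 : iteratedDeriv m (F + fun x => (sgn δ * (-1) ^ (m + k)) * F (-x)) x =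
      iteratedDeriv m F x + (sgn δ * (-1) ^ (m + k)) * ((-1 : ℝ) ^ m • iteratedDeriv m F (-x)) := by
    rw [iteratedDeriv_add hFn (contDiffAt_const.mul hFn'), iteratedDeriv_const_mul_field,
      iteratedDeriv_comp_neg]
  rw [euler_coe, euler_coe, h1, h2, Complex.real_smul]
  push_cast
  have e2 : ((-1 : ℂ) ^ (m + k)) * (-1) ^ m = (-1) ^ k := by
    rw [pow_add, mul_right_comm, ← mul_pow]; simp
  linear_combination (sgn δ * iteratedDeriv m F (-x)) * e2

/-! ### Representing the distribution by a Mellin–Barnes integral -/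

lemma exists_mellin_mul_le {H : ℂ → ℂ} (hH : StripBounded H) (g : 𝓢(ℝ, ℂ)) (R : ℝ) {α β : ℝ}
    (hα : 0 < α) (hβ : 0 < β) : ∃ C : ℝ, ∀ s z : ℂ, |s.re| ≤ R → α ≤ z.re → z.re ≤ β →
      |z.im| = |s.im| → ‖mellin g z * H s‖ ≤ C * ((1 + |s.im|) ^ 2)⁻¹ := by
  obtain ⟨C1, hC1, N, h1⟩ := hH R
  obtain ⟨C2, hC2, h2⟩ := exists_mellin_decay (N + 2) g hα hβ
  refine ⟨C2 * C1, fun s z hs hz1 hz2 him => ?_⟩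
  have h3 := h2 z hz1 hz2
  rw [him] at h3
  have hpos : 0 < 1 + |s.im| := by positivity
  rw [← div_eq_mul_inv, le_div_iff₀ (by positivity), norm_mul]
  calc _ ≤ ‖mellin g z‖ * (C1 * (1 + |s.im|) ^ N) * (1 + |s.im|) ^ 2 := by
        gcongr; exact h1 s hs
    _ = ‖mellin g z‖ * (1 + |s.im|) ^ (N + 2) * C1 := by rw [pow_add]; ring
    _ ≤ _ := by gcongr

lemma verticalIntegrable_mellin (g : 𝓢(ℝ, ℂ)) {σ : ℝ} (hσ : 0 < σ) :
    Integrable fun t => mellin g (vline σ t) := by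
  obtain ⟨C, -, h⟩ := exists_mellin_decay 2 g hσ hσ
  refine integrable_of_norm_le_inv_sq (C := C) (continuous_comp_vline fun s hs =>
    mellin_schwartz_differentiableAt g (by linarith)) fun t => ?_
  have h1 := h (vline σ t) (by simp) (by simp)
  rw [vline_im] at h1
  rwa [← div_eq_mul_inv, le_div_iff₀ (by positivity)]

/-- Mellin inversion is applied to each `g(n)`. The modulus of `n^{-s}` is constant along the line,
so absolute convergence of the Dirichlet series there justifies the exchange. -/
lemma hasSum_eq_integral {b : ℕ → ℂ} (hb : PolySeq b) (g : 𝓢(ℝ, ℂ)) {σ : ℝ} (hσ : 0 < σ)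
    (hL : LSeriesSummable b σ) :
    HasSum (fun n : ℕ => b n * g n)
      ((2 * Real.pi : ℂ)⁻¹ * ∫ t, mellin g (vline σ t) * LSeries b (vline σ t)) := by
  have hint := verticalIntegrable_mellin g hσ
  have hterm : ∀ n : ℕ, ∫ t, LSeries.term b (vline σ t) n * mellin g (vline σ t) =
      2 * Real.pi * (b n * g n) := by
    intro n
    rcases Nat.eq_zero_or_pos n with rfl | hn
    · simp [hb.1]
    have hn0 : (0 : ℝ) < n := by exact_mod_cast hn
    have h1 := mellinInv_mellin_eq σ g hn0 (mellinConvergent_schwartz g (by simpa using hσ))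
      hint g.continuous.continuousAt
    rw [mellinInv, Complex.real_smul] at h1
    have hpi : (Real.pi : ℂ) ≠ 0 := by exact_mod_cast Real.pi_ne_zero
    have h2 : (2 * Real.pi : ℂ) * (b n * g n) = b n *
        ∫ y : ℝ, ((n : ℝ) : ℂ) ^ (-((σ : ℂ) + y * Complex.I)) •
          mellin g ((σ : ℂ) + y * Complex.I) := by
      rw [← h1, one_div]
      push_cast
      rw [mul_inv]
      generalize ∫ y : ℝ, ((n : ℂ)) ^ (-((σ : ℂ) + y * Complex.I)) •
          mellin g ((σ : ℂ) + y * Complex.I) = J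
      field_simp
    rw [h2, ← integral_const_mul]
    refine integral_congr_ae (Eventually.of_forall fun t => ?_)
    simp only [smul_eq_mul]
    rw [LSeries.term_of_ne_zero (by omega), vline, Complex.cpow_neg, div_eq_mul_inv, mul_assoc,
      Complex.ofReal_natCast]
  have hnt : ∀ (n : ℕ) (t : ℝ), ‖LSeries.term b (vline σ t) n‖ = ‖LSeries.term b σ n‖ := by
    intro n t
    rw [LSeries.norm_term_eq, LSeries.norm_term_eq, vline_re, Complex.ofReal_re]
  have h3 := hasSum_integral_of_summable_integral_norm
    (F := fun (n : ℕ) (t : ℝ) => LSeries.term b (vline σ t) n * mellin g (vline σ t))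
    (fun n => by
      refine hint.bdd_mul (c := ‖LSeries.term b σ n‖) ?_
        (Eventually.of_forall fun t => (hnt n t).le)
      rcases Nat.eq_zero_or_pos n with rfl | hn
      · simpa using aestronglyMeasurable_const
      have : Continuous fun t => LSeries.term b (vline σ t) n := by
        have hnc : (n : ℂ) ≠ 0 := by exact_mod_cast hn.ne'
        have h4 : ∀ t, LSeries.term b (vline σ t) n = b n / (n : ℂ) ^ (vline σ t) := fun t =>
          LSeries.term_of_ne_zero (by omega) _ _
        simp only [h4]
        refine continuous_const.div ((continuous_vline σ).const_cpow (Or.inl hnc)) fun t => ?_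
        rw [Ne, Complex.cpow_eq_zero_iff, not_and_or]
        exact Or.inl hnc
      exact this.aestronglyMeasurable) (by
      simp only [norm_mul, hnt, integral_const_mul]
      exact hL.norm.mul_right _)
  simp only [hterm, tsum_mul_right] at h3
  have hpi : (2 * Real.pi : ℂ) ≠ 0 := by exact_mod_cast Real.two_pi_pos.ne'
  have h5 := h3.mul_left (2 * Real.pi : ℂ)⁻¹
  simp only [inv_mul_cancel_left₀ hpi] at h5
  have h6 : ∫ t, mellin g (vline σ t) * LSeries b (vline σ t) =
      ∫ t, (∑' n, LSeries.term b (vline σ t) n) * mellin g (vline σ t) :=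
    integral_congr_ae (Eventually.of_forall fun t => mul_comm _ _)
  rw [h6]
  exact h5

lemma differentiableAt_G (δ : ZMod 2) {s : ℂ} (hs : 0 < s.re) : DifferentiableAt ℂ (G δ) s := by
  have hpi : (2 * Real.pi : ℂ) ≠ 0 := by exact_mod_cast Real.two_pi_pos.ne'
  have h1 : DifferentiableAt ℂ Complex.Gamma s := by
    refine Complex.differentiableAt_Gamma s fun m h => ?_
    rw [h] at hs
    simp at hs
    have : (0 : ℝ) ≤ m := by positivity
    linarith
  have h2 : DifferentiableAt ℂ (fun s : ℂ => (2 * Real.pi : ℂ) ^ (-s)) s :=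
    differentiableAt_id.neg.const_cpow (Or.inl hpi)
  have h3 : DifferentiableAt ℂ (fun s : ℂ => Complex.cos (Real.pi * (s - δ.val) / 2)) s := by
    fun_prop
  exact (((differentiableAt_const _).mul h2).mul h1).mul h3

lemma G_mul_eq {δ : ZMod 2} {b : ℕ → ℂ} {H1 H2 : ℂ → ℂ} (h1 : Differentiable ℂ H1)
    (h2 : Differentiable ℂ H2) {c : ℝ} (hc1 : ∀ s : ℂ, c < s.re → H1 s = LSeries b s)
    (hc2 : ∀ s : ℂ, c < s.re → H2 s = G δ s * LSeries b s) {s : ℂ} (hs : 0 < s.re) :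
    G δ s * H1 s = H2 s := by
  have hU : IsOpen {s : ℂ | 0 < s.re} := isOpen_lt continuous_const Complex.continuous_re
  have hA : AnalyticOnNhd ℂ (fun s => G δ s * H1 s) {s : ℂ | 0 < s.re} :=
    DifferentiableOn.analyticOnNhd (fun z hz =>
      ((differentiableAt_G δ hz).mul (h1 z)).differentiableWithinAt) hU
  have hB : AnalyticOnNhd ℂ H2 {s : ℂ | 0 < s.re} := fun z _ => h2.analyticAt z
  refine hA.eqOn_of_preconnected_of_eventuallyEq hB (convex_halfSpace_re_gt 0).isPreconnected
    (z₀ := ((max c 0 + 1 : ℝ) : ℂ)) ?_ ?_ hs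
  · change 0 < (((max c 0 + 1 : ℝ) : ℂ)).re
    rw [Complex.ofReal_re]
    linarith [le_max_right c 0]
  · filter_upwards [(isOpen_lt continuous_const Complex.continuous_re).mem_nhds
      (show c < (((max c 0 + 1 : ℝ) : ℂ)).re by
        rw [Complex.ofReal_re]; linarith [le_max_left c 0])] with z hz
    rw [hc1 z hz, hc2 z hz]

lemma integrable_schwartz_mul_rpow (φ : 𝓢(ℝ, ℂ)) {r : ℝ} (hr : r < 1) :
    Integrable fun x => ‖φ x‖ * |x| ^ (-r) := by
  have key : ∀ ψ : 𝓢(ℝ, ℂ), IntegrableOn (fun x => ‖ψ x‖ * |x| ^ (-r)) (Ioi 0) := fun ψ => by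
    have h := (mellinConvergent_schwartz ψ (s := ((1 - r : ℝ) : ℂ))
      (by rw [Complex.ofReal_re]; linarith)).norm
    refine IntegrableOn.congr_fun h (fun x hx => ?_) measurableSet_Ioi
    have hx : 0 < x := hx
    have he : (((1 - r : ℝ) : ℂ) - 1).re = -r := by
      rw [Complex.sub_re, Complex.ofReal_re, Complex.one_re]; ring
    rw [norm_smul, Complex.norm_cpow_eq_rpow_re_of_pos hx, he, abs_of_pos hx, mul_comm]
  rw [← integrableOn_univ, ← Iic_union_Ioi (a := (0 : ℝ))]
  refine IntegrableOn.union ?_ (key φ)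
  have h1 := key (dil (-1) φ)
  have h2 : (fun x => ‖dil (-1) φ x‖ * |x| ^ (-r)) = fun x => ‖φ (-x)‖ * |-x| ^ (-r) := by
    funext x
    rw [dil_apply (by norm_num), neg_one_mul, abs_neg]
  rw [h2] at h1
  refine (MeasurePreserving.integrableOn_comp_preimage (Measure.measurePreserving_neg volume)
    (MeasurableEquiv.neg ℝ).measurableEmbedding).1 ?_
  have h3 : Neg.neg ⁻¹' Iic (0 : ℝ) = Ici 0 := by ext x; simp
  rw [h3, integrableOn_Ici_iff_integrableOn_Ioi]
  exact h1

/-- The Mellin–Barnes representation of the distribution, on a line far to the left. -/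
lemma IsFourierSeries.eq_integral
    (hpar : ∀ n : ℕ, 1 ≤ n → a (-(n : ℤ)) = (-1) ^ δ.val * a n)
    (hb : PolySeq (coef ν a)) (hτ : IsFourierSeries ν a τ) {H1 H2 : ℂ → ℂ}
    (h1 : Differentiable ℂ H1) (h2 : Differentiable ℂ H2) (hs1 : StripBounded H1)
    (hs2 : StripBounded H2) {c : ℝ} (hc1 : ∀ s : ℂ, c < s.re → H1 s = LSeries (coef ν a) s)
    (hc2 : ∀ s : ℂ, c < s.re → H2 s = G δ s * LSeries (coef ν a) s) {ρ : ℝ} (hρ : ρ ≤ 1 / 2)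
    (φ : 𝓢(ℝ, ℂ)) :
    τ φ = (2 * Real.pi : ℂ)⁻¹ *
      ∫ t, mellin (parPartS δ φ) (1 - vline ρ t) * H2 (vline ρ t) := by
  obtain ⟨c', hc'⟩ := PolySeq.exists_lseriesSummable (b := coef ν a)
    (by obtain ⟨-, C, -, N, h⟩ := hb; exact ⟨C, N, h⟩)
  set σ : ℝ := max (max c c') 0 + 1 with hσ
  have hσc : c < σ := by
    linarith [(le_max_left c c').trans (le_max_left (max c c') 0)]
  have hσc' : c' < σ := by
    linarith [(le_max_right c c').trans (le_max_left (max c c') 0)]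
  have hσ0 : 1 ≤ σ := by linarith [le_max_right (max c c') 0]
  have e1 := (hτ.hasSum hpar φ).unique
    (hasSum_eq_integral hb (parFourier δ φ) (σ := σ) (by linarith) (hc' σ (by simpa using hσc')))
  have e2 : ∀ t, LSeries (coef ν a) (vline σ t) = H1 (vline σ t) := fun t =>
    (hc1 _ (by simpa using hσc)).symm
  simp only [e2] at e1
  obtain ⟨C1, hC1⟩ := exists_mellin_mul_le hs1 (parFourier δ φ) σ (α := 1 / 2) (β := σ)
    (by norm_num) (by linarith)
  have e3 := integral_vline_eq (f := fun s => mellin (parFourier δ φ) s * H1 s)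
    (show 1 / 2 ≤ σ by linarith)
    (fun s hs _ => (mellin_schwartz_differentiableAt _ (by linarith)).mul (h1 s))
    (fun s hs hs' => hC1 s s (abs_le.2 ⟨by linarith, hs'⟩) hs hs' rfl)
  -- `Re s = 1/2` lies in the strip `0 < Re s < 1`, where the functional equation applies to every
  -- Schwartz `φ`.
  have e4 : ∀ t, mellin (parFourier δ φ) (vline (1 / 2) t) * H1 (vline (1 / 2) t) =
      mellin (parPartS δ φ) (1 - vline (1 / 2) t) * H2 (vline (1 / 2) t) := fun t => by
    have hre : 0 < (vline (1 / 2) t).re := by simp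
    rw [mellin_parFourier δ φ hre (by
      rw [vline_re]; exact integrable_schwartz_mul_rpow φ (by norm_num)),
      ← G_mul_eq h1 h2 hc1 hc2 hre, parPartS_coe]
    ring
  obtain ⟨C2, hC2⟩ := exists_mellin_mul_le hs2 (parPartS δ φ) (|ρ| + 1 / 2) (α := 1 / 2)
    (β := 1 - ρ) (by norm_num) (by linarith)
  have hcomp : ∀ s : ℂ, s.re ≤ 1 / 2 →
      DifferentiableAt ℂ (fun s => mellin (parPartS δ φ) (1 - s)) s := fun s hs =>
    DifferentiableAt.comp (g := mellin (parPartS δ φ)) (f := fun s : ℂ => 1 - s) s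
      (mellin_schwartz_differentiableAt _ (by rw [Complex.sub_re, Complex.one_re]; linarith))
      (differentiableAt_id.const_sub 1)
  -- To the left of `1/2` the argument `1 - s` has real part at least `1/2`, so the new integrand is
  -- holomorphic however far left the line goes.
  have e5 := integral_vline_eq (f := fun s => mellin (parPartS δ φ) (1 - s) * H2 s) hρ
    (fun s _ hs => (hcomp s hs).mul (h2 s))
    (fun s hs hs' => hC2 s (1 - s)
      (abs_le.2 ⟨by linarith [neg_abs_le ρ], by linarith [abs_nonneg ρ]⟩)
      (by rw [Complex.sub_re, Complex.one_re]; linarith)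
      (by rw [Complex.sub_re, Complex.one_re]; linarith) (by simp))
  rw [e1, ← e3, e5]
  simp only [e4]

/-! ### Order of vanishing from the Mellin–Barnes representation -/

/-- The function with Mellin–Barnes density `q`. -/
def barnes (q : ℝ → ℂ) (x : ℝ) : ℂ := ∫ t, q t * (x : ℂ) ^ vline (1 / 2) (-t)

lemma norm_ofReal_cpow_vline {x : ℝ} (hx : 0 < x) (t : ℝ) :
    ‖(x : ℂ) ^ vline (1 / 2) (-t)‖ = x ^ (1 / 2 : ℝ) := by
  rw [Complex.norm_cpow_eq_rpow_re_of_pos hx, vline_re]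

lemma norm_barnes_le (q : ℝ → ℂ) {x : ℝ} (hx : 0 < x) :
    ‖barnes q x‖ ≤ (∫ t, ‖q t‖) * x ^ (1 / 2 : ℝ) := by
  refine (norm_integral_le_integral_norm _).trans_eq ?_
  simp only [norm_mul, norm_ofReal_cpow_vline hx, integral_mul_const]

lemma measurable_barnes_kernel {q : ℝ → ℂ} (hq : Continuous q) :
    Measurable fun p : ℝ × ℝ => q p.1 * (p.2 : ℂ) ^ vline (1 / 2) (-p.1) :=
  (hq.measurable.comp measurable_fst).mul
    ((Complex.measurable_ofReal.comp measurable_snd).pow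
      ((continuous_vline _).measurable.comp measurable_fst.neg))

lemma stronglyMeasurable_barnes {q : ℝ → ℂ} (hq : Continuous q) :
    StronglyMeasurable (barnes q) :=
  (measurable_barnes_kernel hq).stronglyMeasurable.integral_prod_left'

/-- Fubini; on `Re z = 3/2` the kernel `x^{z-1}` has modulus `x^{1/2}`, which is the kernel of
`barnes`. -/
lemma integral_mul_mellin {q : ℝ → ℂ} (hq : Continuous q) (hqi : Integrable q) (u : 𝓢(ℝ, ℂ)) :
    ∫ t, q t * mellin u (vline (3 / 2) (-t)) = ∫ x in Ioi 0, barnes q x * u x := by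
  have he : ∀ t, vline (3 / 2) (-t) - 1 = vline (1 / 2) (-t) := fun t => by
    simp only [vline]; push_cast; ring
  have hu : IntegrableOn (fun x : ℝ => x ^ (1 / 2 : ℝ) * ‖u x‖) (Ioi 0) := by
    refine IntegrableOn.congr_fun (mellinConvergent_schwartz u (s := vline (3 / 2) (-0))
      (by rw [vline_re]; norm_num)).norm (fun x hx => ?_) measurableSet_Ioi
    rw [he, norm_smul, norm_ofReal_cpow_vline hx]
  have hint : Integrable (Function.uncurry fun (t x : ℝ) =>
      q t * (x : ℂ) ^ vline (1 / 2) (-t) * u x) (volume.prod (volume.restrict (Ioi 0))) := by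
    refine (hqi.norm.mul_prod hu).mono' ((measurable_barnes_kernel hq).mul
      (u.continuous.measurable.comp measurable_snd)).aestronglyMeasurable ?_
    have h1 : ∀ᵐ x ∂(volume.restrict (Ioi (0 : ℝ))), 0 < x :=
      (ae_restrict_iff' measurableSet_Ioi).2 (Eventually.of_forall fun x hx => hx)
    have h2 : ∀ᵐ p ∂((volume : Measure ℝ).prod (volume.restrict (Ioi (0 : ℝ)))), 0 < p.2 :=
      Measure.quasiMeasurePreserving_snd.ae h1
    filter_upwards [h2] with p hp
    simp only [Function.uncurry, norm_mul, norm_ofReal_cpow_vline hp]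
    rw [mul_assoc]
  have h1 := integral_integral_swap hint
  have h2 : ∀ t, q t * mellin u (vline (3 / 2) (-t)) =
      ∫ x in Ioi (0 : ℝ), q t * (x : ℂ) ^ vline (1 / 2) (-t) * u x := fun t => by
    rw [mellin, ← integral_const_mul]
    refine integral_congr_ae (Eventually.of_forall fun x => ?_)
    simp only [he, smul_eq_mul, mul_assoc]
  simp only [h2]
  rw [h1]
  refine integral_congr_ae (Eventually.of_forall fun x => ?_)
  simp only [barnes, integral_mul_const]

/-- The operator `x^m (d/dx)^m`. -/
def powDerivOp (m : ℕ) : DiffOp univ where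
  order := m
  coeff i x := if i = m then (x : ℂ) ^ m else 0
  smooth i _ := by
    split_ifs
    · exact (contDiff_ofReal_pow m).contDiffOn
    · exact contDiffOn_const

lemma powDerivOp_apply (m : ℕ) (u : ℝ → ℂ) :
    (powDerivOp m).apply u = fun x : ℝ => (x : ℂ) ^ m * iteratedDeriv m u x := by
  funext x
  rw [DiffOp.apply, Finset.sum_eq_single m]
  · simp [powDerivOp]
  · intro i _ hi
    simp [powDerivOp, hi]
  · intro h
    simp [powDerivOp] at h

lemma powDerivOp_transpose (m : ℕ) (u : ℝ → ℂ) :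
    (powDerivOp m).transpose u =
      fun x : ℝ => (-1) ^ m * iteratedDeriv m (fun y : ℝ => (y : ℂ) ^ m * u y) x := by
  funext x
  rw [DiffOp.transpose, Finset.sum_eq_single m]
  · simp [powDerivOp]
  · intro i _ hi
    simp [powDerivOp, hi]
  · intro h
    simp [powDerivOp] at h

lemma isTangential_powDerivOp (m : ℕ) : (powDerivOp m).IsTangential := by
  intro k u hu hk
  have hu' : ContDiff ℝ ∞ u := contDiffOn_univ.1 hu
  have h1 : FunVanishesToOrder (k - m) (iteratedDeriv m u) := fun i hi => by
    rw [iteratedDeriv_eq_iterate, iteratedDeriv_eq_iterate, ← Function.iterate_add_apply,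
      ← iteratedDeriv_eq_iterate]
    exact hk _ (by omega)
  have h2 := (funVanishesToOrder_ofReal_pow m).mul h1 (contDiff_ofReal_pow m).contDiffAt
    (by rw [iteratedDeriv_eq_iterate]; exact (hu'.iterate_deriv m).contDiffAt)
  rw [powDerivOp_apply]
  exact fun i hi => h2 i (by omega)

/-- One term suffices: `f = x^k` and `D = x^m (d/dx)^m`. The factor `(-1)^m` on `h` offsets the sign
in the transpose. -/
lemma vanishesToOrder_of_eq_integral {τ : 𝓢'(ℝ, ℂ)} {k m : ℕ} {h : ℝ → ℂ}
    (hm : StronglyMeasurable h) {B : ℝ} (hB : ∀ x, ‖h x‖ ≤ B * |x| ^ (1 / 2 : ℝ))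
    (hτ : ∀ φ : 𝓢(ℝ, ℂ), τ φ = ∫ x, h x * euler m (mulX^[k] φ) x) : VanishesToOrder τ k := by
  refine ⟨univ, isOpen_univ, mem_univ _, 1, fun _ x => (x : ℂ) ^ k, fun _ => powDerivOp m,
    fun _ x => (-1) ^ m * h x, fun _ => ⟨(contDiff_ofReal_pow k).contDiffOn,
      funVanishesToOrder_ofReal_pow k⟩, fun _ => isTangential_powDerivOp m, fun _ K _ hK => ?_,
    fun φ _ _ => ?_⟩
  · obtain ⟨M, hM⟩ := hK.isBounded.exists_norm_le
    refine memLp_top_of_bound (hm.const_mul _).aestronglyMeasurable (|B| * |M| ^ (1 / 2 : ℝ))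
      ((ae_restrict_iff' hK.measurableSet).2 (Eventually.of_forall fun x hx => ?_))
    rw [norm_mul, norm_pow, norm_neg, norm_one, one_pow, one_mul]
    refine (hB x).trans ?_
    have hxM : |x| ≤ |M| := (hM x hx).trans (le_abs_self M)
    have := Real.rpow_le_rpow (abs_nonneg x) hxM (show (0 : ℝ) ≤ 1 / 2 by norm_num)
    exact mul_le_mul (le_abs_self B) this (by positivity) (abs_nonneg B)
  · rw [Fin.sum_univ_one, hτ]
    refine integral_congr_ae (Eventually.of_forall fun x => ?_)
    simp only [powDerivOp_transpose, euler_coe, mulX_iterate_apply]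
    have : ((-1 : ℂ) ^ m) * (-1) ^ m = 1 := by rw [← mul_pow]; simp
    linear_combination (-h x * iteratedDeriv m
      (fun y : ℝ => (y : ℂ) ^ m * ((y : ℂ) ^ k * φ y)) x) * this

lemma IsFourierSeries.vanishesToOrder
    (hpar : ∀ n : ℕ, 1 ≤ n → a (-(n : ℤ)) = (-1) ^ δ.val * a n)
    (hb : PolySeq (coef ν a)) (hτ : IsFourierSeries ν a τ) {H1 H2 : ℂ → ℂ}
    (h1 : Differentiable ℂ H1) (h2 : Differentiable ℂ H2) (hs1 : StripBounded H1)
    (hs2 : StripBounded H2) {c : ℝ} (hc1 : ∀ s : ℂ, c < s.re → H1 s = LSeries (coef ν a) s)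
    (hc2 : ∀ s : ℂ, c < s.re → H2 s = G δ s * LSeries (coef ν a) s) (k : ℕ) :
    VanishesToOrder τ k := by
  -- With this abscissa `1 - s` has real part `k + 3/2`: multiplication by `x^k` takes up `k`,
  -- leaving the line of `le_norm_eulerPoly`.
  set ρ : ℝ := -(k + 1 / 2) with hρ
  obtain ⟨C, hC, N, hN⟩ := hs2 (k + 1 / 2)
  -- `N` offsets the growth of `H2` and `2` more powers make the density integrable.
  set m := N + 2 with hm
  set P : ℝ → ℂ := fun t => eulerPoly m (vline (3 / 2) (-t)) with hP
  have hP0 : ∀ t, 0 < ‖P t‖ := fun t =>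
    lt_of_lt_of_le (by positivity) (le_norm_eulerPoly m t)
  set q : ℝ → ℂ := fun t => H2 (vline ρ t) / P t with hq
  have hqc : Continuous q := (h2.continuous.comp (continuous_vline ρ)).div
    ((continuous_eulerPoly m).comp ((continuous_vline _).comp continuous_neg))
    fun t => norm_pos_iff.1 (hP0 t)
  have hqi : Integrable q := by
    refine integrable_of_norm_le_inv_sq (C := C * 3 ^ m) hqc fun t => ?_
    have e1 : ‖H2 (vline ρ t)‖ ≤ C * (1 + |t|) ^ N := by
      have := hN (vline ρ t) (by
        rw [vline_re, hρ, abs_neg, abs_of_nonneg (by positivity)])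
      rwa [vline_im] at this
    rw [hq, norm_div, div_le_iff₀ (hP0 t)]
    have hpos : 0 < 1 + |t| := by positivity
    calc _ ≤ C * (1 + |t|) ^ N := e1
      _ = C * 3 ^ m * ((1 + |t|) ^ 2)⁻¹ * ((1 + |t|) / 3) ^ m := by
          rw [div_pow, hm, pow_add (1 + |t|)]; field_simp
      _ ≤ _ := by gcongr; exact le_norm_eulerPoly m t
  have key : ∀ φ : 𝓢(ℝ, ℂ), τ φ = (2 * Real.pi : ℂ)⁻¹ *
      ∫ x in Ioi 0, barnes q x * euler m (mulX^[k] (parPartS δ φ)) x := fun φ => by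
    rw [hτ.eq_integral hpar hb h1 h2 hs1 hs2 hc1 hc2 (ρ := ρ)
      (by rw [hρ]; linarith [(Nat.cast_nonneg k : (0 : ℝ) ≤ k)]), ← integral_mul_mellin hqc hqi]
    congr 1
    refine integral_congr_ae (Eventually.of_forall fun t => ?_)
    have e1 : 1 - vline ρ t = vline (3 / 2) (-t) + k := by
      simp only [vline, hρ]; push_cast; ring
    have e2 : P t ≠ 0 := norm_pos_iff.1 (hP0 t)
    simp only [hq]
    rw [e1, ← mellin_mulX_iterate, mellin_euler _ _ (by rw [vline_re]; norm_num)]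
    change _ = H2 (vline ρ t) / P t * (P t * _)
    field_simp
  -- The representation lives on `x > 0` and involves the parity part of `φ`. Unfolding it to the
  -- whole line replaces `W` by `W x + ε * W (-x)`, with `ε` the sign from `euler_mulX_parPartS`.
  set W : ℝ → ℂ := (Ioi 0).indicator fun x => (2 * Real.pi : ℂ)⁻¹ * barnes q x with hW
  have hWm : StronglyMeasurable W :=
    ((stronglyMeasurable_barnes hqc).const_mul _).indicator measurableSet_Ioi
  set B : ℝ := ‖(2 * Real.pi : ℂ)⁻¹‖ * ∫ t, ‖q t‖ with hB
  have hB0 : 0 ≤ B := mul_nonneg (norm_nonneg _) (integral_nonneg fun _ => norm_nonneg _)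
  have hWB : ∀ x, ‖W x‖ ≤ B * |x| ^ (1 / 2 : ℝ) := fun x => by
    rcases lt_or_ge 0 x with hx | hx
    · rw [hW, indicator_of_mem (show x ∈ Ioi 0 from hx), norm_mul, abs_of_pos hx, hB, mul_assoc]
      gcongr
      exact norm_barnes_le q hx
    · rw [hW, indicator_of_notMem (by simpa using hx), norm_zero]
      positivity
  set ε : ℂ := sgn δ * (-1) ^ k with hε
  refine vanishesToOrder_of_eq_integral (m := m) (h := fun x => W x + ε * W (-x))
    (B := B + ‖ε‖ * B) (hWm.add ((hWm.comp_measurable measurable_neg).const_mul ε)) (fun x => ?_)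
    fun φ => ?_
  · have e1 := hWB (-x)
    rw [abs_neg] at e1
    calc _ ≤ ‖W x‖ + ‖ε‖ * ‖W (-x)‖ := by rw [← norm_mul]; exact norm_add_le _ _
      _ ≤ B * |x| ^ (1 / 2 : ℝ) + ‖ε‖ * (B * |x| ^ (1 / 2 : ℝ)) := by
        gcongr; exact hWB x
      _ = _ := by ring
  · set E : 𝓢(ℝ, ℂ) := euler m (mulX^[k] φ) with hE
    have hWE : ∀ u : 𝓢(ℝ, ℂ), Integrable fun x => W x * u x := fun u => by
      refine Integrable.mono' (g := fun x => B * (‖u x‖ * |x| ^ (1 / 2 : ℝ)))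
        ?_ (hWm.aestronglyMeasurable.mul u.continuous.aestronglyMeasurable)
        (Eventually.of_forall fun x => ?_)
      · have := (integrable_schwartz_mul_rpow u (r := -(1 / 2)) (by norm_num)).const_mul B
        rwa [neg_neg] at this
      · rw [norm_mul]
        calc _ ≤ B * |x| ^ (1 / 2 : ℝ) * ‖u x‖ := by gcongr; exact hWB x
          _ = _ := by ring
    have hint : Integrable fun x => (W x + ε * W (-x)) * E x := by
      have e1 := ((hWE (dil (-1) E)).comp_neg).const_mul ε
      refine ((hWE E).add e1).congr (Eventually.of_forall fun x => ?_)
      simp only [Pi.add_apply]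
      rw [dil_apply (by norm_num), neg_one_mul, neg_neg]
      ring
    rw [integral_eq_integral_Ioi_add hint, key, ← integral_const_mul]
    refine setIntegral_congr_fun measurableSet_Ioi fun x hx => ?_
    have hx : 0 < x := hx
    have w1 : W x = (2 * Real.pi : ℂ)⁻¹ * barnes q x := indicator_of_mem hx _
    have w2 : W (-x) = 0 := indicator_of_notMem (by simpa using hx.le) _
    simp only [euler_mulX_parPartS, neg_neg, w1, w2, ← hE, ← hε]
    ring

lemma IsFourierSeries.vanishesToInfiniteOrder
    (hpar : ∀ n : ℕ, 1 ≤ n → a (-(n : ℤ)) = (-1) ^ δ.val * a n)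
    (hb : PolySeq (coef ν a)) (hτ : IsFourierSeries ν a τ)
    (h1 : ExtendsToEntireOfModerateGrowth (LSeries (coef ν a)))
    (h2 : ExtendsToEntireOfModerateGrowth fun s => G δ s * LSeries (coef ν a) s) :
    VanishesToInfiniteOrder τ := by
  obtain ⟨H1, hd1, hm1, c1, hc1⟩ := h1
  obtain ⟨H2, hd2, hm2, c2, hc2⟩ := h2
  exact fun k => hτ.vanishesToOrder hpar hb hd1 hd2 (hm1.stripBounded hd1.continuous)
    (hm2.stripBounded hd2.continuous) (c := max c1 c2)
    (fun s hs => hc1 s ((le_max_left _ _).trans_lt hs))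
    (fun s hs => hc2 s ((le_max_right _ _).trans_lt hs)) k

end InfOrder

end

theorem mainTheorem9 (ν : ℂ) (δ : ZMod 2) (a : ℤ → ℂ)
    (hpar : ∀ n : ℕ, 1 ≤ n → a (-(n : ℤ)) = (-1) ^ δ.val * a n)
    (hgrowth : ∃ (C : ℝ) (N : ℕ), ∀ n : ℕ, 1 ≤ n → ‖a n‖ ≤ C * (n : ℝ) ^ N) :
    (∃ c : ℝ, ∀ s : ℂ, c < s.re → LSeriesSummable (fun n : ℕ => a n) s) ∧
    (∃ τ : 𝓢'(ℝ, ℂ), InfOrder.IsFourierSeries ν a τ ∧ InfOrder.HasParity δ τ) ∧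
    (∀ τ : 𝓢'(ℝ, ℂ), InfOrder.IsFourierSeries ν a τ →
      (InfOrder.VanishesToInfiniteOrder τ ↔
        InfOrder.ExtendsToEntireOfModerateGrowth (LSeries (fun n : ℕ => a n)) ∧
        InfOrder.ExtendsToEntireOfModerateGrowth
          (fun s => InfOrder.G δ (s - ν) * LSeries (fun n : ℕ => a n) s))) := by
  have hb := InfOrder.polySeq_coef ν hgrowth
  refine ⟨InfOrder.PolySeq.exists_lseriesSummable hgrowth, ?_, fun τ hτ => ⟨fun hv => ⟨?_, ?_⟩,
    fun h => ?_⟩⟩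
  · obtain ⟨τ, hτ⟩ := InfOrder.exists_isFourierSeries hpar hb
    exact ⟨τ, hτ, hτ.hasParity hpar⟩
  -- Translating by `-ν` undoes the shift in `lseries_coef`, and turns `G δ s` into `G δ (s - ν)` in
  -- the next bullet.
  · have h := (hτ.extends_lseries hpar hb hv).comp_add (-ν)
    simpa only [InfOrder.lseries_coef, neg_add_cancel_right] using h
  · have h := (hτ.extends_G_mul_lseries hpar hb hv).comp_add (-ν)
    simpa only [InfOrder.lseries_coef, neg_add_cancel_right, ← sub_eq_add_neg,
      sub_add_cancel] using h
  · refine hτ.vanishesToInfiniteOrder hpar hb ?_ ?_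
    · simpa only [← InfOrder.lseries_coef] using h.1.comp_add ν
    · simpa only [← InfOrder.lseries_coef, add_sub_cancel_right] using h.2.comp_add ν
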